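/- Let $M$ be a connected (Hausdorff, finite-dimensional) complex manifold and let $(U,f)$ be a path element in $M$, i.e. $U$ is a nonempty connected open subset of the extended complex plane $\mathbb P^1$ and $f\colon U\to M$ is holomorphic. A \emph{standard} (resp. \emph{regular}) \emph{analytical continuation} of $(U,f)$ is a quadruple $(S,\pi,j,F)$, where $S$ is a connected Riemann surface, $\pi\colon S\to\mathbb P^1$ is a nonconstant holomorphic map (resp. a holomorphic map with nowhere vanishing differential), $j\colon U\to S$ is a holomorphic immersion with $\pi\circ j=\mathrm{id}_U$, and $F\colon S\to M$ is holomorphic with $F\circ j=f$. A \emph{morphism} $(S,\pi,j,F)\to(S',\pi',j',F')$ is a holomorphic map $h\colon S\to S'$ with $h\circ j=j'$. The \emph{standard} (resp. \emph{regular}) \emph{Riemann surface} of $(U,f)$ is a standard (resp. regular) analytical continuation of $(U,f)$ into which every standard (resp. regular) analytical continuation of $(U,f)$ admits a morphism. For $z_0\in\mathbb P^1$ let $D(z_0,r)$ be the open disc of radius $r$ about $z_0$ (in the coordinate $1/z$ about $0$ if $z_0=\infty$). A \emph{superstructural singularity} over $z_0$ of a continuation $(S,\pi,j,F)$ is a decreasing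 sequence $(V_k)_{k\ge K}$, $K\ge1$, of open subsets of $S$ such that, for some $n\ge 1$ and every $k\ge K$, $V_k$ is a connected component of $\pi^{-1}(D(z_0,1/k)\setminus\{z_0\})$ and $\pi|_{V_k}\colon V_k\to D(z_0,1/k)\setminus\{z_0\}$ is an $n$-sheeted covering, and such that $\bigcap_{k\ge K}\overline{V_k}=\emptyset$; two such sequences that agree from some index on are identified. It is \emph{removable} if $\bigcap_{k\ge K}\overline{F(V_k)}=\{\eta\}$ for some $\eta\in M$. \textbf{Theorem.} Every path element $(U,f)$ admits a regular Riemann surface $(\widehat S,\widehat\pi,\widehat j,\widehat F)$ and a standard Riemann surface $(\breve S,\breve\pi,\breve j,\breve F)$ such that the latter is obtained from the former by adding the removable superstructural singularities. That is, up to a homeomorphism, $\breve S$ is the disjoint union of $\widehat S$ and the set of removable superstructural singularities of $(\widehat S,\widehat\pi,\widehat j,\widehat F)$, topologized so that $\widehat S$ is an open subspace and the sets $V_k\cup\{p\}$ form a neighbourhood basis of the singularity $p=(V_k)_{k\ge K}$; the inclusion $\iota\colon\widehat S\to\breve S$ is holomorphic, $\breve\pi\circ\iota=\widehat\pi$, $\breve\pi(p)=z_0$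 for each added singularity $p$ over $z_0$, $\breve j=\iota\circ\widehat j$ and $\breve F\circ\iota=\widehat F$. Moreover $\breve S$ is second countable. -/

import Mathlib

open Set Topology
open scoped Manifold ContDiff

universe e u v w

noncomputable section

namespace PathCont

/-! ### The extended complex plane as a Riemann surface -/

/-- The extended complex plane `ℙ¹`, i.e. the one-point compactification of `ℂ`. -/
abbrev Sphere : Type := OnePoint ℂ

namespace Sphere

/-- The inversion `z ↦ 1 / z` of the extended complex plane, exchanging `0` and `∞`. -/
def inv : Sphere → Sphere
  | none => ((0 : ℂ) : Sphere)
  | some z => if z = 0 then OnePoint.infty else ((z⁻¹ : ℂ) : Sphere)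

theorem inv_infty : inv OnePoint.infty = ((0 : ℂ) : Sphere) := rfl

theorem inv_coe (z : ℂ) :
    inv (z : Sphere) = if z = 0 then OnePoint.infty else ((z⁻¹ : ℂ) : Sphere) := rfl

theorem inv_zero : inv ((0 : ℂ) : Sphere) = OnePoint.infty := by simp [inv_coe]

theorem inv_coe_of_ne {z : ℂ} (hz : z ≠ 0) : inv (z : Sphere) = ((z⁻¹ : ℂ) : Sphere) := by
  simp [inv_coe, hz]

theorem inv_inv (x : Sphere) : inv (inv x) = x := by
  induction x using OnePoint.rec with
  | infty => rw [inv_infty, inv_zero]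
  | coe z =>
    by_cases hz : z = 0
    · subst hz; rw [inv_zero, inv_infty]
    · rw [inv_coe_of_ne hz, inv_coe_of_ne (inv_ne_zero hz), _root_.inv_inv]

theorem continuous_inv : Continuous inv := by
  rw [continuous_iff_continuousAt]
  intro x
  induction x using OnePoint.rec with
  | infty =>
    rw [OnePoint.continuousAt_infty', inv_infty, Filter.coclosedCompact_eq_cocompact,
      ← Metric.cobounded_eq_cocompact]
    refine ((OnePoint.continuous_coe.tendsto (0 : ℂ)).comp
      (Filter.tendsto_inv₀_cobounded (α := ℂ))).congr' ?_
    filter_upwards [Bornology.eventually_ne_cobounded (0 : ℂ)] with z hz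
    simp [inv_coe_of_ne hz]
  | coe z =>
    rw [OnePoint.continuousAt_coe]
    by_cases hz : z = 0
    · subst hz
      rw [continuousAt_iff_punctured_nhds]
      have h1 : Filter.Tendsto (fun w : ℂ => ((w⁻¹ : ℂ) : Sphere)) (𝓝[≠] 0)
          (𝓝 OnePoint.infty) := by
        have := OnePoint.tendsto_coe_infty (X := ℂ)
        rw [Filter.coclosedCompact_eq_cocompact, ← Metric.cobounded_eq_cocompact] at this
        exact this.comp (Filter.tendsto_inv₀_nhdsNE_zero (α := ℂ))
      have h2 : (inv ∘ ((↑) : ℂ → Sphere)) 0 = OnePoint.infty := inv_zero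
      rw [h2]
      refine h1.congr' ?_
      filter_upwards [self_mem_nhdsWithin] with w hw
      simp [inv_coe_of_ne hw]
    · have h1 : ContinuousAt (fun w : ℂ => ((w⁻¹ : ℂ) : Sphere)) z :=
        OnePoint.continuous_coe.continuousAt.comp (continuousAt_inv₀ hz)
      refine h1.congr ?_
      filter_upwards [isOpen_ne.mem_nhds hz] with w hw
      simp [inv_coe_of_ne hw]

/-- Inversion as a homeomorphism. -/
def invHomeomorph : Sphere ≃ₜ Sphere where
  toFun := inv
  invFun := inv
  left_inv := inv_inv
  right_inv := inv_inv
  continuous_toFun := continuous_inv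
  continuous_invFun := continuous_inv

/-- The affine chart `ℙ¹ \ {∞} → ℂ`, `z ↦ z`. -/
def chartZero : OpenPartialHomeomorph Sphere ℂ :=
  (OnePoint.isOpenEmbedding_coe.toOpenPartialHomeomorph ((↑) : ℂ → Sphere)).symm

/-- The chart at infinity `ℙ¹ \ {0} → ℂ`, `z ↦ 1 / z`. -/
def chartInfty : OpenPartialHomeomorph Sphere ℂ :=
  invHomeomorph.toOpenPartialHomeomorph.trans chartZero

/-- The extended complex plane with its two standard charts `z` and `1 / z`. -/
instance instChartedSpace : ChartedSpace ℂ Sphere where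
  atlas := {chartZero, chartInfty}
  chartAt
    | none => chartInfty
    | some _ => chartZero
  mem_chart_source := by
    intro x
    induction x using OnePoint.rec with
    | infty =>
      change OnePoint.infty ∈ chartInfty.source
      simp [chartInfty, chartZero, invHomeomorph, inv_infty]
    | coe z =>
      change (z : Sphere) ∈ chartZero.source
      simp [chartZero]
  chart_mem_atlas := by
    intro x
    induction x using OnePoint.rec with
    | infty => exact Or.inr rfl
    | coe z => exact Or.inl rfl

theorem chartZero_symm_apply (z : ℂ) : chartZero.symm z = (z : Sphere) := by
  simp [chartZero]

theorem chartZero_coe (z : ℂ) : chartZero (z : Sphere) = z := by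
  rw [← chartZero_symm_apply]
  exact chartZero.right_inv (by simp [chartZero])

theorem chartZero_source : chartZero.source = range ((↑) : ℂ → Sphere) := by
  simp [chartZero]

theorem coe_mem_chartZero_source (z : ℂ) : (z : Sphere) ∈ chartZero.source := by
  rw [chartZero_source]; exact mem_range_self z

/-- The two standard charts are holomorphically compatible. -/
instance instIsManifold : IsManifold 𝓘(ℂ) ω Sphere := by
  apply isManifold_of_contDiffOn
  have key : ∀ s : Set ℂ, (∀ z ∈ s, z ≠ 0) → ∀ g : ℂ → ℂ, (∀ z ∈ s, g z = z⁻¹) →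
      ContDiffOn ℂ ω g s := by
    intro s hs g hg
    refine ContDiffOn.congr (f := fun z : ℂ => z⁻¹) ?_ hg
    exact contDiffOn_id.inv hs
  rintro e e' (rfl | rfl) (rfl | rfl)
  · refine contDiffOn_id.congr ?_
    intro z _
    simp [chartZero_symm_apply, chartZero_coe]
  · have hne : ∀ z : ℂ, chartZero.symm z ∈ chartInfty.source → z ≠ 0 := by
      rintro z hz rfl
      rw [chartZero_symm_apply] at hz
      simp [chartInfty, chartZero_source, invHomeomorph, inv_zero] at hz
    refine key _ ?_ _ ?_
    · intro z hz
      exact hne z (by simpa using hz.1.2)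
    · intro z hz
      have h0 := hne z (by simpa using hz.1.2)
      simp [chartInfty, invHomeomorph, chartZero_symm_apply, inv_coe_of_ne h0, chartZero_coe]
  · have hne : ∀ z : ℂ, chartInfty.symm z ∈ chartZero.source → z ≠ 0 := by
      rintro z hz rfl
      have h1 : chartInfty.symm 0 = OnePoint.infty := by
        simp [chartInfty, invHomeomorph, chartZero_symm_apply, inv_zero]
      rw [h1] at hz
      simp [chartZero_source] at hz
    refine key _ ?_ _ ?_
    · intro z hz
      exact hne z (by simpa using hz.1.2)
    · intro z hz
      have h0 := hne z (by simpa using hz.1.2)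
      simp [chartInfty, invHomeomorph, chartZero_symm_apply, inv_coe_of_ne h0, chartZero_coe]
  · refine contDiffOn_id.congr ?_
    intro z _
    simp [chartInfty, invHomeomorph, chartZero_symm_apply, inv_inv, chartZero_coe]

/-- The open disc `D(z₀, r)` of the extended complex plane; for `z₀ = ∞` it is the disc of radius
`r` around the origin in the coordinate `1 / z`. -/
def disc : Sphere → ℝ → Set Sphere
  | none, r => inv ⁻¹' (((↑) : ℂ → Sphere) '' Metric.ball 0 r)
  | some z, r => ((↑) : ℂ → Sphere) '' Metric.ball z r

/-- The punctured disc `D(z₀, r) \ {z₀}`. -/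
def puncturedDisc (z₀ : Sphere) (r : ℝ) : Set Sphere := disc z₀ r \ {z₀}

end Sphere

/-! ### Analytical continuations of path elements

A path element `(U, f)` in a complex manifold `M` consists of a connected (nonempty) open subset `U`
of the extended complex plane and a holomorphic map `f : U → M`. -/

section Continuation

variable {E : Type e} [NormedAddCommGroup E] [NormedSpace ℂ E]
  {M : Type u} [TopologicalSpace M] [ChartedSpace E M]

/-- The data `(S, π, j, F)` of an analytical continuation of the path element `(U, f)`: a connected
Riemann surface `S`, a holomorphic map `π : S → ℙ¹`, a holomorphic map `j : U → S` with
`π ∘ j = id` (so `j` is automatically an injective immersion, and `U ⊆ π(S)`), and a holomorphic map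
`F : S → M` with `F ∘ j = f`.  The condition on `π` that distinguishes standard from regular
continuations is imposed by `IsStandard` and `IsRegular` below. -/
structure Continuation (E : Type e) [NormedAddCommGroup E] [NormedSpace ℂ E]
    {M : Type u} [TopologicalSpace M] [ChartedSpace E M]
    (U : TopologicalSpace.Opens Sphere) (f : U → M) where
  S : Type w
  [topS : TopologicalSpace S]
  [t2S : T2Space S]
  [connS : ConnectedSpace S]
  [chartedS : ChartedSpace ℂ S]
  [manifoldS : IsManifold 𝓘(ℂ) ω S]
  proj : S → Sphere
  proj_holo : MDifferentiable 𝓘(ℂ) 𝓘(ℂ) proj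
  j : U → S
  j_holo : MDifferentiable 𝓘(ℂ) 𝓘(ℂ) j
  proj_j : ∀ z : U, proj (j z) = (z : Sphere)
  F : S → M
  F_holo : MDifferentiable 𝓘(ℂ) 𝓘(ℂ, E) F
  F_j : ∀ z : U, F (j z) = f z

attribute [instance] Continuation.topS Continuation.t2S Continuation.connS
  Continuation.chartedS Continuation.manifoldS

namespace Continuation

variable {U : TopologicalSpace.Opens Sphere} {f : U → M}

/-- A standard analytical continuation: the projection is nonconstant (branching is allowed). -/
def IsStandard (Q : Continuation.{e, u, w} E U f) : Prop :=
  ∃ x y : Q.S, Q.proj x ≠ Q.proj y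

/-- A regular analytical continuation: the projection has maximum rank everywhere. -/
def IsRegular (Q : Continuation.{e, u, w} E U f) : Prop :=
  ∀ x : Q.S, mfderiv 𝓘(ℂ) 𝓘(ℂ) Q.proj x ≠ 0

/-- A morphism of analytical continuations of the same path element: a holomorphic map of the
Riemann surfaces compatible with the immersions of `U`. -/
def IsMorphism (Q : Continuation.{e, u, w} E U f) {Q' : Continuation E U f} (h : Q.S → Q'.S) : Prop :=
  MDifferentiable 𝓘(ℂ) 𝓘(ℂ) h ∧ ∀ z : U, h (Q.j z) = Q'.j z

/-- `Q` is the regular Riemann surface (maximal regular analytical continuation) of `(U, f)`. -/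
def IsRegularRiemannSurface (Q : Continuation.{e, u, w} E U f) : Prop :=
  Q.IsRegular ∧ ∀ Q' : Continuation.{e, u, v} E U f, Q'.IsRegular →
    ∃ h : Q'.S → Q.S, Q'.IsMorphism h

/-- `Q` is the standard Riemann surface (maximal standard analytical continuation) of `(U, f)`. -/
def IsStandardRiemannSurface (Q : Continuation.{e, u, w} E U f) : Prop :=
  Q.IsStandard ∧ ∀ Q' : Continuation.{e, u, v} E U f, Q'.IsStandard →
    ∃ h : Q'.S → Q.S, Q'.IsMorphism h

/-! ### Superstructural singularities -/

/-- A sequence `V_K ⊇ V_{K+1} ⊇ ⋯` of open sets representing a superstructural singularity over the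
point `z₀` with `n` sheets.  Values `V k` with `k < K` are irrelevant. -/
structure SingularSequence (Q : Continuation.{e, u, w} E U f) where
  K : ℕ
  K_pos : 0 < K
  V : ℕ → Set Q.S
  n : ℕ
  n_pos : 0 < n
  z₀ : Sphere
  isOpen : ∀ k ≥ K, IsOpen (V k)
  decreasing : ∀ k ≥ K, V (k + 1) ⊆ V k
  /-- `V k` is a connected component of `π⁻¹(D(z₀, 1/k) \ {z₀})`. -/
  component : ∀ k ≥ K, ∃ x ∈ Q.proj ⁻¹' Sphere.puncturedDisc z₀ (1 / k),
    V k = connectedComponentIn (Q.proj ⁻¹' Sphere.puncturedDisc z₀ (1 / k)) x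
  /-- `π : V k → D(z₀, 1/k) \ {z₀}` is an `n`-sheeted covering. -/
  covering : ∀ k ≥ K, ∃ h : MapsTo Q.proj (V k) (Sphere.puncturedDisc z₀ (1 / k)),
    IsCoveringMap h.restrict ∧ ∀ z, (h.restrict ⁻¹' {z}).ncard = n
  iInter_closure : ⋂ k ≥ K, closure (V k) = ∅

/-- Two sequences represent the same singularity if they agree from some index on. -/
instance SingularSequence.setoid (Q : Continuation.{e, u, w} E U f) : Setoid Q.SingularSequence where
  r s t := ∃ L, ∀ k ≥ L, s.V k = t.V k
  iseqv :=
    { refl := fun _ => ⟨0, fun _ _ => rfl⟩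
      symm := fun ⟨L, h⟩ => ⟨L, fun k hk => (h k hk).symm⟩
      trans := fun ⟨L, h⟩ ⟨L', h'⟩ => ⟨max L L', fun k hk =>
        (h k (le_trans (le_max_left _ _) hk)).trans (h' k (le_trans (le_max_right _ _) hk))⟩ }

/-- The superstructural singularities of `Q`. -/
def SuperstructuralSingularity (Q : Continuation.{e, u, w} E U f) : Type w :=
  Quotient (SingularSequence.setoid Q)

/-- The singularity is removable for `F`: the closures of the sets `F(V k)` meet in exactly one
point of `M`. -/
def SuperstructuralSingularity.IsRemovable {Q : Continuation.{e, u, w} E U f}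
    (p : Q.SuperstructuralSingularity) : Prop :=
  ∃ s : Q.SingularSequence, Quotient.mk _ s = p ∧
    ∃ η : M, ⋂ k ≥ s.K, closure (Q.F '' s.V k) = {η}

/-- The Riemann surface of `Q` together with its removable superstructural singularities. -/
inductive RemovableCompletion (Q : Continuation.{e, u, w} E U f) : Type w
  | point (x : Q.S) : RemovableCompletion Q
  | singular (p : Q.SuperstructuralSingularity) (hp : p.IsRemovable) : RemovableCompletion Q

theorem SingularSequence.antitone {Q : Continuation.{e, u, w} E U f} (s : Q.SingularSequence)
    {k l : ℕ} (hk : s.K ≤ k) (hkl : k ≤ l) : s.V l ⊆ s.V k := by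
  induction l, hkl using Nat.le_induction with
  | base => exact subset_rfl
  | succ l hl ih => exact (s.decreasing l (hk.trans hl)).trans ih

/-- The topology of the completion: the surface is an open subspace, and the sets `V k ∪ {p}` form a
neighbourhood basis at the singularity `p` represented by the sequence `V`. -/
instance (Q : Continuation.{e, u, w} E U f) : TopologicalSpace Q.RemovableCompletion where
  IsOpen W := IsOpen {x : Q.S | RemovableCompletion.point x ∈ W} ∧
    ∀ (s : Q.SingularSequence) (hs : SuperstructuralSingularity.IsRemovable (Quotient.mk _ s)),
      RemovableCompletion.singular (Quotient.mk _ s) hs ∈ W →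
        ∃ k ≥ s.K, ∀ x ∈ s.V k, RemovableCompletion.point x ∈ W
  isOpen_univ := ⟨by simp, fun s _ _ => ⟨s.K, le_rfl, fun _ _ => mem_univ _⟩⟩
  isOpen_inter := by
    rintro W W' ⟨h1, h2⟩ ⟨h1', h2'⟩
    refine ⟨h1.inter h1', fun s hs hW => ?_⟩
    obtain ⟨k, hk, hV⟩ := h2 s hs hW.1
    obtain ⟨k', hk', hV'⟩ := h2' s hs hW.2
    refine ⟨max k k', hk.trans (le_max_left _ _), fun x hx => ⟨hV x ?_, hV' x ?_⟩⟩
    · exact s.antitone hk (le_max_left _ _) hx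
    · exact s.antitone hk' (le_max_right _ _) hx
  isOpen_sUnion := by
    intro C hC
    refine ⟨?_, ?_⟩
    · have : {x : Q.S | RemovableCompletion.point x ∈ ⋃₀ C} =
          ⋃ W ∈ C, {x : Q.S | RemovableCompletion.point x ∈ W} := by
        ext x; simp
      rw [this]
      exact isOpen_biUnion fun W hW => (hC W hW).1
    · rintro s hs ⟨W, hW, hsW⟩
      obtain ⟨k, hk, hV⟩ := (hC W hW).2 s hs hsW
      exact ⟨k, hk, fun x hx => ⟨W, hW, hV x hx⟩⟩

/-- `Q'` is obtained from `Q` by adding the removable superstructural singularities of `Q`: the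
surface of `Q'` is, up to a homeomorphism `e`, the completion of the surface of `Q`, which sits in
it holomorphically; `π'` and `F'` extend `π` and `F`, `j'` is `j` followed by the inclusion, and
`π'` sends a singularity to the point it lies over. -/
def IsRemovableExtension (Q : Continuation.{e, u, w} E U f) (Q' : Continuation E U f) : Prop :=
  ∃ e : Q.RemovableCompletion ≃ₜ Q'.S,
    MDifferentiable 𝓘(ℂ) 𝓘(ℂ) (fun x : Q.S => e (.point x)) ∧
    (∀ x : Q.S, Q'.proj (e (.point x)) = Q.proj x) ∧
    (∀ (s : Q.SingularSequence) (hs : SuperstructuralSingularity.IsRemovable (Quotient.mk _ s)),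
      Q'.proj (e (.singular (Quotient.mk _ s) hs)) = s.z₀) ∧
    (∀ z : U, Q'.j z = e (.point (Q.j z))) ∧
    ∀ x : Q.S, Q'.F (e (.point x)) = Q.F x

end Continuation

end Continuation

end PathCont

end

/-! The regular surface is a connected component of the étale space of germs of holomorphic maps
from the sphere to `M`. The base-point map of this space is a local homeomorphism, so the charts of
the sphere pull back along it, and the identity theorem makes the space Hausdorff. On a regular
continuation the projection is locally invertible, and sending `x` to the germ of `F ∘ π⁻¹` at `π x`
is a continuous map to the germ space. Compatibility with `j` puts its image into the chosen
component. This is `exists_germ_lift` and `exists_regular_lift`.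

For the standard surface, the key fact is that a connected finite covering of a punctured disc is a
power map (`exists_root_of_isCoveringMap`). A singularity can thus be filled in as the origin of a
root coordinate (`exists_singular_chart`). Removability makes the extended `F` continuous
(`continuous_F`), and Riemann's removable singularity theorem then makes it holomorphic.

For maximality, let `Q'` be a standard continuation. Its critical points are isolated, so their
complement is connected and maps to the regular surface. Near a critical point `x₀`, the image of a
small punctured neighbourhood is a whole component of the preimage of a punctured disc and covers
that disc finitely. Either these images close up at a point of the regular surface, or they form a
superstructural singularity, which is removable because `F'` is continuous at `x₀`. In both cases
the map has a limit at `x₀` (`exists_tendsto_point`), and the extension by limits is holomorphic.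
Second countability is the Poincaré–Volterra theorem, since the projection has discrete fibres. -/

noncomputable section
namespace PathCont

open Filter

/-! ### Holomorphic maps between Riemann surfaces and into complex manifolds -/

section Holomorphic

variable {X : Type*} [TopologicalSpace X] [ChartedSpace ℂ X]
  {E : Type*} [NormedAddCommGroup E] [NormedSpace ℂ E]
  {N : Type*} [TopologicalSpace N] [ChartedSpace E N]

theorem tendsto_chart_symm_punctured (x₀ : X) :
    Tendsto (chartAt ℂ x₀).symm (𝓝[≠] (chartAt ℂ x₀ x₀)) (𝓝[≠] x₀) := by
  set φ := chartAt ℂ x₀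
  have hx : x₀ ∈ φ.source := mem_chart_source ℂ x₀
  refine tendsto_nhdsWithin_iff.2 ⟨?_, ?_⟩
  · have := (φ.continuousAt_symm (φ.map_source hx)).tendsto
    rw [φ.left_inv hx] at this
    exact this.mono_left nhdsWithin_le_nhds
  · filter_upwards [self_mem_nhdsWithin,
      nhdsWithin_le_nhds (φ.open_target.mem_nhds (φ.map_source hx))] with w hw hwt h
    exact hw (by rw [mem_singleton_iff, ← φ.right_inv hwt, mem_singleton_iff.1 h])

theorem tendsto_chart_punctured (x₀ : X) :
    Tendsto (chartAt ℂ x₀) (𝓝[≠] x₀) (𝓝[≠] (chartAt ℂ x₀ x₀)) := by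
  set φ := chartAt ℂ x₀
  have hx : x₀ ∈ φ.source := mem_chart_source ℂ x₀
  refine tendsto_nhdsWithin_iff.2 ⟨(φ.continuousAt hx).tendsto.mono_left nhdsWithin_le_nhds, ?_⟩
  filter_upwards [self_mem_nhdsWithin, nhdsWithin_le_nhds (φ.open_source.mem_nhds hx)]
    with y hy hys h
  exact hy (φ.injOn hys hx h)

theorem eventually_nhds_of_chart {x₀ : X} {P : X → Prop}
    (h : ∀ᶠ w in 𝓝 (chartAt ℂ x₀ x₀), P ((chartAt ℂ x₀).symm w)) : ∀ᶠ x in 𝓝 x₀, P x := by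
  have hx : x₀ ∈ (chartAt ℂ x₀).source := mem_chart_source ℂ x₀
  filter_upwards [((chartAt ℂ x₀).continuousAt hx).eventually h,
    (chartAt ℂ x₀).open_source.mem_nhds hx] with x h1 h2
  rwa [(chartAt ℂ x₀).left_inv h2] at h1

theorem eventually_punctured_of_chart {x₀ : X} {P : X → Prop}
    (h : ∀ᶠ w in 𝓝[≠] (chartAt ℂ x₀ x₀), P ((chartAt ℂ x₀).symm w)) : ∀ᶠ x in 𝓝[≠] x₀, P x := by
  filter_upwards [(tendsto_chart_punctured x₀).eventually h,
    nhdsWithin_le_nhds ((chartAt ℂ x₀).open_source.mem_nhds (mem_chart_source ℂ x₀))] with x h1 h2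
  rwa [(chartAt ℂ x₀).left_inv h2] at h1

theorem tendsto_chart_symm (x₀ : X) :
    Tendsto (chartAt ℂ x₀).symm (𝓝 (chartAt ℂ x₀ x₀)) (𝓝 x₀) := by
  have hx : x₀ ∈ (chartAt ℂ x₀).source := mem_chart_source ℂ x₀
  have := ((chartAt ℂ x₀).continuousAt_symm ((chartAt ℂ x₀).map_source hx)).tendsto
  rwa [(chartAt ℂ x₀).left_inv hx] at this

/-- Makes limits along punctured neighbourhoods unique and forces two properties holding on them to
hold at a common point. -/
instance nhdsNE_neBot (x : X) : (𝓝[≠] x).NeBot :=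
  (tendsto_chart_symm_punctured x).neBot

variable [IsManifold 𝓘(ℂ) ω X] [IsManifold 𝓘(ℂ, E) ω N]

instance isManifold_one_of_analytic : IsManifold 𝓘(ℂ, E) 1 N :=
  IsManifold.of_le (n := ω) le_top

/-- The charts may be centred at points other than `x` and `g x`, so one fixed pair of charts serves
a whole neighbourhood. -/
theorem mdifferentiableAt_iff_charts {g : X → N} {x₀ x : X} {y₀ : N}
    (hx : x ∈ (chartAt ℂ x₀).source) (hy : g x ∈ (chartAt E y₀).source) :
    MDifferentiableAt 𝓘(ℂ) 𝓘(ℂ, E) g x ↔ ContinuousAt g x ∧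
      DifferentiableAt ℂ (chartAt E y₀ ∘ g ∘ (chartAt ℂ x₀).symm) (chartAt ℂ x₀ x) := by
  rw [mdifferentiableAt_iff_of_mem_source hx hy]
  simp [extChartAt, differentiableWithinAt_univ, OpenPartialHomeomorph.extend]

/-- A holomorphic map read in the charts around a point and its image. -/
theorem eventually_differentiableAt_charts {g : X → N} {x₀ : X}
    (hg : ∀ᶠ x in 𝓝 x₀, MDifferentiableAt 𝓘(ℂ) 𝓘(ℂ, E) g x) :
    ∀ᶠ w in 𝓝 (chartAt ℂ x₀ x₀), DifferentiableAt ℂ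
      (chartAt E (g x₀) ∘ g ∘ (chartAt ℂ x₀).symm) w := by
  have hx : x₀ ∈ (chartAt ℂ x₀).source := mem_chart_source ℂ x₀
  have hy : ∀ᶠ x in 𝓝 x₀, g x ∈ (chartAt E (g x₀)).source :=
    hg.self_of_nhds.continuousAt ((chartAt E (g x₀)).open_source.mem_nhds (mem_chart_source E _))
  filter_upwards [(tendsto_chart_symm x₀).eventually (hg.and hy),
    (chartAt ℂ x₀).open_target.mem_nhds ((chartAt ℂ x₀).map_source hx)] with w hw hwt
  have h := ((mdifferentiableAt_iff_charts ((chartAt ℂ x₀).map_target hwt) hw.2).1 hw.1).2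
  rwa [(chartAt ℂ x₀).right_inv hwt] at h

theorem analyticAt_charts [CompleteSpace E] {g : X → N} {x₀ : X}
    (hg : ∀ᶠ x in 𝓝 x₀, MDifferentiableAt 𝓘(ℂ) 𝓘(ℂ, E) g x) :
    AnalyticAt ℂ (chartAt E (g x₀) ∘ g ∘ (chartAt ℂ x₀).symm) (chartAt ℂ x₀ x₀) :=
  Complex.analyticAt_iff_eventually_differentiableAt.2 (eventually_differentiableAt_charts hg)

/-- Riemann's removable singularity theorem for continuous maps into a complex manifold. -/
theorem mdifferentiableAt_of_punctured [CompleteSpace E] {g : X → N} {x₀ : X}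
    (hc : ContinuousAt g x₀) (hg : ∀ᶠ x in 𝓝[≠] x₀, MDifferentiableAt 𝓘(ℂ) 𝓘(ℂ, E) g x) :
    MDifferentiableAt 𝓘(ℂ) 𝓘(ℂ, E) g x₀ := by
  have hx : x₀ ∈ (chartAt ℂ x₀).source := mem_chart_source ℂ x₀
  rw [mdifferentiableAt_iff_charts hx (mem_chart_source E _)]
  refine ⟨hc, ?_⟩
  have hy : ∀ᶠ x in 𝓝 x₀, g x ∈ (chartAt E (g x₀)).source :=
    hc ((chartAt E (g x₀)).open_source.mem_nhds (mem_chart_source E _))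
  refine (Complex.analyticAt_of_differentiable_on_punctured_nhds_of_continuousAt ?_ ?_).differentiableAt
  · filter_upwards [(tendsto_chart_symm_punctured x₀).eventually
        (hg.and (nhdsWithin_le_nhds hy)), nhdsWithin_le_nhds
        ((chartAt ℂ x₀).open_target.mem_nhds ((chartAt ℂ x₀).map_source hx))] with w hw hwt
    have h := ((mdifferentiableAt_iff_charts ((chartAt ℂ x₀).map_target hwt) hw.2).1 hw.1).2
    rwa [(chartAt ℂ x₀).right_inv hwt] at h
  · refine ContinuousAt.comp (g := chartAt E (g x₀)) ?_ (ContinuousAt.comp (g := g) ?_ ?_)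
    · simp only [Function.comp, (chartAt ℂ x₀).left_inv hx]
      exact (chartAt E (g x₀)).continuousAt (mem_chart_source E _)
    · rwa [(chartAt ℂ x₀).left_inv hx]
    · exact (chartAt ℂ x₀).continuousAt_symm ((chartAt ℂ x₀).map_source hx)

/-- Two holomorphic maps either agree near a point or differ on a punctured neighbourhood. -/
theorem eventuallyEq_or_eventually_ne [CompleteSpace E] [T2Space N] {g₁ g₂ : X → N} {x₀ : X}
    (h₁ : ∀ᶠ x in 𝓝 x₀, MDifferentiableAt 𝓘(ℂ) 𝓘(ℂ, E) g₁ x)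
    (h₂ : ∀ᶠ x in 𝓝 x₀, MDifferentiableAt 𝓘(ℂ) 𝓘(ℂ, E) g₂ x) :
    g₁ =ᶠ[𝓝 x₀] g₂ ∨ ∀ᶠ x in 𝓝[≠] x₀, g₁ x ≠ g₂ x := by
  by_cases h0 : g₁ x₀ = g₂ x₀
  · have a₁ := analyticAt_charts h₁
    have a₂ := analyticAt_charts h₂
    rw [← h0] at a₂
    have hy₁ : ∀ᶠ x in 𝓝 x₀, g₁ x ∈ (chartAt E (g₁ x₀)).source :=
      h₁.self_of_nhds.continuousAt ((chartAt E (g₁ x₀)).open_source.mem_nhds (mem_chart_source E _))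
    have hy₂ : ∀ᶠ x in 𝓝 x₀, g₂ x ∈ (chartAt E (g₁ x₀)).source :=
      h₂.self_of_nhds.continuousAt ((chartAt E (g₁ x₀)).open_source.mem_nhds
        (h0 ▸ mem_chart_source E _))
    rcases a₁.eventually_eq_or_eventually_ne a₂ with h | h
    · left
      refine eventually_nhds_of_chart ?_
      filter_upwards [h, (tendsto_chart_symm x₀).eventually (hy₁.and hy₂)] with w hw hws
      exact (chartAt E (g₁ x₀)).injOn hws.1 hws.2 hw
    · right
      refine eventually_punctured_of_chart ?_
      filter_upwards [h] with w hw h'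
      exact hw (by simp [h'])
  · right
    exact nhdsWithin_le_nhds
      ((h₁.self_of_nhds.continuousAt.ne_iff_eventually_ne h₂.self_of_nhds.continuousAt).1 h0)

variable {Z : Type*} [TopologicalSpace Z] [ChartedSpace ℂ Z] [IsManifold 𝓘(ℂ) ω Z]

/-- A holomorphic function on a Riemann surface is locally constant at a point or has nonzero
differential on a punctured neighbourhood. -/
theorem eventually_const_or_mfderiv_ne_zero {g : X → Z} {x₀ : X}
    (hg : ∀ᶠ x in 𝓝 x₀, MDifferentiableAt 𝓘(ℂ) 𝓘(ℂ) g x) :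
    (∀ᶠ x in 𝓝 x₀, g x = g x₀) ∨ ∀ᶠ x in 𝓝[≠] x₀, mfderiv 𝓘(ℂ) 𝓘(ℂ) g x ≠ 0 := by
  have hx : x₀ ∈ (chartAt ℂ x₀).source := mem_chart_source ℂ x₀
  have hy : ∀ᶠ x in 𝓝 x₀, g x ∈ (chartAt ℂ (g x₀)).source :=
    hg.self_of_nhds.continuousAt ((chartAt ℂ (g x₀)).open_source.mem_nhds (mem_chart_source ℂ _))
  have a := analyticAt_charts hg
  -- The derivative of the coordinate expression is analytic, so its zeros are isolated unless it
  -- vanishes identically near the point.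
  rcases a.deriv.eventually_eq_zero_or_eventually_ne_zero with h | h
  · left
    refine eventually_nhds_of_chart ?_
    obtain ⟨r, hr, hball⟩ := Metric.eventually_nhds_iff_ball.1
      (h.and (eventually_differentiableAt_charts hg))
    have hw0 : chartAt ℂ x₀ x₀ ∈ Metric.ball (chartAt ℂ x₀ x₀) r := Metric.mem_ball_self hr
    filter_upwards [Metric.ball_mem_nhds _ hr, (tendsto_chart_symm x₀).eventually hy]
      with w hw hws
    have := Metric.isOpen_ball.is_const_of_deriv_eq_zero
      (convex_ball (chartAt ℂ x₀ x₀) r).isPreconnected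
      (fun w hw => (hball w hw).2.differentiableWithinAt) (fun w hw => (hball w hw).1) hw hw0
    simp only [Function.comp, (chartAt ℂ x₀).left_inv hx] at this
    exact (chartAt ℂ (g x₀)).injOn hws (mem_chart_source ℂ _) this
  · right
    refine eventually_punctured_of_chart ?_
    filter_upwards [h, nhdsWithin_le_nhds ((tendsto_chart_symm x₀).eventually (hg.and hy)),
      nhdsWithin_le_nhds
        ((chartAt ℂ x₀).open_target.mem_nhds ((chartAt ℂ x₀).map_source hx))] with w hw hws hwt h0
    apply hw
    have d₁ := mdifferentiableAt_atlas_symm (I := 𝓘(ℂ)) (chart_mem_atlas ℂ x₀) hwt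
    have d₂ := mdifferentiableAt_atlas (I := 𝓘(ℂ)) (chart_mem_atlas ℂ (g x₀)) hws.2
    have d₃ := (hws.1.hasMFDerivAt.comp w d₁.hasMFDerivAt)
    have d₄ := (d₂.hasMFDerivAt.comp (f := g ∘ (chartAt ℂ x₀).symm) w d₃)
    rw [h0] at d₄
    simp only [ContinuousLinearMap.zero_comp, ContinuousLinearMap.comp_zero] at d₄
    have d₅ : HasFDerivAt (chartAt ℂ (g x₀) ∘ g ∘ (chartAt ℂ x₀).symm) (0 : ℂ →L[ℂ] ℂ) w :=
      hasMFDerivAt_iff_hasFDerivAt.1 d₄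
    rw [← fderiv_apply_one_eq_deriv, d₅.fderiv]; simp

/-- The inverse function theorem for maps of Riemann surfaces. -/
theorem exists_openPartialHomeomorph_of_mfderiv_ne_zero {g : X → Z} {x₀ : X}
    (hg : ∀ᶠ x in 𝓝 x₀, MDifferentiableAt 𝓘(ℂ) 𝓘(ℂ) g x)
    (h0 : mfderiv 𝓘(ℂ) 𝓘(ℂ) g x₀ ≠ 0) :
    ∃ e : OpenPartialHomeomorph X Z, x₀ ∈ e.source ∧ EqOn g e e.source ∧
      MDifferentiableAt 𝓘(ℂ) 𝓘(ℂ) e.symm (g x₀) := by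
  have hx : x₀ ∈ (chartAt ℂ x₀).source := mem_chart_source ℂ x₀
  have hz : g x₀ ∈ (chartAt ℂ (g x₀)).source := mem_chart_source ℂ _
  have hy : ∀ᶠ x in 𝓝 x₀, g x ∈ (chartAt ℂ (g x₀)).source :=
    hg.self_of_nhds.continuousAt ((chartAt ℂ (g x₀)).open_source.mem_nhds hz)
  have a := analyticAt_charts hg
  set G : ℂ → ℂ := chartAt ℂ (g x₀) ∘ g ∘ (chartAt ℂ x₀).symm with hG
  set w₀ := chartAt ℂ x₀ x₀ with hw₀
  have hd : deriv G w₀ ≠ 0 := by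
    intro hd
    apply h0
    rw [hg.self_of_nhds.mfderiv]
    simp only [extChartAt, OpenPartialHomeomorph.extend, writtenInExtChartAt, mfld_simps,
      fderivWithin_univ]
    have : fderiv ℂ G w₀ = 0 := by
      ext; simp [hd]
    exact this
  have hs := a.hasStrictDerivAt
  have hs' : HasStrictFDerivAt G
    ((ContinuousLinearEquiv.unitsEquivAut ℂ (Units.mk0 _ hd) : ℂ ≃L[ℂ] ℂ) : ℂ →L[ℂ] ℂ) w₀ :=
    hs.hasStrictFDerivAt_equiv hd
  obtain ⟨e₁, he₁c, hw₀s⟩ : ∃ e₁ : OpenPartialHomeomorph ℂ ℂ, (e₁ : ℂ → ℂ) = G ∧ w₀ ∈ e₁.source :=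
    ⟨hs'.toOpenPartialHomeomorph G, hs'.toOpenPartialHomeomorph_coe,
      hs'.mem_toOpenPartialHomeomorph_source⟩
  -- The composite of charts and planar inverse agrees with `g` only where `g` stays in the target
  -- chart; restricting to `O` ensures this.
  obtain ⟨O, hOsub, hO, hxO⟩ := mem_nhds_iff.1 hy
  let e₂ := ((chartAt ℂ x₀).trans e₁).trans (chartAt ℂ (g x₀)).symm
  have hGw : G w₀ = chartAt ℂ (g x₀) (g x₀) := by simp [hG, hw₀, (chartAt ℂ x₀).left_inv hx]
  have hx₂ : x₀ ∈ e₂.source := by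
    simp only [e₂, mfld_simps]
    refine ⟨hw₀s, ?_⟩
    rw [he₁c, ← hw₀, hGw]
    exact (chartAt ℂ (g x₀)).map_source hz
  have hc₂ : ∀ x ∈ (chartAt ℂ x₀).source, g x ∈ (chartAt ℂ (g x₀)).source → e₂ x = g x := by
    intro x hx hgx
    simp only [e₂, mfld_simps]
    rw [he₁c]
    simp [hG, (chartAt ℂ x₀).left_inv hx, (chartAt ℂ (g x₀)).left_inv hgx]
  refine ⟨e₂.restrOpen O hO, ?_, ?_, ?_⟩
  · rw [OpenPartialHomeomorph.restrOpen_source]; exact mem_inter hx₂ hxO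
  · intro x hx'
    rw [OpenPartialHomeomorph.restrOpen_source] at hx'
    obtain ⟨hx', hxO'⟩ := hx'
    simp only [e₂, mfld_simps] at hx'
    exact (hc₂ x hx'.1.1 (hOsub hxO')).symm
  · have d₁ := mdifferentiableAt_atlas (I := 𝓘(ℂ)) (chart_mem_atlas ℂ (g x₀)) hz
    have hsymm : e₁.symm (chartAt ℂ (g x₀) (g x₀)) = w₀ := by
      rw [← hGw, ← he₁c]; exact e₁.left_inv hw₀s
    have d₂ : DifferentiableAt ℂ e₁.symm (chartAt ℂ (g x₀) (g x₀)) := by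
      have ht : chartAt ℂ (g x₀) (g x₀) ∈ e₁.target := by
        rw [← hGw, ← he₁c]; exact e₁.map_source hw₀s
      refine (e₁.hasDerivAt_symm ht hd ?_).differentiableAt
      rw [hsymm, he₁c]
      exact hs.hasDerivAt
    have hwt : w₀ ∈ (chartAt ℂ x₀).target := (chartAt ℂ x₀).map_source hx
    have d₃ := mdifferentiableAt_atlas_symm (I := 𝓘(ℂ)) (chart_mem_atlas ℂ x₀) hwt
    have d₄ := d₂.mdifferentiableAt.comp (g x₀) d₁
    have := MDifferentiableAt.comp (g := (chartAt ℂ x₀).symm)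
      (f := e₁.symm ∘ chartAt ℂ (g x₀)) (g x₀) (by simpa [hsymm] using d₃) d₄
    exact this

/-- A continuous lift of a holomorphic map through a locally biholomorphic map is holomorphic. -/
theorem mdifferentiableAt_of_comp {H' : Type*} [NormedAddCommGroup H'] [NormedSpace ℂ H']
    {Y : Type*} [TopologicalSpace Y] [ChartedSpace H' Y]
    {g : X → Z} {h : Y → X} {y₀ : Y} (hh : ContinuousAt h y₀)
    (hg : ∀ᶠ x in 𝓝 (h y₀), MDifferentiableAt 𝓘(ℂ) 𝓘(ℂ) g x)
    (h0 : mfderiv 𝓘(ℂ) 𝓘(ℂ) g (h y₀) ≠ 0)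
    (hgh : MDifferentiableAt 𝓘(ℂ, H') 𝓘(ℂ) (g ∘ h) y₀) :
    MDifferentiableAt 𝓘(ℂ, H') 𝓘(ℂ) h y₀ := by
  obtain ⟨e, hs, heq, hd⟩ := exists_openPartialHomeomorph_of_mfderiv_ne_zero hg h0
  refine (MDifferentiableAt.comp (g := e.symm) y₀ hd hgh).congr_of_eventuallyEq ?_
  filter_upwards [hh (e.open_source.mem_nhds hs)] with y hy
  simp only [Function.comp]
  rw [heq hy, e.left_inv hy]

/-- A holomorphic map between Riemann surfaces that is not constant near any point, on a connected
surface, as soon as its differential does not vanish somewhere. -/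
theorem not_eventually_const [PreconnectedSpace X] [T2Space Z] {g : X → Z}
    (hg : MDifferentiable 𝓘(ℂ) 𝓘(ℂ) g) {x₁ : X} (h1 : mfderiv 𝓘(ℂ) 𝓘(ℂ) g x₁ ≠ 0) (x : X) :
    ¬ ∀ᶠ y in 𝓝 x, g y = g x := by
  -- The locus of local constancy is open and closed, so it is empty or everything; the latter
  -- contradicts the nonzero differential at `x₁`.
  set A : Set X := {x | ∀ᶠ y in 𝓝 x, g y = g x} with hA
  have hopen : IsOpen A := by
    rw [isOpen_iff_mem_nhds]
    intro x hx
    filter_upwards [eventually_eventually_nhds.2 hx, hx] with y hy hyx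
    filter_upwards [hy] with z hz
    rw [hz, hyx]
  have hzero : ∀ x ∈ A, mfderiv 𝓘(ℂ) 𝓘(ℂ) g x = 0 := by
    intro x hx
    have : g =ᶠ[𝓝 x] fun _ => g x := hx
    rw [this.mfderiv_eq]
    exact mfderiv_const
  have hclosed : IsClosed A := by
    rw [← isOpen_compl_iff, isOpen_iff_mem_nhds]
    intro x hx
    have := (eventually_const_or_mfderiv_ne_zero (.of_forall hg)).resolve_left hx
    rw [eventually_nhdsWithin_iff] at this
    filter_upwards [this] with y hy hyA
    by_cases hxy : y = x
    · exact hx (hxy ▸ hyA)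
    · exact hy hxy (hzero y hyA)
  rcases isClopen_iff.1 ⟨hclosed, hopen⟩ with h | h
  · intro hx
    exact (h ▸ (show x ∈ A from hx) : x ∈ (∅ : Set X))
  · exact absurd (hzero x₁ (h ▸ mem_univ _)) h1

/-- The identity theorem. -/
theorem eventuallyEq_of_isPreconnected [CompleteSpace E] [T2Space X] [T2Space N] {g₁ g₂ : X → N} {O : Set X}
    (hO : IsOpen O) (hOc : IsPreconnected O)
    (h₁ : ∀ x ∈ O, MDifferentiableAt 𝓘(ℂ) 𝓘(ℂ, E) g₁ x)
    (h₂ : ∀ x ∈ O, MDifferentiableAt 𝓘(ℂ) 𝓘(ℂ, E) g₂ x) {x₁ : X} (hx₁ : x₁ ∈ O)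
    (heq : g₁ =ᶠ[𝓝 x₁] g₂) {x : X} (hx : x ∈ O) : g₁ =ᶠ[𝓝 x] g₂ := by
  by_contra hne
  -- The points where the germs agree and the points where the maps differ on a punctured
  -- neighbourhood form two open sets covering `O`. They cannot meet, as no point is isolated.
  have ho₁ : IsOpen {x | g₁ =ᶠ[𝓝 x] g₂} := isOpen_setOfPred_eventually_nhds
  have ho₂ : IsOpen {x | ∀ᶠ y in 𝓝[≠] x, g₁ y ≠ g₂ y} := by
    rw [isOpen_iff_mem_nhds]
    intro x hx
    have hx' := hx
    rw [mem_ofPred_eq, eventually_nhdsWithin_iff] at hx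
    filter_upwards [eventually_eventually_nhds.2 hx] with y hy
    by_cases hxy : y = x
    · exact hxy ▸ hx'
    · have : ∀ᶠ z in 𝓝 y, z ≠ x := isOpen_ne.mem_nhds hxy
      exact nhdsWithin_le_nhds (by filter_upwards [hy, this] with z h h' using h h')
  have hcov : O ⊆ {x | g₁ =ᶠ[𝓝 x] g₂} ∪ {x | ∀ᶠ y in 𝓝[≠] x, g₁ y ≠ g₂ y} := fun x hx =>
    eventuallyEq_or_eventually_ne (by filter_upwards [hO.mem_nhds hx] using h₁)
      (by filter_upwards [hO.mem_nhds hx] using h₂)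
  obtain ⟨y, -, hy₁, hy₂⟩ := hOc _ _ ho₁ ho₂ hcov ⟨x₁, hx₁, heq⟩ ⟨x, hx, (hcov hx).resolve_left hne⟩
  obtain ⟨z, hz₁, hz₂⟩ := (Filter.Eventually.and
    (nhdsWithin_le_nhds hy₁ : ∀ᶠ z in 𝓝[≠] y, g₁ z = g₂ z) hy₂).exists
  exact hz₂ hz₁

end Holomorphic

/-! ### Topological preliminaries -/

/-! ### Punctured discs and the removal of discrete sets. -/

section Punctured

/-- Presents the punctured disc as the image of a convex half-plane, which gives its connectedness.
-/
theorem image_exp_re_lt {r : ℝ} (hr : 0 < r) :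
    Complex.exp '' {w | w.re < Real.log r} = Metric.ball 0 r \ {0} := by
  ext u
  simp only [mem_image, mem_ofPred_eq, Set.mem_sdiff, mem_ball_zero_iff, mem_singleton_iff]
  constructor
  · rintro ⟨w, hw, rfl⟩
    refine ⟨?_, Complex.exp_ne_zero w⟩
    rwa [Complex.norm_exp, ← Real.lt_log_iff_exp_lt hr]
  · rintro ⟨hu, h0⟩
    refine ⟨Complex.log u, ?_, Complex.exp_log h0⟩
    rw [Complex.log_re]
    exact Real.log_lt_log (norm_pos_iff.2 h0) hu

theorem convex_re_lt (a : ℝ) : Convex ℝ {w : ℂ | w.re < a} :=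
  convex_halfSpace_re_lt a

theorem isPreconnected_ball_diff_singleton {r : ℝ} (hr : 0 < r) :
    IsPreconnected (Metric.ball (0 : ℂ) r \ {0}) := by
  rw [← image_exp_re_lt hr]
  exact (convex_re_lt _).isPreconnected.image _ Complex.continuous_exp.continuousOn

theorem isPreconnected_ball_diff_center (c : ℂ) {r : ℝ} (hr : 0 < r) :
    IsPreconnected (Metric.ball c r \ {c}) := by
  have h : (fun w => c + w) '' (Metric.ball (0 : ℂ) r \ {0}) = Metric.ball c r \ {c} := by
    ext w
    simp only [mem_image, Set.mem_sdiff, mem_singleton_iff, Metric.mem_ball]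
    constructor
    · rintro ⟨u, ⟨h1, h2⟩, rfl⟩
      exact ⟨by simpa [dist_eq_norm] using h1, by simpa using h2⟩
    · rintro ⟨h1, h2⟩
      exact ⟨w - c, ⟨by simpa [dist_eq_norm] using h1, sub_ne_zero.2 h2⟩, by ring⟩
  rw [← h]
  exact (isPreconnected_ball_diff_singleton hr).image _ (by fun_prop)

variable {X : Type*} [TopologicalSpace X] [ChartedSpace ℂ X]

theorem exists_isPreconnected_diff_singleton {x : X} {O : Set X} (hO : O ∈ 𝓝 x) :
    ∃ N ∈ 𝓝 x, N ⊆ O ∧ IsPreconnected (N \ {x}) := by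
  set φ := chartAt ℂ x
  have hx : x ∈ φ.source := mem_chart_source ℂ x
  have h1 : ∀ᶠ w in 𝓝 (φ x), w ∈ φ.target ∧ φ.symm w ∈ O :=
    Filter.Eventually.and (φ.open_target.mem_nhds (φ.map_source hx)) ((tendsto_chart_symm x).eventually hO)
  obtain ⟨r, hr, hb⟩ := Metric.eventually_nhds_iff_ball.1 h1
  have hsub : Metric.ball (φ x) r ⊆ φ.target := fun w hw => (hb w hw).1
  have hinj : InjOn φ.symm (Metric.ball (φ x) r) := φ.symm.injOn.mono hsub
  refine ⟨φ.symm '' Metric.ball (φ x) r, ?_, ?_, ?_⟩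
  · refine (φ.symm.isOpen_image_of_subset_source Metric.isOpen_ball hsub).mem_nhds ?_
    exact ⟨φ x, Metric.mem_ball_self hr, φ.left_inv hx⟩
  · rintro _ ⟨w, hw, rfl⟩
    exact (hb w hw).2
  · have : φ.symm '' Metric.ball (φ x) r \ {x} = φ.symm '' (Metric.ball (φ x) r \ {φ x}) := by
      rw [hinj.image_sdiff_subset (by simpa using hr), image_singleton, φ.left_inv hx]
    rw [this]
    exact (isPreconnected_ball_diff_center _ hr).image _
      (φ.continuousOn_symm.mono (sdiff_subset.trans hsub))

/-- Removing a discrete closed set does not disconnect an open subset of a surface. -/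
theorem isPreconnected_diff_of_discrete [T2Space X] {O D : Set X} (hO : IsOpen O)
    (hOc : IsPreconnected O) (hD : ∀ x ∈ O, ∀ᶠ y in 𝓝[≠] x, y ∉ D) : IsPreconnected (O \ D) := by
  rintro A B hA hB hAB ⟨a, haO, haA⟩ ⟨b, hbO, hbB⟩
  by_contra hne
  -- Every point of `O` has a connected punctured neighbourhood avoiding `D`, hence lying entirely
  -- in `A` or entirely in `B`. A separation of `O \ D` thus extends to an open cover of `O`.
  have hcov : O ⊆ {x | ∀ᶠ y in 𝓝[≠] x, y ∈ A} ∪ {x | ∀ᶠ y in 𝓝[≠] x, y ∈ B} := by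
    intro x hx
    have hx1 : {y | y ≠ x → y ∉ D} ∩ O ∈ 𝓝 x :=
      inter_mem (eventually_nhdsWithin_iff.1 (hD x hx)) (hO.mem_nhds hx)
    obtain ⟨N, hN, hNO, hNc⟩ := exists_isPreconnected_diff_singleton hx1
    have hsub : N \ {x} ⊆ O \ D := fun y hy => ⟨(hNO hy.1).2, (hNO hy.1).1 hy.2⟩
    have hNx : N \ {x} ∈ 𝓝[≠] x := sdiff_mem_nhdsWithin_compl hN _
    by_cases hNA : ((N \ {x}) ∩ A).Nonempty
    · by_cases hNB : ((N \ {x}) ∩ B).Nonempty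
      · obtain ⟨y, hy, hy'⟩ := hNc A B hA hB (hsub.trans hAB) hNA hNB
        exact absurd ⟨y, hsub hy, hy'⟩ hne
      · left
        filter_upwards [hNx] with y hy
        exact (hAB (hsub hy)).resolve_right fun h => hNB ⟨y, hy, h⟩
    · right
      filter_upwards [hNx] with y hy
      exact (hAB (hsub hy)).resolve_left fun h => hNA ⟨y, hy, h⟩
  obtain ⟨x, hx, hxA, hxB⟩ := hOc _ _ isOpen_setOfPred_eventually_nhdsWithin
    isOpen_setOfPred_eventually_nhdsWithin hcov
    ⟨a, haO.1, nhdsWithin_le_nhds (hA.mem_nhds haA)⟩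
    ⟨b, hbO.1, nhdsWithin_le_nhds (hB.mem_nhds hbB)⟩
  replace hxA : ∀ᶠ y in 𝓝[≠] x, y ∈ A := hxA
  replace hxB : ∀ᶠ y in 𝓝[≠] x, y ∈ B := hxB
  have hxO : ∀ᶠ y in 𝓝[≠] x, y ∈ O := nhdsWithin_le_nhds (hO.mem_nhds hx)
  obtain ⟨y, ⟨⟨hy1, hy2⟩, hy3⟩, hy4⟩ := (((hxA.and hxB).and hxO).and (hD x hx)).exists
  exact hne ⟨y, ⟨hy3, hy4⟩, hy1, hy2⟩

end Punctured

/-! ### Countability of surfaces with discrete fibres over a second countable space. -/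

section PoincareVolterra

open TopologicalSpace

/-- The component of the preimage of a small set at an isolated point of its fibre is small. -/
theorem exists_connectedComponentIn_preimage_subset {X Y : Type*} [TopologicalSpace X]
    [TopologicalSpace Y] [T2Space X] [T2Space Y] [LocallyCompactSpace X] {p : X → Y}
    (hp : Continuous p) {x : X} (hx : ∀ᶠ y in 𝓝[≠] x, p y ≠ p x) {O : Set X} (hO : O ∈ 𝓝 x) :
    ∃ B ∈ 𝓝 (p x), ∀ B' ⊆ B, p x ∈ B' → connectedComponentIn (p ⁻¹' B') x ⊆ O := by
  obtain ⟨N, hN, hNsub, hNc⟩ := local_compact_nhds (inter_mem hO (eventually_nhdsWithin_iff.1 hx))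
  have hF : IsCompact (p '' (N \ interior N)) := (hNc.diff isOpen_interior).image hp
  -- In `N` the fibre of `p x` is `x` alone, which is interior, so the compact image of `N \
  -- interior N` misses `p x`. A connected set through `x` over the complement of that image cannot
  -- leave the interior of `N`.
  refine ⟨(p '' (N \ interior N))ᶜ, hF.isClosed.isOpen_compl.mem_nhds ?_, fun B' hB hxB => ?_⟩
  · rintro ⟨y, hy, hyx⟩
    refine (hNsub hy.1).2 ?_ hyx
    rintro rfl
    exact hy.2 (mem_interior_iff_mem_nhds.2 hN)
  · refine (IsPreconnected.subset_of_closure_inter_subset isPreconnected_connectedComponentIn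
      isOpen_interior ⟨x, mem_connectedComponentIn hxB, mem_interior_iff_mem_nhds.2 hN⟩ ?_).trans
      (interior_subset.trans (hNsub.trans inter_subset_left))
    rintro y ⟨hy1, hy2⟩
    by_contra hy3
    have hyN : y ∈ N := closure_minimal interior_subset hNc.isClosed hy1
    exact hB (connectedComponentIn_subset (p ⁻¹' B') x hy2) ⟨y, ⟨hyN, hy3⟩, rfl⟩

/-- The Poincaré–Volterra theorem. -/
theorem secondCountableTopology_of_discrete_fibers {X Y : Type*} [TopologicalSpace X]
    [TopologicalSpace Y] [ConnectedSpace X] [T2Space X] [T2Space Y] [SecondCountableTopology Y]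
    [LocallyCompactSpace X] [LocallyConnectedSpace X]
    (hX : ∀ x : X, ∃ O ∈ 𝓝 x, SecondCountableTopology O)
    {p : X → Y} (hp : Continuous p) (hd : ∀ x, ∀ᶠ y in 𝓝[≠] x, p y ≠ p x) :
    SecondCountableTopology X := by
  set 𝔘 : Set (Set X) := {C | IsOpen C ∧ C.Nonempty ∧ SecondCountableTopology C ∧
    ∃ B ∈ countableBasis Y, ∃ x, C = connectedComponentIn (p ⁻¹' B) x} with h𝔘
  have key : ∀ (x : X) (O : Set X), x ∈ O → IsOpen O → ∃ C ∈ 𝔘, x ∈ C ∧ C ⊆ O := by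
    intro x O hxO hO
    obtain ⟨O', hO', hsc⟩ := hX x
    obtain ⟨N, hN, hNO⟩ :=
      exists_connectedComponentIn_preimage_subset hp (hd x) (inter_mem (hO.mem_nhds hxO) hO')
    obtain ⟨B, hB, hxB, hBN⟩ := (isBasis_countableBasis Y).mem_nhds_iff.1 hN
    have hopen : IsOpen (p ⁻¹' B) := (isOpen_of_mem_countableBasis hB).preimage hp
    have hxC : x ∈ connectedComponentIn (p ⁻¹' B) x := mem_connectedComponentIn hxB
    have hCO : connectedComponentIn (p ⁻¹' B) x ⊆ O ∩ O' := hNO B hBN hxB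
    refine ⟨_, ⟨hopen.connectedComponentIn, ⟨x, hxC⟩, ?_, B, hB, x, rfl⟩, hxC,
      hCO.trans inter_subset_left⟩
    exact (IsEmbedding.inclusion (hCO.trans inter_subset_right)).secondCountableTopology
  -- For one basic set `B` the components over it are disjoint and open, and a second countable `C`
  -- meets only countably many of them.
  have hmeet : ∀ C ∈ 𝔘, {C' ∈ 𝔘 | (C' ∩ C).Nonempty}.Countable := by
    rintro C ⟨-, -, hsc, -⟩
    have hsub : {C' ∈ 𝔘 | (C' ∩ C).Nonempty} ⊆ ⋃ B ∈ countableBasis Y,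
        {C' | (IsOpen C' ∧ (C' ∩ C).Nonempty) ∧ ∃ x, C' = connectedComponentIn (p ⁻¹' B) x} := by
      rintro C' ⟨⟨h1, -, -, B, hB, h2⟩, h3⟩
      exact mem_biUnion hB ⟨⟨h1, h3⟩, h2⟩
    refine Countable.mono hsub ((countable_countableBasis Y).biUnion fun B _ => ?_)
    refine PairwiseDisjoint.countable_of_isOpen (α := C)
      (s := fun C' => ((↑) : C → X) ⁻¹' C') ?_ ?_ ?_
    · rintro C₁ ⟨-, x₁, rfl⟩ C₂ ⟨-, x₂, rfl⟩ hne
      refine Disjoint.preimage _ (disjoint_iff_inter_eq_empty.2 (not_nonempty_iff_eq_empty.1 ?_))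
      rintro ⟨y, hy1, hy2⟩
      exact hne ((connectedComponentIn_eq hy1).trans (connectedComponentIn_eq hy2).symm)
    · rintro C' ⟨⟨h, -⟩, -⟩
      exact h.preimage continuous_subtype_val
    · rintro C' ⟨⟨-, y, hy1, hy2⟩, -⟩
      exact ⟨⟨y, hy2⟩, hy1⟩
  obtain ⟨x₀⟩ := (inferInstance : Nonempty X)
  obtain ⟨C₀, hC₀, -⟩ := key x₀ univ trivial isOpen_univ
  -- `s n` collects the members of `𝔘` linked to `C₀` by a chain of length `n` of successively
  -- intersecting members. The union of all of them is clopen, so connectedness makes every member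
  -- of `𝔘` reachable.
  let s : ℕ → Set (Set X) := fun n => Nat.rec {C₀}
    (fun _ t => ⋃ C ∈ t, {C' ∈ 𝔘 | (C' ∩ C).Nonempty}) n
  have hs0 : s 0 = {C₀} := rfl
  have hs1 : ∀ n, s (n + 1) = ⋃ C ∈ s n, {C' ∈ 𝔘 | (C' ∩ C).Nonempty} := fun _ => rfl
  have hsub : ∀ n, s n ⊆ 𝔘 := by
    intro n
    cases n with
    | zero => rw [hs0]; exact singleton_subset_iff.2 hC₀
    | succ n => rw [hs1]; exact iUnion₂_subset fun C _ C' h => h.1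
  have hcount : ∀ n, (s n).Countable := by
    intro n
    induction n with
    | zero => rw [hs0]; exact countable_singleton _
    | succ n ih => rw [hs1]; exact ih.biUnion fun C hC => hmeet C (hsub n hC)
  have huniv : (⋃ n, ⋃₀ s n) = univ := by
    refine IsClopen.eq_univ ⟨?_, isOpen_iUnion fun n => isOpen_sUnion fun C hC => (hsub n hC).1⟩ ?_
    · refine isClosed_of_closure_subset fun x hx => ?_
      obtain ⟨C, hC, hxC, -⟩ := key x univ trivial isOpen_univ
      obtain ⟨y, hyC, hy⟩ := mem_closure_iff.1 hx C hC.1 hxC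
      obtain ⟨n, C', hC', hyC'⟩ := mem_iUnion.1 hy
      refine mem_iUnion.2 ⟨n + 1, C, ?_, hxC⟩
      rw [hs1]
      exact mem_biUnion hC' ⟨hC, y, hyC, hyC'⟩
    · obtain ⟨y, hy⟩ := hC₀.2.1
      exact ⟨y, mem_iUnion.2 ⟨0, C₀, rfl, hy⟩⟩
  have hall : 𝔘 ⊆ ⋃ n, s n := by
    intro C hC
    obtain ⟨y, hy⟩ := hC.2.1
    obtain ⟨n, C', hC', hyC'⟩ := mem_iUnion.1 (huniv ▸ mem_univ y : y ∈ ⋃ n, ⋃₀ s n)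
    refine mem_iUnion.2 ⟨n + 1, ?_⟩
    rw [hs1]
    exact mem_biUnion hC' ⟨hC, y, hy, hyC'⟩
  exact (isTopologicalBasis_of_isOpen_of_nhds (fun C hC => hC.1) key).secondCountableTopology
    ((countable_iUnion hcount).mono hall)

end PoincareVolterra

/-! ### Finite connected coverings of a punctured disc. -/

section PuncturedDiscCovering

/-- A connected covering of a punctured disc with a finite fibre is isomorphic to a power map. -/
theorem exists_root_of_isCoveringMap {V : Type*} [TopologicalSpace V] [ConnectedSpace V]
    {r : ℝ} (hr : 0 < r) {D : Set ℂ} (hD : D = Metric.ball 0 r \ {0}) {p : V → D} (hp : IsCoveringMap p)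
    (hfin : ∀ z, (p ⁻¹' {z}).Finite) :
    ∃ (N : ℕ) (t : V → ℂ), 0 < N ∧ IsOpenEmbedding t ∧
      range t = {τ | τ ≠ 0 ∧ ‖τ ^ N‖ < r} ∧ ∀ v, t v ^ N = p v := by
  have hDpre : Complex.exp ⁻¹' D = {w | w.re < Real.log r} := by
    ext w
    simp only [hD, mem_preimage, Set.mem_sdiff, mem_ball_zero_iff, mem_singleton_iff,
      Complex.exp_ne_zero, not_false_eq_true, and_true, Complex.norm_exp, mem_ofPred_eq]
    exact (Real.lt_log_iff_exp_lt hr).symm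
  have hDo : IsOpen D := hD ▸ Metric.isOpen_ball.sdiff isClosed_singleton
  have hcov : IsCoveringMap (D.restrictPreimage Complex.exp) :=
    (Complex.isCoveringMapOn_exp.mono fun z hz => (hD ▸ hz).2).isCoveringMap_restrictPreimage
  set H : Set ℂ := Complex.exp ⁻¹' D with hH
  have hHo : IsOpen H := hDo.preimage Complex.continuous_exp
  set ex : H → D := D.restrictPreimage Complex.exp with hex
  have hexv : ∀ w : H, (ex w : ℂ) = Complex.exp w := fun w => rfl
  have hD0 : ∀ z : D, (z : ℂ) ≠ 0 := fun z => (hD ▸ z.2 : (z : ℂ) ∈ Metric.ball 0 r \ {0}).2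
  have hsurjex : ∀ z : D, ∃ w : H, ex w = z := fun z =>
    ⟨⟨Complex.log z, by rw [hH, mem_preimage, Complex.exp_log (hD0 z)]; exact z.2⟩,
      Subtype.ext (Complex.exp_log (hD0 z))⟩
  obtain ⟨v₀⟩ := (inferInstance : Nonempty V)
  have hconv : Convex ℝ H := hDpre ▸ convex_re_lt _
  have : ContractibleSpace H := hconv.contractibleSpace
    (by obtain ⟨w, -⟩ := hsurjex (p v₀); exact ⟨w, w.2⟩)
  have : LocallyPathConnectedSpace H := hHo.locallyPathConnectedSpace
  -- The half-plane `H` is contractible and locally path connected, so the exponential lifts through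
  -- `p` with any prescribed starting point.
  have hlift : ∀ v : V, ∃ L : C(H, V), p ∘ L = ex ∧ v ∈ range L := by
    intro v
    obtain ⟨w, hw⟩ := hsurjex (p v)
    obtain ⟨L, ⟨hL1, hL2⟩, -⟩ := hp.existsUnique_continuousMap_lifts ⟨ex, hcov.continuous⟩ w v hw.symm
    exact ⟨L, hL2, w, hL1⟩
  -- translation by multiples of the period of the exponential
  have hTmem : ∀ (m : ℤ) (w : H), (w : ℂ) + m * (2 * Real.pi * Complex.I) ∈ H := by
    intro m w
    have := Complex.exp_periodic.int_mul m w
    change Complex.exp _ ∈ D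
    rw [this]
    exact w.2
  let T : ℤ → H → H := fun m w => ⟨w + m * (2 * Real.pi * Complex.I), hTmem m w⟩
  have hTv : ∀ m w, (T m w : ℂ) = w + m * (2 * Real.pi * Complex.I) := fun _ _ => rfl
  have hTc : ∀ m, Continuous (T m) := fun m => by
    refine Continuous.subtype_mk ?_ _
    fun_prop
  have hTex : ∀ m, ex ∘ T m = ex := fun m => by
    funext w
    exact Subtype.ext (Complex.exp_periodic.int_mul m w)
  have hTadd : ∀ m n w, T m (T n w) = T (m + n) w := fun m n w => by
    apply Subtype.ext; simp only [hTv]; push_cast; ring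
  have hT0 : ∀ w, T 0 w = w := fun w => by apply Subtype.ext; simp [hTv]
  have hexeq : ∀ w w', ex w = ex w' → ∃ m, w = T m w' := by
    intro w w' h
    obtain ⟨m, hm⟩ := Complex.exp_eq_exp_iff_exists_int.1 (congrArg Subtype.val h)
    exact ⟨m, Subtype.ext hm⟩
  obtain ⟨L, hL, -⟩ := hlift v₀
  have hLc : Continuous L := L.continuous
  have hpL : ∀ w, p (L w) = ex w := fun w => congrFun hL w
  -- Two lifts whose images meet differ by a translation by a period, because they lift the same map
  -- and agree at one point after that translation.
  have hLT : ∀ (L' : C(H, V)), p ∘ L' = ex → ∀ w w', L' w = L w' → ∃ m, L ∘ T m = L' := by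
    intro L' hL' w w' h
    have h1 : ex w' = ex w := by rw [← hpL, ← h]; exact congrFun hL' w
    obtain ⟨m, hm⟩ := hexeq _ _ h1
    refine ⟨m, hp.eq_of_comp_eq (hLc.comp (hTc m)) L'.continuous ?_ w ?_⟩
    · rw [← Function.comp_assoc, hL, hTex, hL']
    · simp [← hm, h]
  have hlocal : ∀ L' : C(H, V), p ∘ L' = ex → IsOpenMap L' := fun L' hL' =>
    (IsLocalHomeomorph.of_comp (by rw [hL']; exact hcov.isLocalHomeomorph)
      hp.isLocalHomeomorph L'.continuous).isOpenMap
  have hLo : IsOpenMap L := hlocal L hL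
  have hLsurj : Function.Surjective L := by
    rw [← range_eq_univ]
    -- The complement of the image is open: a missed point lies on another lift, and if the images
    -- of the two lifts met, they would coincide.
    refine IsClopen.eq_univ ⟨?_, hLo.isOpen_range⟩ ?_
    · rw [← isOpen_compl_iff, isOpen_iff_mem_nhds]
      intro v hv
      obtain ⟨L', hL', hvL'⟩ := hlift v
      filter_upwards [(hlocal L' hL').isOpen_range.mem_nhds hvL']
      rintro _ ⟨w, rfl⟩ ⟨w', hw'⟩
      obtain ⟨m, hm⟩ := hLT L' hL' w w' hw'.symm
      obtain ⟨w'', rfl⟩ := hvL'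
      exact hv ⟨T m w'', congrFun hm w''⟩
    · exact ⟨L (hsurjex (p v₀)).choose, mem_range_self _⟩
  have hper : ∀ m w, L (T m w) = L w → L ∘ T m = L := by
    intro m w h
    refine hp.eq_of_comp_eq (hLc.comp (hTc m)) hLc ?_ w h
    rw [← Function.comp_assoc, hL, hTex]
  have hexper : ∃ N : ℕ, 0 < N ∧ L ∘ T N = L := by
    obtain ⟨w, -⟩ := hsurjex (p v₀)
    -- All translates of `w` land in one fibre of `p`, which is finite, so two of them must coincide
    -- in `V`.
    have hni : ¬ Function.Injective fun m : ℤ => L (T m w) := by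
      intro hinj
      refine infinite_range_of_injective hinj ((hfin (ex w)).subset ?_)
      rintro _ ⟨m, rfl⟩
      change p (L (T m w)) = ex w
      rw [hpL]
      exact congrFun (hTex m) w
    simp only [Function.Injective, not_forall] at hni
    obtain ⟨m, m', h, hne⟩ := hni
    have hstep : ∀ a b : ℤ, b < a → L (T a w) = L (T b w) → ∃ N : ℕ, 0 < N ∧ L ∘ T N = L := by
      intro a b hab h
      refine ⟨(a - b).toNat, by omega, hper _ (T b w) ?_⟩
      rw [hTadd, ← h]
      congr 2
      omega
    rcases lt_or_gt_of_ne hne with hlt | hlt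
    · exact hstep m' m hlt h.symm
    · exact hstep m m' hlt h
  classical
  -- The least positive period of `L`; its minimality makes the periods exactly the multiples of
  -- `N`.
  set N := Nat.find hexper with hN
  obtain ⟨hN0, hNper⟩ : 0 < N ∧ L ∘ T N = L := Nat.find_spec hexper
  have hmulper : ∀ k : ℤ, L ∘ T (N * k) = L := by
    have hnat : ∀ k : ℕ, L ∘ T (N * k) = L := by
      intro k
      induction k with
      | zero => funext w; simp [hT0]
      | succ k ih =>
        funext w
        have h1 := congrFun hNper (T (N * k) w)
        have h2 := congrFun ih w
        simp only [Function.comp] at h1 h2 ⊢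
        rw [hTadd] at h1
        rw [← h2, ← h1]
        congr 2
        push_cast; ring
    intro k
    obtain ⟨n, rfl | rfl⟩ := Int.eq_nat_or_neg k
    · exact hnat n
    · funext w
      have h := congrFun (hnat n) (T (N * -(n : ℤ)) w)
      simp only [Function.comp] at h ⊢
      rw [hTadd] at h
      rw [← h, show ((N : ℤ) * n + N * -n) = 0 by ring, hT0]
  have hLeq : ∀ w w', L w = L w' ↔ ∃ k : ℤ, w = T (N * k) w' := by
    intro w w'
    constructor
    · intro h
      obtain ⟨m, hm⟩ := hexeq w w' (by rw [← hpL, ← hpL, h])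
      have hmp : L ∘ T m = L := hper m w' (by rw [← hm, h])
      -- The remainder of a period modulo `N` is again a period, hence zero by minimality.
      have hmod : L ∘ T (m % N) = L := by
        funext x
        have h1 := congrFun hmp (T (N * -(m / N)) x)
        have h2 := congrFun (hmulper (-(m / N))) x
        simp only [Function.comp] at h1 h2 ⊢
        rw [h2, hTadd] at h1
        rw [← h1]
        congr 2
        rw [Int.emod_def]; ring
      have hmod0 : m % N = 0 := by
        by_contra hne
        have hpos : 0 ≤ m % N := Int.emod_nonneg _ (by omega)
        have hlt : m % N < N := Int.emod_lt_of_pos _ (by omega)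
        refine Nat.find_min hexper (m := (m % N).toNat) (by omega) ⟨by omega, ?_⟩
        rwa [Int.toNat_of_nonneg hpos]
      obtain ⟨k, hk⟩ := Int.dvd_of_emod_eq_zero hmod0
      exact ⟨k, hk ▸ hm⟩
    · rintro ⟨k, rfl⟩
      exact congrFun (hmulper k) w'
  have hNC : (N : ℂ) ≠ 0 := Nat.cast_ne_zero.2 hN0.ne'
  -- `E` identifies exactly the points that `L` identifies, so it descends through `L` to an
  -- injective coordinate on `V`. Its `N`-th power is the exponential, that is, `p`.
  let E : H → ℂ := fun w => Complex.exp (w / N)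
  have hEeq : ∀ w w', E w = E w' ↔ L w = L w' := by
    intro w w'
    rw [hLeq]
    simp only [E]
    rw [Complex.exp_eq_exp_iff_exists_int]
    refine exists_congr fun k => ?_
    rw [Subtype.ext_iff, hTv]
    push_cast
    constructor
    · intro h
      field_simp at h
      rw [h]; ring
    · intro h
      rw [h]; field_simp
  choose σ hσ using hLsurj
  let t : V → ℂ := fun v => E (σ v)
  have htL : t ∘ L = E := by
    funext w
    exact (hEeq _ _).2 (hσ _)
  have hEc : Continuous E := by
    refine Complex.continuous_exp.comp ?_
    fun_prop
  have hEo : IsOpenMap E := by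
    have h1 : IsOpenMap fun w : ℂ => w / N := by
      simp only [div_eq_mul_inv]
      exact (Homeomorph.mulRight₀ _ (inv_ne_zero hNC)).isOpenMap
    exact (Complex.isOpenMap_exp.comp h1).comp hHo.isOpenMap_subtype_val
  have hLsurj' : Function.Surjective L := fun v => ⟨_, hσ v⟩
  refine ⟨N, t, hN0, ?_, ?_, ?_⟩
  · refine IsOpenEmbedding.of_continuous_injective_isOpenMap ?_ ?_ ?_
    · rw [(hLo.isQuotientMap hLc hLsurj').continuous_iff, htL]
      exact hEc
    · intro v v' h
      have := (hEeq _ _).1 h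
      rwa [hσ, hσ] at this
    · intro O hO
      have : t '' O = E '' (L ⁻¹' O) := by
        rw [← htL, image_comp, image_preimage_eq _ hLsurj']
      rw [this]
      exact hEo _ (hO.preimage hLc)
  · rw [← hLsurj'.range_comp t, htL]
    ext τ
    have hEN : ∀ w : H, E w ^ N = Complex.exp w := by
      intro w
      simp only [E]
      rw [← Complex.exp_nat_mul]
      congr 1
      field_simp
    constructor
    · rintro ⟨w, rfl⟩
      refine ⟨Complex.exp_ne_zero _, ?_⟩
      rw [hEN]
      exact mem_ball_zero_iff.1 (hD ▸ w.2 : Complex.exp w ∈ Metric.ball 0 r \ {0}).1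
    · rintro ⟨h0, hτ⟩
      have hw : Complex.exp (N * Complex.log τ) = τ ^ N := by
        rw [Complex.exp_nat_mul, Complex.exp_log h0]
      refine ⟨⟨N * Complex.log τ, ?_⟩, ?_⟩
      · rw [hH, mem_preimage, hw, hD]
        exact ⟨mem_ball_zero_iff.2 hτ, pow_ne_zero _ h0⟩
      · simp only [E]
        rw [mul_div_cancel_left₀ _ hNC, Complex.exp_log h0]
  · intro v
    have h1 : p v = ex (σ v) := by rw [← hpL, hσ]
    simp only [t, E]
    rw [← Complex.exp_nat_mul, h1, hexv]
    congr 1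
    field_simp

end PuncturedDiscCovering

/-! ### Coordinate discs of the extended complex plane -/

namespace Sphere

/-- The standard parametrization of a neighbourhood of `z₀` by the complex plane. -/
def param (z₀ : Sphere) : ℂ → Sphere :=
  match z₀ with
  | none => fun u => chartInfty.symm u
  | some z => fun u => chartZero.symm (z + u)

/-- The coordinate inverse to `param z₀`. -/
def coord (z₀ : Sphere) : Sphere → ℂ :=
  match z₀ with
  | none => chartInfty
  | some z => fun x => chartZero x - z

theorem param_infty (u : ℂ) : param OnePoint.infty u = inv (u : Sphere) := by
  change chartInfty.symm u = _
  simp [chartInfty, invHomeomorph, chartZero_symm_apply]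

theorem param_coe (z u : ℂ) : param (z : Sphere) u = ((z + u : ℂ) : Sphere) :=
  chartZero_symm_apply _

theorem param_zero (z₀ : Sphere) : param z₀ 0 = z₀ := by
  induction z₀ using OnePoint.rec with
  | infty => rw [param_infty, inv_zero]
  | coe z => rw [param_coe, add_zero]

theorem isOpenEmbedding_param (z₀ : Sphere) : IsOpenEmbedding (param z₀) := by
  induction z₀ using OnePoint.rec with
  | infty =>
    have : param OnePoint.infty = invHomeomorph ∘ ((↑) : ℂ → Sphere) := funext param_infty
    rw [this]
    exact invHomeomorph.isOpenEmbedding.comp OnePoint.isOpenEmbedding_coe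
  | coe z =>
    have : param (z : Sphere) = ((↑) : ℂ → Sphere) ∘ Homeomorph.addLeft z := funext (param_coe z)
    rw [this]
    exact OnePoint.isOpenEmbedding_coe.comp (Homeomorph.addLeft z).isOpenEmbedding

theorem disc_eq (z₀ : Sphere) (r : ℝ) : disc z₀ r = param z₀ '' Metric.ball 0 r := by
  induction z₀ using OnePoint.rec with
  | infty =>
    have : param OnePoint.infty = inv ∘ ((↑) : ℂ → Sphere) := funext param_infty
    rw [this, image_comp]
    exact (congrFun (image_eq_preimage_of_inverse inv_inv inv_inv) _).symm
  | coe z =>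
    have : param (z : Sphere) = ((↑) : ℂ → Sphere) ∘ fun u => z + u := funext (param_coe z)
    rw [this, image_comp]
    change _ '' Metric.ball z r = _
    simp

theorem puncturedDisc_eq (z₀ : Sphere) (r : ℝ) :
    puncturedDisc z₀ r = param z₀ '' (Metric.ball 0 r \ {0}) := by
  rw [image_sdiff (isOpenEmbedding_param z₀).injective, image_singleton, param_zero, ← disc_eq,
    puncturedDisc]

theorem isOpen_disc (z₀ : Sphere) (r : ℝ) : IsOpen (disc z₀ r) := by
  rw [disc_eq]
  exact (isOpenEmbedding_param z₀).isOpenMap _ Metric.isOpen_ball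

theorem isOpen_puncturedDisc (z₀ : Sphere) (r : ℝ) : IsOpen (puncturedDisc z₀ r) :=
  (isOpen_disc z₀ r).sdiff isClosed_singleton

theorem disc_mono (z₀ : Sphere) {r r' : ℝ} (h : r ≤ r') : disc z₀ r ⊆ disc z₀ r' := by
  rw [disc_eq, disc_eq]
  exact image_mono (Metric.ball_subset_ball h)

theorem puncturedDisc_mono (z₀ : Sphere) {r r' : ℝ} (h : r ≤ r') :
    puncturedDisc z₀ r ⊆ puncturedDisc z₀ r' :=
  sdiff_subset_sdiff_left (disc_mono z₀ h)

theorem mem_disc_self (z₀ : Sphere) {r : ℝ} (hr : 0 < r) : z₀ ∈ disc z₀ r := by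
  rw [disc_eq]
  exact ⟨0, Metric.mem_ball_self hr, param_zero z₀⟩

theorem isPreconnected_disc (z₀ : Sphere) (r : ℝ) : IsPreconnected (disc z₀ r) := by
  rw [disc_eq]
  exact (convex_ball (0 : ℂ) r).isPreconnected.image _
    (isOpenEmbedding_param z₀).continuous.continuousOn

theorem isPreconnected_puncturedDisc (z₀ : Sphere) {r : ℝ} (hr : 0 < r) :
    IsPreconnected (puncturedDisc z₀ r) := by
  rw [puncturedDisc_eq]
  exact (isPreconnected_ball_diff_singleton hr).image _
    (isOpenEmbedding_param z₀).continuous.continuousOn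

theorem exists_disc_subset {z₀ : Sphere} {O : Set Sphere} (hO : O ∈ 𝓝 z₀) :
    ∃ K : ℕ, 0 < K ∧ ∀ k ≥ K, disc z₀ (1 / k) ⊆ O := by
  have h : param z₀ ⁻¹' O ∈ 𝓝 (0 : ℂ) :=
    (isOpenEmbedding_param z₀).continuous.continuousAt (by rwa [param_zero])
  obtain ⟨r, hr, hb⟩ := Metric.mem_nhds_iff.1 h
  obtain ⟨n, hn⟩ := exists_nat_one_div_lt hr
  refine ⟨n + 1, n.succ_pos, fun k hk => ?_⟩
  rw [disc_eq, image_subset_iff]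
  refine (Metric.ball_subset_ball ?_).trans hb
  refine le_trans ?_ hn.le
  gcongr
  exact_mod_cast hk

theorem one_div_le {k l : ℕ} (hk : 0 < k) (h : k ≤ l) : (1 / l : ℝ) ≤ 1 / k :=
  one_div_le_one_div_of_le (by exact_mod_cast hk) (by exact_mod_cast h)

theorem coord_param (z₀ : Sphere) (u : ℂ) : coord z₀ (param z₀ u) = u := by
  induction z₀ using OnePoint.rec with
  | infty =>
    change chartInfty (chartInfty.symm u) = u
    refine chartInfty.right_inv ?_
    simp [chartInfty, chartZero]
  | coe z =>
    rw [param_coe]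
    change chartZero _ - z = u
    rw [chartZero_coe]; ring

theorem mdifferentiable_param (z₀ : Sphere) : MDifferentiable 𝓘(ℂ) 𝓘(ℂ) (param z₀) := by
  induction z₀ using OnePoint.rec with
  | infty =>
    intro u
    refine mdifferentiableAt_atlas_symm (I := 𝓘(ℂ)) (e := chartInfty) (Or.inr rfl) ?_
    simp [chartInfty, chartZero]
  | coe z =>
    intro u
    have h1 := mdifferentiableAt_atlas_symm (I := 𝓘(ℂ)) (e := chartZero) (Or.inl rfl)
      (show z + u ∈ chartZero.target by simp [chartZero])
    have h2 : DifferentiableAt ℂ (fun u : ℂ => z + u) u := by fun_prop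
    exact MDifferentiableAt.comp u h1 h2.mdifferentiableAt

theorem mdifferentiableAt_coord (z₀ : Sphere) {x : Sphere} (hx : x ∈ range (param z₀)) :
    MDifferentiableAt 𝓘(ℂ) 𝓘(ℂ) (coord z₀) x := by
  obtain ⟨u, rfl⟩ := hx
  induction z₀ using OnePoint.rec with
  | infty =>
    refine mdifferentiableAt_atlas (I := 𝓘(ℂ)) (e := chartInfty) (Or.inr rfl) ?_
    exact chartInfty.map_target (by simp [chartInfty, chartZero])
  | coe z =>
    have h1 := mdifferentiableAt_atlas (I := 𝓘(ℂ)) (e := chartZero) (Or.inl rfl)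
      (x := param (z : Sphere) u) (by rw [param_coe]; exact coe_mem_chartZero_source _)
    have h2 : DifferentiableAt ℂ (fun u : ℂ => u - z) (chartZero (param (z : Sphere) u)) := by
      fun_prop
    exact MDifferentiableAt.comp (g := fun u : ℂ => u - z) _ h2.mdifferentiableAt h1

instance : SecondCountableTopology Sphere := ChartedSpace.secondCountable_of_sigmaCompact ℂ Sphere

end Sphere

/-! ### The Riemann surface structure of a space spread over the extended complex plane -/

section LocalHomeomorph

variable {X : Type*} [TopologicalSpace X] {p : X → Sphere}

/-- The charts of a space spread over the extended complex plane. -/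
@[reducible] def spreadChartedSpace (hp : IsLocalHomeomorph p) : ChartedSpace ℂ X where
  atlas := range fun x => (hp.localInverseAt x).symm.trans (chartAt ℂ (p x))
  chartAt x := (hp.localInverseAt x).symm.trans (chartAt ℂ (p x))
  mem_chart_source x := by
    rw [OpenPartialHomeomorph.trans_source]
    refine ⟨hp.self_mem_localInverseAt_target, ?_⟩
    rw [mem_preimage, hp.localInverseAt_symm]
    exact mem_chart_source ℂ (p x)
  chart_mem_atlas x := ⟨x, rfl⟩

/-- The local inverses of `p` cancel in a transition map, leaving a restriction of a transition map
of the sphere. -/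
theorem spread_isManifold (hp : IsLocalHomeomorph p) :
    @IsManifold ℂ _ ℂ _ _ ℂ _ 𝓘(ℂ) ω X _ (spreadChartedSpace hp) := by
  let _ := spreadChartedSpace hp
  apply isManifold_of_contDiffOn
  rintro _ _ ⟨x, rfl⟩ ⟨y, rfl⟩
  have key : ContDiffOn ℂ ω (chartAt ℂ (p y) ∘ (chartAt ℂ (p x)).symm)
      ((chartAt ℂ (p x)).symm.trans (chartAt ℂ (p y))).source := by
    have := (contDiffGroupoid ω 𝓘(ℂ)).compatible (chart_mem_atlas ℂ (p x)) (chart_mem_atlas ℂ (p y))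
    rw [contDiffGroupoid, mem_groupoid_of_pregroupoid] at this
    have := this.1
    simpa [contDiffPregroupoid] using this
  refine (key.mono ?_).congr ?_
  · intro w hw
    simp only [mfld_simps] at hw ⊢
    obtain ⟨⟨h1, h2⟩, h3, h4⟩ := hw
    refine ⟨h1, ?_⟩
    rw [hp.localInverseAt_symm] at h4
    rwa [hp.apply_localInverseAt_of_mem h2] at h4
  · intro w hw
    simp only [mfld_simps] at hw ⊢
    rw [hp.localInverseAt_symm, hp.apply_localInverseAt_of_mem hw.1.2]

/-- Holds for every `y`, also outside the chart domain, since the inverse of `localInverseAt` is `p`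
as a total function. In these charts `p` becomes the identity. -/
theorem spread_chart_eq (hp : IsLocalHomeomorph p) (x y : X) :
    letI := spreadChartedSpace hp
    chartAt ℂ x y = chartAt ℂ (p x) (p y) := by
  change chartAt ℂ (p x) ((hp.localInverseAt x).symm y) = _
  rw [hp.localInverseAt_symm]

theorem spread_mdifferentiable (hp : IsLocalHomeomorph p) :
    letI := spreadChartedSpace hp
    MDifferentiable 𝓘(ℂ) 𝓘(ℂ) p := by
  let _ := spreadChartedSpace hp
  have := spread_isManifold hp
  intro x
  have hx : x ∈ (chartAt ℂ x).source := mem_chart_source ℂ x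
  rw [mdifferentiableAt_iff_charts hx (mem_chart_source ℂ (p x))]
  refine ⟨hp.continuous.continuousAt, differentiableAt_id.congr_of_eventuallyEq ?_⟩
  filter_upwards [(chartAt ℂ x).open_target.mem_nhds ((chartAt ℂ x).map_source hx)] with w hw
  simp only [Function.comp, ← spread_chart_eq hp, id]
  exact (chartAt ℂ x).right_inv hw

/-- A chart factors through `p` and has injective differential, so the differential of `p` cannot
vanish. -/
theorem spread_mfderiv_ne_zero (hp : IsLocalHomeomorph p) (x : X) :
    letI := spreadChartedSpace hp
    mfderiv 𝓘(ℂ) 𝓘(ℂ) p x ≠ 0 := by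
  let _ := spreadChartedSpace hp
  have := spread_isManifold hp
  intro h0
  have hx : x ∈ (chartAt ℂ x).source := mem_chart_source ℂ x
  have hinj := (mdifferentiable_chart (I := 𝓘(ℂ)) x).mfderiv_injective hx
  have hc : (chartAt ℂ x : X → ℂ) = chartAt ℂ (p x) ∘ p := funext (spread_chart_eq hp x)
  have h1 : mfderiv 𝓘(ℂ) 𝓘(ℂ) (chartAt ℂ x) x = 0 := by
    rw [hc, mfderiv_comp x (mdifferentiableAt_atlas (chart_mem_atlas ℂ (p x))
      (mem_chart_source ℂ (p x))) (spread_mdifferentiable hp x), h0]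
    exact ContinuousLinearMap.comp_zero _
  rw [h1] at hinj
  have h10 : (1 : ℂ) = 0 := hinj (a₁ := (1 : ℂ)) (a₂ := (0 : ℂ)) rfl
  exact one_ne_zero h10

end LocalHomeomorph

/-! ### The space of germs of holomorphic maps -/

section Germs

variable (E : Type e) [NormedAddCommGroup E] [NormedSpace ℂ E]
  {M : Type u} [TopologicalSpace M] [ChartedSpace E M]

/-- A map that is holomorphic in a neighbourhood of `z`. -/
def HolAt (g : Sphere → M) (z : Sphere) : Prop :=
  ∀ᶠ y in 𝓝 z, MDifferentiableAt 𝓘(ℂ) 𝓘(ℂ, E) g y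

variable (M) in
/-- The germs of holomorphic maps from the extended complex plane to `M`. -/
def HolGerm : Type u :=
  {x : Σ z : Sphere, (𝓝 z).Germ M // ∃ g : Sphere → M, HolAt E g x.1 ∧ x.2 = (g : (𝓝 x.1).Germ M)}

variable {E}

theorem HolAt.eventually {g : Sphere → M} {z : Sphere} (h : HolAt E g z) :
    ∀ᶠ y in 𝓝 z, HolAt E g y :=
  eventually_eventually_nhds.2 h

theorem HolAt.congr {g g' : Sphere → M} {z : Sphere} (h : HolAt E g z) (hg : g =ᶠ[𝓝 z] g') :
    HolAt E g' z := by
  filter_upwards [h, hg.eventuallyEq_nhds] with y h1 h2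
  exact h1.congr_of_eventuallyEq h2.symm

namespace HolGerm

/-- The germ of `g` at `z`. -/
def jet (g : Sphere → M) (z : Sphere) (h : HolAt E g z) : HolGerm E M :=
  ⟨⟨z, (g : (𝓝 z).Germ M)⟩, g, h, rfl⟩

/-- The base point of a germ. -/
def base (x : HolGerm E M) : Sphere := x.1.1

/-- The value of a germ at its base point. -/
def value (x : HolGerm E M) : M := x.1.2.value

theorem exists_jet (x : HolGerm E M) : ∃ g z h, x = jet g z h := by
  obtain ⟨⟨z, γ⟩, g, h1, h2⟩ := x
  refine ⟨g, z, h1, Subtype.ext ?_⟩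
  simp only at h2
  subst h2
  rfl

@[simp] theorem base_jet (g : Sphere → M) (z : Sphere) (h : HolAt E g z) : base (jet g z h) = z :=
  rfl

@[simp] theorem value_jet (g : Sphere → M) (z : Sphere) (h : HolAt E g z) :
    value (jet g z h) = g z := rfl

theorem jet_eq_iff {g g' : Sphere → M} {z z' : Sphere} {h : HolAt E g z} {h' : HolAt E g' z'} :
    jet g z h = jet g' z' h' ↔ z = z' ∧ g =ᶠ[𝓝 z] g' := by
  constructor
  · intro heq
    have h1 : z = z' := congrArg base heq
    subst h1
    refine ⟨rfl, ?_⟩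
    have h2 := congrArg Subtype.val heq
    simp only [jet, Sigma.mk.injEq, heq_eq_eq, true_and] at h2
    exact Germ.coe_eq.1 h2
  · rintro ⟨rfl, hg⟩
    apply Subtype.ext
    simp only [jet, Sigma.mk.injEq, heq_eq_eq, true_and]
    exact Germ.coe_eq.2 hg

/-- The étale topology: a set is open if its pullback by each local section is open. -/
instance : TopologicalSpace (HolGerm E M) where
  IsOpen W := ∀ (g : Sphere → M) (z : Sphere) (h : HolAt E g z), jet g z h ∈ W →
    ∀ᶠ y in 𝓝 z, ∃ h', jet g y h' ∈ W
  isOpen_univ g z h _ := by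
    filter_upwards [h.eventually] with y hy using ⟨hy, trivial⟩
  isOpen_inter W W' h1 h2 g z h hW := by
    filter_upwards [h1 g z h hW.1, h2 g z h hW.2] with y ⟨h', hy⟩ ⟨_, hy'⟩
    exact ⟨h', hy, hy'⟩
  isOpen_sUnion C hC g z h := by
    rintro ⟨W, hW, hgW⟩
    filter_upwards [hC W hW g z h hgW] with y ⟨h', hy⟩
    exact ⟨h', W, hW, hy⟩

theorem isOpen_iff {W : Set (HolGerm E M)} : IsOpen W ↔
    ∀ (g : Sphere → M) (z : Sphere) (h : HolAt E g z), jet g z h ∈ W →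
      ∀ᶠ y in 𝓝 z, ∃ h', jet g y h' ∈ W := Iff.rfl

theorem continuous_base : Continuous (base : HolGerm E M → Sphere) := by
  refine ⟨fun O hO => isOpen_iff.2 fun g z h hz => ?_⟩
  filter_upwards [hO.mem_nhds hz, h.eventually] with y hy h'
  exact ⟨h', hy⟩

/-- The sheet of the germ space swept out by a holomorphic map. -/
def sheet (g : Sphere → M) (O : Set Sphere) : Set (HolGerm E M) :=
  {x | x.base ∈ O ∧ ∃ h, x = jet g x.base h}

theorem jet_mem_sheet {g g' : Sphere → M} {O : Set Sphere} {z : Sphere} {h : HolAt E g' z} :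
    jet g' z h ∈ sheet (E := E) g O ↔ z ∈ O ∧ g' =ᶠ[𝓝 z] g := by
  simp only [sheet, mem_ofPred_eq, base_jet, jet_eq_iff, true_and]
  exact and_congr_right fun _ => ⟨fun ⟨_, h⟩ => h, fun h' => ⟨h.congr h', h'⟩⟩

theorem isOpen_sheet (g : Sphere → M) {O : Set Sphere} (hO : IsOpen O) :
    IsOpen (sheet (E := E) g O) := by
  refine isOpen_iff.2 fun g' z h hz => ?_
  rw [jet_mem_sheet] at hz
  filter_upwards [hO.mem_nhds hz.1, hz.2.eventuallyEq_nhds, h.eventually] with y hy hgy hy'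
  exact ⟨hy', jet_mem_sheet.2 ⟨hy, hgy⟩⟩

/-- The local section of the germ space given by a map holomorphic on an open set. -/
def lift (g : Sphere → M) (O : Set Sphere) (hg : ∀ z ∈ O, HolAt E g z) (z : O) : HolGerm E M :=
  jet g z (hg z z.2)

theorem continuous_section (g : Sphere → M) {O : Set Sphere}
    (hg : ∀ z ∈ O, HolAt E g z) : Continuous (lift g O hg) := by
  refine ⟨fun W hW => ?_⟩
  rw [isOpen_iff_mem_nhds]
  rintro ⟨z, hz⟩ hzW
  have := hW g z (hg z hz) hzW
  rw [nhds_subtype_eq_comap, mem_comap]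
  refine ⟨_, this, ?_⟩
  rintro ⟨y, hy⟩ ⟨h', hyW⟩
  exact hyW

/-- Over an open set `O` where `g` is holomorphic, the base map sends the sheet of `g`
homeomorphically onto `O`, with inverse `lift`. -/
theorem isLocalHomeomorph_base : IsLocalHomeomorph (base : HolGerm E M → Sphere) := by
  refine isLocalHomeomorph_iff_isOpenEmbedding_restrict.2 fun x => ?_
  obtain ⟨g, z, h, rfl⟩ := exists_jet x
  obtain ⟨O, hOh, hO, hz⟩ := mem_nhds_iff.1 h.eventually
  refine ⟨sheet g O, (isOpen_sheet g hO).mem_nhds (jet_mem_sheet.2 ⟨hz, EventuallyEq.rfl⟩), ?_⟩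
  have hS : ∀ z ∈ O, HolAt E g z := hOh
  have hmem : ∀ z : O, lift g O hS z ∈ sheet (E := E) g O := fun z =>
    jet_mem_sheet.2 ⟨z.2, EventuallyEq.rfl⟩
  let φ : sheet (E := E) g O ≃ₜ O :=
    { toFun := fun x => ⟨base x.1, x.2.1⟩
      invFun := fun z => ⟨lift g O hS z, hmem z⟩
      left_inv := by
        rintro ⟨x, hx1, h', hx2⟩
        exact Subtype.ext hx2.symm
      right_inv := fun z => rfl
      continuous_toFun := (continuous_base.comp continuous_subtype_val).subtype_mk _
      continuous_invFun := (continuous_section g hS).subtype_mk _ }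
  exact hO.isOpenEmbedding_subtypeVal.comp φ.isOpenEmbedding

/-- Germs over different points are separated by the base map. Over the same point, take sheets over
a disc where both maps are holomorphic: a common germ anywhere in the disc would, by the identity
theorem, make the germs at the centre equal. -/
theorem t2Space [CompleteSpace E] [T2Space M] [IsManifold 𝓘(ℂ, E) ω M] :
    T2Space (HolGerm E M) := by
  refine ⟨fun x y hxy => ?_⟩
  by_cases hb : base x = base y
  · obtain ⟨g, z, h, rfl⟩ := exists_jet x
    obtain ⟨g', z', h', rfl⟩ := exists_jet y
    simp only [base_jet] at hb
    subst hb
    obtain ⟨K, hK, hKO⟩ := Sphere.exists_disc_subset (Filter.inter_mem h h')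
    have hr : (0 : ℝ) < 1 / K := by positivity
    have hO := Sphere.isOpen_disc z (1 / K)
    have hz := Sphere.mem_disc_self z hr
    refine ⟨sheet g (Sphere.disc z (1 / K)), sheet g' (Sphere.disc z (1 / K)), isOpen_sheet g hO,
      isOpen_sheet g' hO, jet_mem_sheet.2 ⟨hz, EventuallyEq.rfl⟩,
      jet_mem_sheet.2 ⟨hz, EventuallyEq.rfl⟩, ?_⟩
    refine Set.disjoint_left.2 fun w hw hw' => ?_
    obtain ⟨hwO, h1, hwg⟩ := hw
    obtain ⟨-, h2, hwg'⟩ := hw'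
    have heq := (jet_eq_iff.1 (hwg.symm.trans hwg')).2
    have hz' := eventuallyEq_of_isPreconnected hO (Sphere.isPreconnected_disc z _)
      (fun y hy => (hKO K le_rfl hy).1) (fun y hy => (hKO K le_rfl hy).2) hwO heq hz
    exact hxy (jet_eq_iff.2 ⟨rfl, hz'⟩)
  · obtain ⟨A, B, hA, hB, hxA, hyB, hAB⟩ := t2_separation hb
    exact ⟨_, _, hA.preimage continuous_base, hB.preimage continuous_base, hxA, hyB,
      hAB.preimage _⟩

end HolGerm

end Germs

/-! ### The regular Riemann surface -/

section OpenSubset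

variable {E : Type*} [NormedAddCommGroup E] [NormedSpace ℂ E]
  {N : Type*} [TopologicalSpace N] [ChartedSpace E N]
  {X : Type*} [TopologicalSpace X] [ChartedSpace ℂ X] {U : TopologicalSpace.Opens X}

theorem mdifferentiableAt_comp_subtype_val {g : X → N} {z : U} :
    MDifferentiableAt 𝓘(ℂ) 𝓘(ℂ, E) (g ∘ Subtype.val : U → N) z ↔
      MDifferentiableAt 𝓘(ℂ) 𝓘(ℂ, E) g z :=
  (differentiableWithinAt_localInvariantProp.liftPropAt_iff_comp_subtype_val _ _).symm

theorem mdifferentiableAt_subtype_val [IsManifold 𝓘(ℂ) ω X] (z : U) :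
    MDifferentiableAt 𝓘(ℂ) 𝓘(ℂ) (Subtype.val : U → X) z :=
  mdifferentiableAt_comp_subtype_val (g := id).2 mdifferentiableAt_id

theorem mfderiv_subtype_val_ne_zero [IsManifold 𝓘(ℂ) ω X] (z : U) :
    mfderiv 𝓘(ℂ) 𝓘(ℂ) (Subtype.val : U → X) z ≠ 0 := by
  intro h0
  have hz : z ∈ (chartAt ℂ z).source := mem_chart_source ℂ z
  have hinj := (mdifferentiable_chart (I := 𝓘(ℂ)) z).mfderiv_injective hz
  have hc : (chartAt ℂ z : U → ℂ) = chartAt ℂ (z : X) ∘ Subtype.val := rfl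
  have h1 : mfderiv 𝓘(ℂ) 𝓘(ℂ) (chartAt ℂ z) z = 0 := by
    rw [hc, mfderiv_comp z (mdifferentiableAt_atlas (chart_mem_atlas ℂ (z : X))
      (mem_chart_source ℂ (z : X))) (mdifferentiableAt_subtype_val z), h0]
    exact ContinuousLinearMap.comp_zero _
  rw [h1] at hinj
  have h10 : (1 : ℂ) = 0 := hinj (a₁ := (1 : ℂ)) (a₂ := (0 : ℂ)) rfl
  exact one_ne_zero h10

end OpenSubset

/-- A path element extended by a constant outside its domain. -/
def extendPath {M : Type*} {U : TopologicalSpace.Opens Sphere} (f : U → M) (z₁ : U) : Sphere → M :=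
  Function.extend Subtype.val f fun _ => f z₁

theorem extendPath_apply {M : Type*} {U : TopologicalSpace.Opens Sphere} {f : U → M} (z₁ z : U) :
    extendPath f z₁ z = f z :=
  Subtype.val_injective.extend_apply _ _ _

section RegularSurface

variable {E : Type e} [NormedAddCommGroup E] [NormedSpace ℂ E]
  {M : Type u} [TopologicalSpace M] [ChartedSpace E M]

open HolGerm

/-- The connected component of a germ, the Riemann surface of the germ. -/
def GermComponent (x₁ : HolGerm E M) : Type u := ↥(connectedComponent x₁)

namespace GermComponent

variable (x₁ : HolGerm E M)

instance : TopologicalSpace (GermComponent x₁) :=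
  inferInstanceAs (TopologicalSpace ↥(connectedComponent x₁))

instance : ConnectedSpace (GermComponent x₁) :=
  isConnected_iff_connectedSpace.1 isConnected_connectedComponent

instance [CompleteSpace E] [T2Space M] [IsManifold 𝓘(ℂ, E) ω M] : T2Space (GermComponent x₁) :=
  have : T2Space (HolGerm E M) := HolGerm.t2Space
  inferInstanceAs (T2Space ↥(connectedComponent x₁))

variable {x₁}

/-- The inclusion into the germ space. -/
def val (x : GermComponent x₁) : HolGerm E M := Subtype.val x

/-- The germ space is locally connected, being locally homeomorphic to the sphere, so its components
are open. -/
theorem isOpenEmbedding_val : IsOpenEmbedding (val : GermComponent x₁ → HolGerm E M) := by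
  let _ := spreadChartedSpace (HolGerm.isLocalHomeomorph_base (E := E) (M := M))
  have : LocallyConnectedSpace (HolGerm E M) := ChartedSpace.locallyConnectedSpace ℂ _
  exact isOpen_connectedComponent.isOpenEmbedding_subtypeVal

/-- The projection to the extended complex plane. -/
def proj (x : GermComponent x₁) : Sphere := x.val.base

/-- The value of a germ. -/
def eval (x : GermComponent x₁) : M := x.val.value

theorem isLocalHomeomorph_proj : IsLocalHomeomorph (proj : GermComponent x₁ → Sphere) :=
  HolGerm.isLocalHomeomorph_base.comp isOpenEmbedding_val.isLocalHomeomorph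

instance : ChartedSpace ℂ (GermComponent x₁) := spreadChartedSpace isLocalHomeomorph_proj

instance : IsManifold 𝓘(ℂ) ω (GermComponent x₁) := spread_isManifold isLocalHomeomorph_proj

theorem mdifferentiable_proj : MDifferentiable 𝓘(ℂ) 𝓘(ℂ) (proj : GermComponent x₁ → Sphere) :=
  spread_mdifferentiable isLocalHomeomorph_proj

theorem mfderiv_proj_ne_zero (x : GermComponent x₁) :
    mfderiv 𝓘(ℂ) 𝓘(ℂ) (proj : GermComponent x₁ → Sphere) x ≠ 0 :=
  spread_mfderiv_ne_zero isLocalHomeomorph_proj x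

/-- On the sheet of a representative `g`, evaluation is `g` composed with the projection. -/
theorem mdifferentiable_eval :
    MDifferentiable 𝓘(ℂ) 𝓘(ℂ, E) (eval : GermComponent x₁ → M) := by
  intro x
  obtain ⟨g, z, h, hx⟩ := exists_jet x.val
  have hz : proj x = z := by rw [proj, hx, base_jet]
  have h1 : MDifferentiableAt 𝓘(ℂ) 𝓘(ℂ, E) (g ∘ proj) x :=
    MDifferentiableAt.comp x (hz ▸ h.self_of_nhds) (mdifferentiable_proj x)
  refine h1.congr_of_eventuallyEq ?_
  have h2 : sheet (E := E) g univ ∈ 𝓝 x.val := (isOpen_sheet g isOpen_univ).mem_nhds (by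
    rw [hx]; exact jet_mem_sheet.2 ⟨trivial, EventuallyEq.rfl⟩)
  filter_upwards [isOpenEmbedding_val.continuous.continuousAt h2] with y hy
  obtain ⟨-, h', hy⟩ := hy
  change y.val.value = g y.val.base
  conv_lhs => rw [hy]
  rfl

end GermComponent

/-- A holomorphic map of a surface spread over the extended complex plane induces a map to the germ
space. -/
theorem exists_germ_lift {X : Type*} [TopologicalSpace X] [ChartedSpace ℂ X]
    [IsManifold 𝓘(ℂ) ω X] {π : X → Sphere} {F : X → M} {R : Set X} (hR : IsOpen R)
    (hπ : ∀ x ∈ R, MDifferentiableAt 𝓘(ℂ) 𝓘(ℂ) π x)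
    (hπ' : ∀ x ∈ R, mfderiv 𝓘(ℂ) 𝓘(ℂ) π x ≠ 0)
    (hF : ∀ x ∈ R, MDifferentiableAt 𝓘(ℂ) 𝓘(ℂ, E) F x) :
    ∃ h : R → HolGerm E M, Continuous h ∧
      (∀ x : R, base (h x) = π x ∧ value (h x) = F x) ∧
      ∀ (x : R) (g : Sphere → M) (hg : HolAt E g (π x)),
        (∀ᶠ y in 𝓝 (x : X), g (π y) = F y) → h x = jet g (π x) hg := by
  have hex : ∀ x : R, ∃ e : OpenPartialHomeomorph X Sphere, ↑x ∈ e.source ∧ e.source ⊆ R ∧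
      EqOn π e e.source := by
    intro x
    obtain ⟨e, h1, h2, -⟩ := exists_openPartialHomeomorph_of_mfderiv_ne_zero
      (by filter_upwards [hR.mem_nhds x.2] using hπ) (hπ' x x.2)
    refine ⟨e.restrOpen R hR, ?_, ?_, ?_⟩
    · rw [OpenPartialHomeomorph.restrOpen_source]; exact ⟨h1, x.2⟩
    · rw [OpenPartialHomeomorph.restrOpen_source]; exact inter_subset_right
    · rw [OpenPartialHomeomorph.restrOpen_source]; exact fun y hy => h2 hy.1
  choose e he heR heπ using hex
  have hright : ∀ (x : R), ∀ w ∈ (e x).target, π ((e x).symm w) = w := fun x w hw => by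
    rw [heπ x ((e x).map_target hw), (e x).right_inv hw]
  have hsymm : ∀ (x : R), ∀ w ∈ (e x).target,
      MDifferentiableAt 𝓘(ℂ) 𝓘(ℂ, E) (F ∘ (e x).symm) w := by
    intro x w hw
    have hwR : (e x).symm w ∈ R := heR x ((e x).map_target hw)
    refine MDifferentiableAt.comp w (hF _ hwR) ?_
    refine mdifferentiableAt_of_comp (g := π) ((e x).continuousAt_symm hw)
      (by filter_upwards [hR.mem_nhds hwR] using hπ) (hπ' _ hwR) ?_
    refine mdifferentiableAt_id.congr_of_eventuallyEq ?_
    filter_upwards [(e x).open_target.mem_nhds hw] with w' hw' using hright x w' hw'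
  have hmem : ∀ x : R, ∀ y ∈ (e x).source, π y ∈ (e x).target := fun x y hy => by
    rw [heπ x hy]; exact (e x).map_source hy
  have hhol : ∀ (x : R), ∀ y ∈ (e x).source, HolAt E (F ∘ (e x).symm) (π y) := fun x y hy => by
    filter_upwards [(e x).open_target.mem_nhds (hmem x y hy)] using hsymm x
  have hinv : ∀ x : R, ∀ y ∈ (e x).source, (e x).symm (π y) = y := fun x y hy => by
    rw [heπ x hy, (e x).left_inv hy]
  -- The germ does not depend on the chosen local inverse: any `g` with `g ∘ π = F` near `x` defines
  -- it. Continuity follows, since one local inverse then computes the germs at all nearby points.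
  have hchar : ∀ (x : R) (g : Sphere → M) (hg : HolAt E g (π x)),
      (∀ᶠ y in 𝓝 (x : X), g (π y) = F y) →
        jet (F ∘ (e x).symm) (π x) (hhol x x (he x)) = jet g (π x) hg := by
    intro x g hg hgF
    refine jet_eq_iff.2 ⟨rfl, ?_⟩
    have ht := hmem x x (he x)
    have hcont : Tendsto (e x).symm (𝓝 (π x)) (𝓝 (x : X)) := by
      have := ((e x).continuousAt_symm ht).tendsto
      rwa [hinv x x (he x)] at this
    filter_upwards [hcont.eventually hgF, (e x).open_target.mem_nhds ht] with w hw hwt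
    rw [hright x w hwt] at hw
    exact hw.symm
  refine ⟨fun x => jet (F ∘ (e x).symm) (π x) (hhol x x (he x)), ?_, fun x => ⟨rfl, ?_⟩, hchar⟩
  · rw [continuous_iff_continuousAt]
    intro x W hW
    obtain ⟨W', hW'W, hW'o, hxW'⟩ := mem_nhds_iff.1 hW
    have hc : ContinuousAt (fun y : R => π y) x :=
      (hπ x x.2).continuousAt.comp continuous_subtype_val.continuousAt
    have hs : ∀ᶠ y : R in 𝓝 x, (y : X) ∈ (e x).source :=
      continuous_subtype_val.continuousAt ((e x).open_source.mem_nhds (he x))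
    refine Filter.mem_map.2 ?_
    filter_upwards [hc.eventually (hW'o _ _ _ hxW'), hs] with y ⟨hy, hyW⟩ hys
    refine hW'W ?_
    have hFy : ∀ᶠ y' in 𝓝 (y : X), (F ∘ (e x).symm) (π y') = F y' := by
      filter_upwards [(e x).open_source.mem_nhds hys] with y' hy'
      simp only [Function.comp, hinv x y' hy']
    exact mem_of_eq_of_mem (hchar y (F ∘ (e x).symm) hy hFy) hyW
  · rw [value_jet]
    simp only [Function.comp, hinv x x (he x)]

variable {U : TopologicalSpace.Opens Sphere} {f : U → M}

/-- By the chain rule, as `proj ∘ j` is the inclusion of `U`. So the image of `j` avoids the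
critical points of a standard continuation. -/
theorem Continuation.mfderiv_proj_j_ne_zero (Q : Continuation.{e, u, w} E U f) (z : U) :
    mfderiv 𝓘(ℂ) 𝓘(ℂ) Q.proj (Q.j z) ≠ 0 := by
  intro h0
  have h1 := mfderiv_comp z (Q.proj_holo (Q.j z)) (Q.j_holo z)
  rw [h0, show Q.proj ∘ Q.j = Subtype.val from funext Q.proj_j] at h1
  exact mfderiv_subtype_val_ne_zero z (h1.trans (ContinuousLinearMap.zero_comp _))

theorem Continuation.isStandard (Q : Continuation.{e, u, w} E U f) (hU : (U : Set Sphere).Nonempty) :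
    Q.IsStandard := by
  obtain ⟨z, hz⟩ := hU
  by_contra hne
  simp only [Continuation.IsStandard, not_exists, not_not] at hne
  refine Q.mfderiv_proj_j_ne_zero ⟨z, hz⟩ ?_
  have : Q.proj = fun _ => Q.proj (Q.j ⟨z, hz⟩) := funext fun x => hne _ _
  rw [this]
  exact mfderiv_const

theorem holAt_extendPath (hf : MDifferentiable 𝓘(ℂ) 𝓘(ℂ, E) f) (z₁ z : U) :
    HolAt E (extendPath f z₁) z := by
  filter_upwards [U.isOpen.mem_nhds z.2] with y hy
  rw [← mdifferentiableAt_comp_subtype_val (z := (⟨y, hy⟩ : U))]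
  have : extendPath f z₁ ∘ Subtype.val = f := funext (extendPath_apply z₁)
  rw [this]
  exact hf _

/-- The germ of a path element. -/
def pathGerm (hf : MDifferentiable 𝓘(ℂ) 𝓘(ℂ, E) f) (z₁ z : U) : HolGerm E M :=
  jet (extendPath f z₁) z (holAt_extendPath hf z₁ z)

theorem continuous_pathGerm (hf : MDifferentiable 𝓘(ℂ) 𝓘(ℂ, E) f) (z₁ : U) :
    Continuous (pathGerm hf z₁) :=
  continuous_section (O := (U : Set Sphere)) _ fun z hz => holAt_extendPath hf z₁ ⟨z, hz⟩

theorem pathGerm_mem (hU : IsConnected (U : Set Sphere)) (hf : MDifferentiable 𝓘(ℂ) 𝓘(ℂ, E) f)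
    (z₁ z : U) : pathGerm hf z₁ z ∈ connectedComponent (pathGerm hf z₁ z₁) := by
  have : PreconnectedSpace U := isPreconnected_iff_preconnectedSpace.1 hU.isPreconnected
  exact (isPreconnected_range (continuous_pathGerm hf z₁)).subset_connectedComponent
    (mem_range_self _) (mem_range_self _)

variable [CompleteSpace E] [T2Space M] [IsManifold 𝓘(ℂ, E) ω M]

/-- The regular Riemann surface of a path element. -/
def regularSurface (hU : IsConnected (U : Set Sphere)) (hf : MDifferentiable 𝓘(ℂ) 𝓘(ℂ, E) f)
    (z₁ : U) : Continuation.{e, u, u} E U f where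
  S := GermComponent (pathGerm hf z₁ z₁)
  proj := GermComponent.proj
  proj_holo := GermComponent.mdifferentiable_proj
  j z := ⟨pathGerm hf z₁ z, pathGerm_mem hU hf z₁ z⟩
  j_holo z := by
    refine mdifferentiableAt_of_comp (g := GermComponent.proj) ?_
      (.of_forall GermComponent.mdifferentiable_proj) (GermComponent.mfderiv_proj_ne_zero _)
      (mdifferentiableAt_subtype_val z)
    exact ((continuous_pathGerm hf z₁).subtype_mk _).continuousAt
  proj_j _ := rfl
  F := GermComponent.eval
  F_holo := GermComponent.mdifferentiable_eval
  F_j z := extendPath_apply z₁ z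

/-- Stated on an open connected part `R` in order to serve twice: with `R` the whole surface for
regular continuations, and with the critical points removed for standard ones. -/
theorem exists_regular_lift (hU : IsConnected (U : Set Sphere))
    (hf : MDifferentiable 𝓘(ℂ) 𝓘(ℂ, E) f) (z₁ : U) (Q : Continuation.{e, u, v} E U f) {R : Set Q.S}
    (hR : IsOpen R) (hRc : IsPreconnected R)
    (hreg : ∀ x ∈ R, mfderiv 𝓘(ℂ) 𝓘(ℂ) Q.proj x ≠ 0) (hj : ∀ z, Q.j z ∈ R) :
    ∃ h : Q.S → (regularSurface hU hf z₁).S,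
      (∀ x ∈ R, MDifferentiableAt 𝓘(ℂ) 𝓘(ℂ) h x ∧ (regularSurface hU hf z₁).proj (h x) = Q.proj x ∧
        (regularSurface hU hf z₁).F (h x) = Q.F x) ∧
      ∀ z, h (Q.j z) = (regularSurface hU hf z₁).j z := by
  obtain ⟨h, hc, hval, hchar⟩ := exists_germ_lift hR (fun x _ => Q.proj_holo x) hreg
    (fun x _ => Q.F_holo x)
  have hjz : ∀ z : U, h ⟨Q.j z, hj z⟩ = pathGerm hf z₁ z := by
    intro z
    have hpj := Q.proj_j z
    have hg : HolAt E (extendPath f z₁) (Q.proj (Q.j z)) := by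
      rw [hpj]; exact holAt_extendPath hf z₁ z
    rw [hchar ⟨Q.j z, hj z⟩ (extendPath f z₁) hg ?_]
    · exact jet_eq_iff.2 ⟨hpj, EventuallyEq.rfl⟩
    -- It remains to see that `f ∘ π = F` near `Q.j z`. Local injectivity of the projection gives `y
    -- = j (π y)` for `y` near `Q.j z`, and then `F y = f (π y)`.
    obtain ⟨e, he, heq, -⟩ := exists_openPartialHomeomorph_of_mfderiv_ne_zero
      (.of_forall Q.proj_holo) (Q.mfderiv_proj_j_ne_zero z)
    have h1 : ∀ᶠ z' : U in 𝓝 z, Q.j z' ∈ e.source :=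
      (Q.j_holo z).continuousAt (e.open_source.mem_nhds he)
    have h2 : ∀ᶠ w in 𝓝 (z : Sphere), ∃ hw : w ∈ U, Q.j ⟨w, hw⟩ ∈ e.source := by
      rw [nhds_subtype_eq_comap, eventually_comap] at h1
      filter_upwards [h1, U.isOpen.mem_nhds z.2] with w hw hwU using ⟨hwU, hw ⟨w, hwU⟩ rfl⟩
    have hπc : Tendsto Q.proj (𝓝 (Q.j z)) (𝓝 (z : Sphere)) := by
      have := (Q.proj_holo (Q.j z)).continuousAt.tendsto
      rwa [hpj] at this
    filter_upwards [hπc.eventually h2, e.open_source.mem_nhds he] with y ⟨hyU, hy⟩ hys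
    have h3 : Q.j ⟨Q.proj y, hyU⟩ = y := by
      refine e.injOn hy hys ?_
      rw [← heq hy, ← heq hys, Q.proj_j]
    conv_rhs => rw [← h3, Q.F_j]
    exact extendPath_apply z₁ ⟨Q.proj y, hyU⟩
  have hRcs : PreconnectedSpace R := isPreconnected_iff_preconnectedSpace.1 hRc
  have hmem : ∀ x : R, h x ∈ connectedComponent (pathGerm hf z₁ z₁) := fun x =>
    (isPreconnected_range hc).subset_connectedComponent ⟨_, hjz z₁⟩ (mem_range_self x)
  classical
  -- The value outside `R` is an arbitrary default; all assertions concern points of `R`.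
  let k : Q.S → (regularSurface hU hf z₁).S := fun x =>
    if hx : x ∈ R then ⟨h ⟨x, hx⟩, hmem ⟨x, hx⟩⟩ else (regularSurface hU hf z₁).j z₁
  have hk : ∀ (x) (hx : x ∈ R), k x = ⟨h ⟨x, hx⟩, hmem ⟨x, hx⟩⟩ := fun x hx => dif_pos hx
  have hkproj : ∀ x ∈ R, (regularSurface hU hf z₁).proj (k x) = Q.proj x := fun x hx => by
    rw [hk x hx]; exact (hval ⟨x, hx⟩).1
  have hkc : ContinuousOn k R := by
    rw [continuousOn_iff_continuous_domRestrict]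
    have : R.domRestrict k = fun x : R => (⟨h x, hmem x⟩ : connectedComponent (pathGerm hf z₁ z₁)) :=
      funext fun x => hk x x.2
    rw [this]
    exact hc.subtype_mk _
  refine ⟨k, fun x hx => ⟨?_, hkproj x hx, ?_⟩, fun z => ?_⟩
  · refine mdifferentiableAt_of_comp (g := (regularSurface hU hf z₁).proj)
      (hkc.continuousAt (hR.mem_nhds hx))
      (.of_forall (regularSurface hU hf z₁).proj_holo) (GermComponent.mfderiv_proj_ne_zero _) ?_
    refine (Q.proj_holo x).congr_of_eventuallyEq ?_
    filter_upwards [hR.mem_nhds hx] using hkproj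
  · rw [hk x hx]; exact (hval ⟨x, hx⟩).2
  · rw [hk _ (hj z)]; exact Subtype.ext (hjz z)

theorem regularSurface_isRegular (hU : IsConnected (U : Set Sphere))
    (hf : MDifferentiable 𝓘(ℂ) 𝓘(ℂ, E) f) (z₁ : U) : (regularSurface hU hf z₁).IsRegular :=
  GermComponent.mfderiv_proj_ne_zero

theorem regularSurface_isRegularRiemannSurface (hU : IsConnected (U : Set Sphere))
    (hf : MDifferentiable 𝓘(ℂ) 𝓘(ℂ, E) f) (z₁ : U) :
    (regularSurface hU hf z₁).IsRegularRiemannSurface.{e, u, v, u} := by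
  refine ⟨regularSurface_isRegular hU hf z₁, fun Q hQ => ?_⟩
  obtain ⟨h, h1, h2⟩ := exists_regular_lift hU hf z₁ Q isOpen_univ isPreconnected_univ
    (fun x _ => hQ x) fun _ => trivial
  exact ⟨h, fun x => (h1 x trivial).1, h2⟩

end RegularSurface

/-! ### Superstructural singularities and the removable completion -/

theorem exists_openPartialHomeomorph_of_injOn {X Y : Type*} [TopologicalSpace X] [TopologicalSpace Y]
    [Nonempty X] {g : X → Y} {s : Set X} (hs : IsOpen s) (hc : ContinuousOn g s) (hi : InjOn g s)
    (ho : ∀ x ∈ s, 𝓝 (g x) ≤ map g (𝓝 x)) :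
    ∃ φ : OpenPartialHomeomorph X Y, φ.source = s ∧ (φ : X → Y) = g := by
  refine ⟨OpenPartialHomeomorph.ofContinuousOpenRestrict (hi.toPartialEquiv g s) hc ?_ hs, rfl, rfl⟩
  rw [isOpenMap_iff_nhds_le]
  rintro ⟨x, hx⟩
  have h1 : map (s.domRestrict g) (𝓝 ⟨x, hx⟩) = map g (𝓝 x) := by
    rw [← hs.isOpenEmbedding_subtypeVal.map_nhds_eq ⟨x, hx⟩, map_map]
    rfl
  exact (ho x hx).trans_eq h1.symm

theorem ncard_preimage_restrict {X Y : Type*} {p : X → Y} {V : Set X} {D : Set Y} (hm : MapsTo p V D)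
    (z : D) : (hm.restrict ⁻¹' {z}).ncard = {x | x ∈ V ∧ p x = z}.ncard := by
  rw [← ncard_image_of_injective _ Subtype.val_injective]
  congr 1
  ext x
  constructor
  · rintro ⟨⟨x, hx⟩, hxz, rfl⟩
    exact ⟨hx, congrArg Subtype.val hxz⟩
  · rintro ⟨hx, hxz⟩
    exact ⟨⟨x, hx⟩, Subtype.ext hxz, rfl⟩

namespace Continuation

variable {E : Type e} [NormedAddCommGroup E] [NormedSpace ℂ E]
  {M : Type u} [TopologicalSpace M] [ChartedSpace E M]
  {U : TopologicalSpace.Opens Sphere} {f : U → M}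

theorem eventually_proj_ne_and_mfderiv_ne (Q : Continuation.{e, u, w} E U f)
    (hU : (U : Set Sphere).Nonempty) (x : Q.S) :
    ∀ᶠ y in 𝓝[≠] x, Q.proj y ≠ Q.proj x ∧ mfderiv 𝓘(ℂ) 𝓘(ℂ) Q.proj y ≠ 0 := by
  obtain ⟨z, hz⟩ := hU
  have hnc := not_eventually_const Q.proj_holo (Q.mfderiv_proj_j_ne_zero ⟨z, hz⟩) x
  refine Filter.Eventually.and ?_
    ((eventually_const_or_mfderiv_ne_zero (.of_forall Q.proj_holo)).resolve_left hnc)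
  refine (eventuallyEq_or_eventually_ne (E := ℂ) (.of_forall Q.proj_holo)
    (g₂ := fun _ => Q.proj x) (.of_forall fun _ => mdifferentiableAt_const)).resolve_left hnc

/-- The Poincaré–Volterra theorem applies because the section `j` keeps the projection from being
constant near any point, so its fibres are discrete. -/
theorem secondCountableTopology (Q : Continuation.{e, u, w} E U f)
    (hU : (U : Set Sphere).Nonempty) : SecondCountableTopology Q.S := by
  have : LocallyCompactSpace Q.S := ChartedSpace.locallyCompactSpace ℂ _
  have : LocallyConnectedSpace Q.S := ChartedSpace.locallyConnectedSpace ℂ _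
  exact secondCountableTopology_of_discrete_fibers
    (fun x => ⟨(chartAt ℂ x).source, (chartAt ℂ x).open_source.mem_nhds (mem_chart_source ℂ x),
      (chartAt ℂ x).secondCountableTopology_source⟩)
    Q.proj_holo.continuous
    fun x => (Q.eventually_proj_ne_and_mfderiv_ne hU x).mono fun _ h => h.1

theorem isLocalHomeomorphOn_proj (Q : Continuation.{e, u, w} E U f) {R : Set Q.S}
    (hR : ∀ x ∈ R, mfderiv 𝓘(ℂ) 𝓘(ℂ) Q.proj x ≠ 0) : IsLocalHomeomorphOn Q.proj R := by
  refine IsLocalHomeomorphOn.mk _ _ fun x hx => ?_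
  obtain ⟨e, h1, h2, -⟩ := exists_openPartialHomeomorph_of_mfderiv_ne_zero
    (.of_forall Q.proj_holo) (hR x hx)
  exact ⟨e, h1, h2⟩

theorem IsRegular.isLocalHomeomorph {Q : Continuation.{e, u, w} E U f} (hQ : Q.IsRegular) :
    IsLocalHomeomorph Q.proj :=
  isLocalHomeomorph_iff_isLocalHomeomorphOn_univ.2 (Q.isLocalHomeomorphOn_proj fun x _ => hQ x)

namespace SingularSequence

variable {Q : Continuation.{e, u, w} E U f} (s : Q.SingularSequence) {k l : ℕ}

theorem pos_of_le (hk : s.K ≤ k) : 0 < k := s.K_pos.trans_le hk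

theorem mapsTo (hk : s.K ≤ k) : MapsTo Q.proj (s.V k) (Sphere.puncturedDisc s.z₀ (1 / k)) :=
  (s.covering k hk).choose

theorem nonempty (hk : s.K ≤ k) : (s.V k).Nonempty := by
  obtain ⟨x, hx, hV⟩ := s.component k hk
  exact ⟨x, hV ▸ mem_connectedComponentIn hx⟩

theorem isPreconnected (hk : s.K ≤ k) : IsPreconnected (s.V k) := by
  obtain ⟨x, hx, hV⟩ := s.component k hk
  rw [hV]
  exact isPreconnected_connectedComponentIn

theorem ncard_fiber (hk : s.K ≤ k) {z : Sphere} (hz : z ∈ Sphere.puncturedDisc s.z₀ (1 / k)) :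
    {x | x ∈ s.V k ∧ Q.proj x = z}.ncard = s.n := by
  obtain ⟨h, -, hn⟩ := s.covering k hk
  rw [← hn ⟨z, hz⟩, ncard_preimage_restrict]

/-- Both `V l ⊆ V k` have exactly `n` points over `Q.proj x`, so the two fibres coincide. The
constancy of `n` along the sequence is what makes this work. -/
theorem mem_of_proj_mem (hk : s.K ≤ k) (hkl : k ≤ l) {x : Q.S} (hx : x ∈ s.V k)
    (hl : Q.proj x ∈ Sphere.puncturedDisc s.z₀ (1 / l)) : x ∈ s.V l := by
  have h1 := s.ncard_fiber hk (Sphere.puncturedDisc_mono _ (Sphere.one_div_le (s.pos_of_le hk) hkl) hl)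
  have h2 := s.ncard_fiber (hk.trans hkl) hl
  have hfin : {y | y ∈ s.V k ∧ Q.proj y = Q.proj x}.Finite :=
    finite_of_ncard_ne_zero (h1.trans_ne s.n_pos.ne')
  have heq := eq_of_subset_of_ncard_le (s := {y | y ∈ s.V l ∧ Q.proj y = Q.proj x})
    (t := {y | y ∈ s.V k ∧ Q.proj y = Q.proj x})
    (fun y hy => ⟨s.antitone hk hkl hy.1, hy.2⟩) (h1.trans_le h2.ge) hfin
  have hx' : x ∈ {y | y ∈ s.V k ∧ Q.proj y = Q.proj x} := ⟨hx, rfl⟩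
  rw [← heq] at hx'
  exact hx'.1

theorem z₀_eq_of_equiv {s t : Q.SingularSequence} (h : s ≈ t) : s.z₀ = t.z₀ := by
  obtain ⟨L, hL⟩ := h
  by_contra hne
  obtain ⟨A, B, hA, hB, hsA, htB, hAB⟩ := t2_separation hne
  obtain ⟨K₁, -, h₁⟩ := Sphere.exists_disc_subset (hA.mem_nhds hsA)
  obtain ⟨K₂, -, h₂⟩ := Sphere.exists_disc_subset (hB.mem_nhds htB)
  set k := max (max K₁ K₂) (max L (max s.K t.K)) with hk
  obtain ⟨x, hx⟩ := s.nonempty (k := k) (by omega)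
  have hxt : x ∈ t.V k := hL k (by omega) ▸ hx
  exact Set.disjoint_left.1 hAB (h₁ k (by omega) (s.mapsTo (by omega) hx).1)
    (h₂ k (by omega) (t.mapsTo (by omega) hxt).1)

/-- With a common centre, both sets are components of the same preimage. -/
theorem eq_or_disjoint {s t : Q.SingularSequence} (hz : s.z₀ = t.z₀) (hs : s.K ≤ k) (ht : t.K ≤ k) :
    s.V k = t.V k ∨ Disjoint (s.V k) (t.V k) := by
  obtain ⟨x, -, hV⟩ := s.component k hs
  obtain ⟨y, -, hV'⟩ := t.component k ht
  rw [hV, hV', hz]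
  by_cases h : (connectedComponentIn (Q.proj ⁻¹' Sphere.puncturedDisc t.z₀ (1 / k)) x ∩
      connectedComponentIn (Q.proj ⁻¹' Sphere.puncturedDisc t.z₀ (1 / k)) y).Nonempty
  · obtain ⟨w, hw₁, hw₂⟩ := h
    exact Or.inl ((connectedComponentIn_eq hw₁).trans (connectedComponentIn_eq hw₂).symm)
  · exact Or.inr (disjoint_iff_inter_eq_empty.2 (not_nonempty_iff_eq_empty.1 h))

/-- A uniformizing function around a singularity. -/
theorem exists_root (hk : s.K ≤ k) : ∃ (N : ℕ) (t : s.V k → ℂ), 0 < N ∧ IsOpenEmbedding t ∧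
    range t = {τ | τ ≠ 0 ∧ ‖τ ^ N‖ < 1 / k} ∧ ∀ x, Sphere.param s.z₀ (t x ^ N) = Q.proj x := by
  obtain ⟨h, hcov, hn⟩ := s.covering k hk
  have hr : (0 : ℝ) < 1 / k := by
    have := s.pos_of_le hk
    positivity
  have hcs : ConnectedSpace (s.V k) :=
    isConnected_iff_connectedSpace.1 ⟨s.nonempty hk, s.isPreconnected hk⟩
  set D : Set ℂ := Metric.ball 0 (1 / k : ℝ) \ {0} with hD
  let ψ : D ≃ₜ Sphere.puncturedDisc s.z₀ (1 / k) :=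
    ((Sphere.isOpenEmbedding_param s.z₀).isEmbedding.homeomorphImage D).trans
      (Homeomorph.setCongr (Sphere.puncturedDisc_eq s.z₀ (1 / k)).symm)
  have hψ : ∀ u : D, (ψ u : Sphere) = Sphere.param s.z₀ u := fun u => rfl
  obtain ⟨N, t, hN, ht, hrange, hpow⟩ := exists_root_of_isCoveringMap hr hD
    (p := ψ.symm ∘ h.restrict) (hcov.homeomorph_comp ψ.symm) fun z => by
      rw [preimage_comp, ← ψ.image_eq_preimage_symm, image_singleton]
      exact finite_of_ncard_ne_zero ((hn _).trans_ne s.n_pos.ne')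
  refine ⟨N, t, hN, ht, hrange, fun x => ?_⟩
  rw [hpow, ← hψ]
  simp

/-- The basic neighbourhoods of a singularity in the completion. -/
def nhd (k : ℕ) : Set Q.RemovableCompletion :=
  {y | (∃ x ∈ s.V k, y = .point x) ∨
    ∃ hs : SuperstructuralSingularity.IsRemovable (Quotient.mk _ s), y = .singular _ hs}

theorem point_mem_nhd {x : Q.S} : RemovableCompletion.point x ∈ s.nhd k ↔ x ∈ s.V k := by
  simp [nhd]

theorem singular_mem_nhd {p : Q.SuperstructuralSingularity} {hp : p.IsRemovable} :
    RemovableCompletion.singular p hp ∈ s.nhd k ↔ p = Quotient.mk _ s := by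
  constructor
  · rintro (⟨x, -, h⟩ | ⟨hs', h⟩)
    · cases h
    · exact (RemovableCompletion.singular.inj h)
  · rintro rfl
    exact Or.inr ⟨hp, rfl⟩

theorem isOpen_nhd (hk : s.K ≤ k) : IsOpen (s.nhd k) := by
  refine ⟨?_, fun t ht hmem => ?_⟩
  · simp only [point_mem_nhd]
    exact s.isOpen k hk
  · obtain ⟨L, hL⟩ := Quotient.exact (s.singular_mem_nhd.1 hmem)
    refine ⟨max (max k t.K) L, by omega, fun x hx => ?_⟩
    rw [hL _ (by omega)] at hx
    exact s.point_mem_nhd.2 (s.antitone hk (by omega) hx)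

end SingularSequence

/-! ### Topology and complex structure of the completion. -/

namespace RemovableCompletion

variable {Q : Continuation.{e, u, w} E U f}

theorem isOpenEmbedding_point : IsOpenEmbedding (point : Q.S → Q.RemovableCompletion) := by
  refine IsOpenEmbedding.of_continuous_injective_isOpenMap ⟨fun O hO => hO.1⟩
    (fun x y h => by simpa using h) fun O hO => ⟨?_, fun s hs hmem => ?_⟩
  · convert hO
    ext x; simp
  · simp at hmem

theorem mem_nhds_singular {s : Q.SingularSequence}
    {hs : SuperstructuralSingularity.IsRemovable (Quotient.mk _ s)} {W : Set Q.RemovableCompletion} :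
    W ∈ 𝓝 (singular (Quotient.mk _ s) hs) ↔ ∃ k ≥ s.K, s.nhd k ⊆ W := by
  constructor
  · intro hW
    obtain ⟨O, hOW, hO, hsO⟩ := mem_nhds_iff.1 hW
    obtain ⟨k, hk, hV⟩ := hO.2 s hs hsO
    refine ⟨k, hk, fun y hy => hOW ?_⟩
    rcases hy with ⟨x, hx, rfl⟩ | ⟨hs', rfl⟩
    · exact hV x hx
    · exact hsO
  · rintro ⟨k, hk, hsub⟩
    exact mem_of_superset ((s.isOpen_nhd hk).mem_nhds (s.singular_mem_nhd.2 rfl)) hsub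

theorem continuousAt_singular {Y : Type*} [TopologicalSpace Y] {g : Q.RemovableCompletion → Y}
    {s : Q.SingularSequence} {hs : SuperstructuralSingularity.IsRemovable (Quotient.mk _ s)}
    (h : ∀ O ∈ 𝓝 (g (singular (Quotient.mk _ s) hs)), ∃ k ≥ s.K, ∀ x ∈ s.V k, g (point x) ∈ O) :
    ContinuousAt g (singular (Quotient.mk _ s) hs) := by
  intro O hO
  obtain ⟨k, hk, hV⟩ := h O hO
  refine mem_nhds_singular.2 ⟨k, hk, ?_⟩
  rintro y (⟨x, hx, rfl⟩ | ⟨hs', rfl⟩)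
  · exact hV x hx
  · exact (mem_of_mem_nhds hO : g (singular _ hs) ∈ O)

theorem denseRange_point : DenseRange (point : Q.S → Q.RemovableCompletion) := by
  intro y
  rcases y with x | ⟨p, hp⟩
  · exact subset_closure (mem_range_self x)
  · induction p using Quotient.inductionOn with
    | h s =>
      rw [mem_closure_iff_nhds]
      intro W hW
      obtain ⟨k, hk, hsub⟩ := mem_nhds_singular.1 hW
      obtain ⟨x, hx⟩ := s.nonempty hk
      exact ⟨point x, hsub (s.point_mem_nhd.2 hx), mem_range_self x⟩

instance : ConnectedSpace Q.RemovableCompletion :=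
  { denseRange_point.preconnectedSpace isOpenEmbedding_point.continuous with
    toNonempty := (inferInstance : Nonempty Q.S).map point }

/-- The projection of the completion. -/
def proj : Q.RemovableCompletion → Sphere
  | point x => Q.proj x
  | singular p _ => p.lift SingularSequence.z₀ fun _ _ h => SingularSequence.z₀_eq_of_equiv h

theorem continuous_proj : Continuous (proj : Q.RemovableCompletion → Sphere) := by
  rw [continuous_iff_continuousAt]
  rintro (x | ⟨p, hp⟩)
  · exact isOpenEmbedding_point.continuousAt_iff.1 (Q.proj_holo x).continuousAt
  · induction p using Quotient.inductionOn with
    | h s =>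
      refine continuousAt_singular fun O hO => ?_
      obtain ⟨K, -, hK⟩ := Sphere.exists_disc_subset hO
      exact ⟨max K s.K, by omega, fun x hx => hK _ (by omega) (s.mapsTo (by omega) hx).1⟩

/-- A point and a singularity are separated because the closures of the `V k` have empty
intersection. Distinct singularities over one point have different, hence disjoint, components at
some level. Singularities over different points are separated by the projection. -/
instance : T2Space Q.RemovableCompletion := by
  have hps : ∀ (x : Q.S) (s : Q.SingularSequence)
      (hs : SuperstructuralSingularity.IsRemovable (Quotient.mk _ s)),
      ∃ A B : Set Q.RemovableCompletion, IsOpen A ∧ IsOpen B ∧ point x ∈ A ∧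
        singular (Quotient.mk _ s) hs ∈ B ∧ Disjoint A B := by
    intro x s hs
    have hx : x ∉ ⋂ k ≥ s.K, closure (s.V k) := by rw [s.iInter_closure]; exact notMem_empty x
    simp only [mem_iInter, not_forall] at hx
    obtain ⟨k, hk, hx⟩ := hx
    refine ⟨point '' (closure (s.V k))ᶜ, s.nhd k,
      isOpenEmbedding_point.isOpenMap _ isClosed_closure.isOpen_compl, s.isOpen_nhd hk,
      ⟨x, hx, rfl⟩, s.singular_mem_nhd.2 rfl, ?_⟩
    rw [Set.disjoint_left]
    rintro _ ⟨y, hy, rfl⟩ hy'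
    exact hy (subset_closure (s.point_mem_nhd.1 hy'))
  refine ⟨fun a b hab => ?_⟩
  rcases a with x | ⟨p, hp⟩ <;> rcases b with y | ⟨q, hq⟩
  · obtain ⟨A, B, hA, hB, hxA, hyB, hAB⟩ := t2_separation (show x ≠ y from fun h => hab (h ▸ rfl))
    exact ⟨_, _, isOpenEmbedding_point.isOpenMap _ hA, isOpenEmbedding_point.isOpenMap _ hB,
      ⟨x, hxA, rfl⟩, ⟨y, hyB, rfl⟩, (disjoint_image_iff isOpenEmbedding_point.injective).2 hAB⟩
  · induction q using Quotient.inductionOn with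
    | h s => exact hps x s hq
  · induction p using Quotient.inductionOn with
    | h s =>
      obtain ⟨A, B, hA, hB, h1, h2, hAB⟩ := hps y s hp
      exact ⟨B, A, hB, hA, h2, h1, hAB.symm⟩
  · induction p using Quotient.inductionOn with
    | h s =>
    induction q using Quotient.inductionOn with
    | h t =>
      by_cases hz : s.z₀ = t.z₀
      · have hst : ¬ s ≈ t := fun h => hab (by simp [Quotient.sound h])
        have hst' : ∃ k ≥ max s.K t.K, s.V k ≠ t.V k := by
          by_contra hcon
          push Not at hcon
          exact hst ⟨_, hcon⟩
        obtain ⟨k, hk, hne⟩ := hst'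
        have hdis := (SingularSequence.eq_or_disjoint hz (k := k) (by omega) (by omega)).resolve_left hne
        refine ⟨s.nhd k, t.nhd k, s.isOpen_nhd (by omega), t.isOpen_nhd (by omega),
          s.singular_mem_nhd.2 rfl, t.singular_mem_nhd.2 rfl, ?_⟩
        rw [Set.disjoint_left]
        rintro _ (⟨x, hx, rfl⟩ | ⟨hs', rfl⟩) hy
        · exact Set.disjoint_left.1 hdis hx (t.point_mem_nhd.1 hy)
        · exact hst (Quotient.exact (t.singular_mem_nhd.1 hy))
      · obtain ⟨A, B, hA, hB, hsA, htB, hAB⟩ := t2_separation hz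
        exact ⟨_, _, hA.preimage continuous_proj, hB.preimage continuous_proj, hsA, htB,
          hAB.preimage _⟩

/-- The extension of `F` to the completion. -/
def F : Q.RemovableCompletion → M
  | point x => Q.F x
  | singular _ hp => hp.choose_spec.2.choose

/-- Let `N` be a compact neighbourhood of the value `η` at a singularity. The decreasing closures of
the `F(V k)` meet only in `η`, so by compactness one of them misses `N \ interior N`. That `F(V k)`
is connected and comes arbitrarily close to `η`, so it lies inside `N`. -/
theorem continuous_F [T2Space M] [LocallyCompactSpace M] :
    Continuous (F : Q.RemovableCompletion → M) := by
  rw [continuous_iff_continuousAt]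
  rintro (x | ⟨p, hp⟩)
  · exact isOpenEmbedding_point.continuousAt_iff.1 (Q.F_holo x).continuousAt
  -- The representative chosen in the definition of `F` is used, since its intersection of closures
  -- is the one known to be `η`.
  · obtain ⟨s, hsp, hη⟩ : ∃ s : Q.SingularSequence, Quotient.mk _ s = p ∧
        ⋂ k ≥ s.K, closure (Q.F '' s.V k) = {F (singular p hp)} :=
      ⟨hp.choose, hp.choose_spec.1, hp.choose_spec.2.choose_spec⟩
    subst hsp
    refine continuousAt_singular fun O hO => ?_
    set η := F (singular (Quotient.mk _ s) hp)
    obtain ⟨N, hN, hNO, hNc⟩ := local_compact_nhds hO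
    have hηcl : ∀ k, η ∈ closure (Q.F '' s.V (s.K + k)) := by
      intro k
      have : η ∈ ⋂ k ≥ s.K, closure (Q.F '' s.V k) := by rw [hη]; exact mem_singleton η
      simp only [mem_iInter] at this
      exact this _ (by omega)
    obtain ⟨k, hk⟩ := (hNc.diff isOpen_interior).elim_directed_family_closed
      (fun k => closure (Q.F '' s.V (s.K + k))) (fun _ => isClosed_closure) (by
        rw [← not_nonempty_iff_eq_empty]
        rintro ⟨y, hy, hy'⟩
        have : y ∈ ⋂ k ≥ s.K, closure (Q.F '' s.V k) := by
          simp only [mem_iInter] at hy' ⊢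
          intro k hk
          have := hy' (k - s.K)
          rwa [Nat.add_sub_cancel' hk] at this
        rw [hη, mem_singleton_iff] at this
        exact hy.2 (this ▸ mem_interior_iff_mem_nhds.2 hN)) (by
        intro a b
        refine ⟨max a b, closure_mono (image_mono (s.antitone (by omega) (by omega))),
          closure_mono (image_mono (s.antitone (by omega) (by omega)))⟩)
    refine ⟨s.K + k, by omega, ?_⟩
    have hpre : IsPreconnected (Q.F '' s.V (s.K + k)) :=
      (s.isPreconnected (by omega)).image _ Q.F_holo.continuous.continuousOn
    have hsub : Q.F '' s.V (s.K + k) ⊆ interior N := by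
      refine hpre.subset_left_of_subset_union isOpen_interior hNc.isClosed.isOpen_compl ?_ ?_ ?_
      · exact Set.disjoint_left.2 fun y hy hy' => hy' (interior_subset hy)
      · intro y hy
        by_contra hne
        simp only [mem_union, not_or, mem_compl_iff, not_not] at hne
        have : y ∈ (N \ interior N) ∩ closure (Q.F '' s.V (s.K + k)) :=
          ⟨⟨hne.2, hne.1⟩, subset_closure hy⟩
        rw [hk] at this
        exact this
      · obtain ⟨y, hy, hy'⟩ := mem_closure_iff.1 (hηcl k) _ isOpen_interior
          (mem_interior_iff_mem_nhds.2 hN)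
        exact ⟨y, hy', hy⟩
    exact fun x hx => hNO (interior_subset (hsub ⟨x, hx, rfl⟩))

/-- The charts of the completion are holomorphic on the surface, and the projection is holomorphic
in them. -/
structure IsGoodChart (φ : OpenPartialHomeomorph Q.RemovableCompletion ℂ) : Prop where
  comp_point : ∀ x, point x ∈ φ.source → MDifferentiableAt 𝓘(ℂ) 𝓘(ℂ) (φ ∘ point) x
  proj_comp : ∀ τ ∈ φ.target, MDifferentiableAt 𝓘(ℂ) 𝓘(ℂ) (proj ∘ φ.symm) τ

theorem mdifferentiableAt_of_pow {X : Type*} [TopologicalSpace X] [ChartedSpace ℂ X]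
    {t : X → ℂ} {x : X} {N : ℕ} (hN : 0 < N) (hc : ContinuousAt t x)
    (h0 : t x ≠ 0) (h : MDifferentiableAt 𝓘(ℂ) 𝓘(ℂ) (fun y => t y ^ N) x) :
    MDifferentiableAt 𝓘(ℂ) 𝓘(ℂ) t x := by
  have hd : ∀ τ : ℂ, HasDerivAt (fun τ : ℂ => τ ^ N) (N * τ ^ (N - 1)) τ := fun τ => hasDerivAt_pow N τ
  refine mdifferentiableAt_of_comp (g := fun τ : ℂ => τ ^ N) hc
    (.of_forall fun τ => (hd τ).differentiableAt.mdifferentiableAt) ?_ h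
  rw [mfderiv_eq_fderiv]
  intro hz
  have h1 : deriv (fun τ : ℂ => τ ^ N) (t x) = 0 := by
    rw [← fderiv_apply_one_eq_deriv, hz]; rfl
  rw [(hd (t x)).deriv] at h1
  have hN' : (N : ℂ) ≠ 0 := Nat.cast_ne_zero.2 hN.ne'
  exact mul_ne_zero hN' (pow_ne_zero _ h0) h1

/-- The root coordinate on `V s.K`, extended by `0` at the singularity, is the chart. Its `N`-th
power is the coordinate of the projection, so the chart is holomorphic away from the singularity and
the projection reads as a power map. -/
theorem exists_singular_chart (p : Q.SuperstructuralSingularity) (hp : p.IsRemovable) :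
    ∃ φ : OpenPartialHomeomorph Q.RemovableCompletion ℂ, singular p hp ∈ φ.source ∧
      (∀ q hq, singular q hq ∈ φ.source → q = p) ∧ IsGoodChart φ := by
  classical
  induction p using Quotient.inductionOn with
  | h s =>
  let V := s.V s.K
  obtain ⟨N, t, hN, ht, hrange, hpow⟩ : ∃ (N : ℕ) (t : V → ℂ), 0 < N ∧ IsOpenEmbedding t ∧
      range t = {τ | τ ≠ 0 ∧ ‖τ ^ N‖ < 1 / s.K} ∧
      ∀ x, Sphere.param s.z₀ (t x ^ N) = Q.proj x := s.exists_root le_rfl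
  have hVo : IsOpen V := s.isOpen _ le_rfl
  -- The value `0` off `V`, like that of `g` at other singularities, plays no role: the chart domain
  -- is `s.nhd s.K`.
  let T : Q.S → ℂ := fun x => if hx : x ∈ V then t ⟨x, hx⟩ else 0
  have hT : ∀ x (hx : x ∈ V), T x = t ⟨x, hx⟩ := fun x hx => dif_pos hx
  let g : Q.RemovableCompletion → ℂ := fun y => match y with
    | point x => T x
    | singular _ _ => 0
  have hgp : ∀ x, g (point x) = T x := fun _ => rfl
  have hgs : g (singular _ hp) = 0 := rfl
  have htr : ∀ x, t x ≠ 0 ∧ ‖t x ^ N‖ < 1 / s.K := fun x => by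
    have : t x ∈ range t := mem_range_self x
    rwa [hrange] at this
  have hTc : ∀ x ∈ V, map T (𝓝 x) = 𝓝 (T x) := by
    intro x hx
    rw [hT x hx, ← ht.map_nhds_eq, ← hVo.isOpenEmbedding_subtypeVal.map_nhds_eq ⟨x, hx⟩, map_map]
    exact map_congr (.of_forall fun y => hT y y.2)
  have hmapp : ∀ x ∈ V, map g (𝓝 (point x)) = 𝓝 (g (point x)) := by
    intro x hx
    rw [← isOpenEmbedding_point.map_nhds_eq, map_map, hgp, ← hTc x hx]
    rfl
  have hsmall : ∀ ε > 0, ∃ k ≥ s.K, ∀ x ∈ s.V k, ‖T x‖ < ε := by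
    intro ε hε
    obtain ⟨n, hn⟩ := exists_nat_one_div_lt (pow_pos hε N)
    refine ⟨max s.K (n + 1), le_max_left _ _, fun x hx => ?_⟩
    have hxV : x ∈ V := s.antitone le_rfl (le_max_left _ _) hx
    have h1 := (s.mapsTo (le_max_left _ _) hx).1
    rw [Sphere.disc_eq] at h1
    obtain ⟨w, hw, hwx⟩ := h1
    have h2 : w = T x ^ N := by
      refine (Sphere.isOpenEmbedding_param s.z₀).injective ?_
      rw [hwx, hT x hxV, hpow]
    have h3 : ‖T x‖ ^ N < ε ^ N := by
      rw [← norm_pow, ← h2]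
      refine lt_of_lt_of_le (mem_ball_zero_iff.1 hw) (le_trans ?_ hn.le)
      have := Sphere.one_div_le n.succ_pos (le_max_right s.K (n + 1))
      exact_mod_cast this
    exact lt_of_pow_lt_pow_left₀ N hε.le h3
  have hgc : ContinuousAt g (singular _ hp) := by
    refine continuousAt_singular fun O hO => ?_
    obtain ⟨ε, hε, hb⟩ := Metric.mem_nhds_iff.1 hO
    obtain ⟨k, hk, hV'⟩ := hsmall ε hε
    exact ⟨k, hk, fun x hx => hb (mem_ball_zero_iff.2 (hV' x hx))⟩
  obtain ⟨φ, hφs, hφ⟩ := exists_openPartialHomeomorph_of_injOn (g := g) (s.isOpen_nhd le_rfl) (by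
      rintro _ (⟨x, hx, rfl⟩ | ⟨hs', rfl⟩)
      · exact ContinuousAt.continuousWithinAt (hmapp x hx).le
      · exact hgc.continuousWithinAt) (by
      rintro _ (⟨x, hx, rfl⟩ | ⟨hs', rfl⟩) _ (⟨y, hy, rfl⟩ | ⟨hs', rfl⟩) h
      · rw [hgp, hgp, hT x hx, hT y hy] at h
        exact congrArg point (Subtype.ext_iff.1 (ht.injective h))
      · rw [hgp, hT x hx] at h
        exact absurd h (htr _).1
      · rw [hgp, hT y hy] at h
        exact absurd h.symm (htr _).1
      · rfl) (by
      rintro _ (⟨x, hx, rfl⟩ | ⟨hs', rfl⟩)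
      · exact (hmapp x hx).ge
      · intro W hW
        -- Openness at the singularity: a nonzero `τ` with `τ ^ N` smaller than `1 / k` is the
        -- coordinate of a point of `V s.K` over the smaller punctured disc. By the sheet count that
        -- point lies in `s.V k`.
        obtain ⟨k, hk, hsub⟩ := mem_nhds_singular.1 (Filter.mem_map.1 hW)
        have hk0 : (0 : ℝ) < 1 / k := by
          have := s.pos_of_le hk
          positivity
        have hcont : ContinuousAt (fun τ : ℂ => ‖τ ^ N‖) 0 := by fun_prop
        have h1 : ∀ᶠ τ : ℂ in 𝓝 0, ‖τ ^ N‖ < 1 / k :=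
          hcont.eventually_lt_const (by simp only [zero_pow hN.ne', norm_zero]; exact hk0)
        rw [hgs]
        filter_upwards [h1] with τ hτ
        by_cases hτ0 : τ = 0
        · have : singular _ hp ∈ g ⁻¹' W := hsub (s.singular_mem_nhd.2 rfl)
          rw [hτ0]
          exact this
        · have hτr : τ ∈ range t := by
            rw [hrange]
            exact ⟨hτ0, hτ.trans_le (Sphere.one_div_le s.K_pos hk)⟩
          obtain ⟨⟨x, hx⟩, rfl⟩ := hτr
          have hxk : x ∈ s.V k := by
            refine s.mem_of_proj_mem le_rfl hk hx ?_
            rw [← hpow ⟨x, hx⟩, Sphere.puncturedDisc_eq]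
            exact ⟨_, ⟨mem_ball_zero_iff.2 hτ, pow_ne_zero _ hτ0⟩, rfl⟩
          have : point x ∈ g ⁻¹' W := hsub (s.point_mem_nhd.2 hxk)
          rwa [mem_preimage, hgp, hT x hx] at this)
  refine ⟨φ, ?_, fun q hq h => ?_, ?_, ?_⟩
  · rw [hφs]; exact s.singular_mem_nhd.2 rfl
  · rw [hφs] at h; exact s.singular_mem_nhd.1 h
  · intro x hx
    rw [hφs, s.point_mem_nhd] at hx
    rw [hφ]
    change MDifferentiableAt 𝓘(ℂ) 𝓘(ℂ) T x
    refine mdifferentiableAt_of_pow hN (hTc x hx).le (by rw [hT x hx]; exact (htr _).1) ?_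
    have h1 : MDifferentiableAt 𝓘(ℂ) 𝓘(ℂ) (Sphere.coord s.z₀ ∘ Q.proj) x := by
      refine MDifferentiableAt.comp x (Sphere.mdifferentiableAt_coord s.z₀ ?_) (Q.proj_holo x)
      rw [← hpow ⟨x, hx⟩]
      exact mem_range_self _
    refine h1.congr_of_eventuallyEq ?_
    filter_upwards [hVo.mem_nhds hx] with y hy
    simp only [Function.comp]
    rw [← hpow ⟨y, hy⟩, Sphere.coord_param, hT y hy]
  · intro τ hτ
    have h1 : MDifferentiableAt 𝓘(ℂ) 𝓘(ℂ) (fun τ : ℂ => Sphere.param s.z₀ (τ ^ N)) τ := by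
      have h2 : DifferentiableAt ℂ (fun τ : ℂ => τ ^ N) τ := by fun_prop
      exact MDifferentiableAt.comp τ (Sphere.mdifferentiable_param s.z₀ _) h2.mdifferentiableAt
    refine h1.congr_of_eventuallyEq ?_
    filter_upwards [φ.open_target.mem_nhds hτ] with τ' hτ'
    have h3 := φ.map_target hτ'
    have h4 := φ.right_inv hτ'
    rw [hφ] at h4
    rw [hφs] at h3
    rcases h3 with ⟨x, hx, h3⟩ | ⟨hs', h3⟩
    · simp only [Function.comp]
      rw [h3] at h4 ⊢
      rw [← h4, hgp, hT x hx, hpow]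
      rfl
    · simp only [Function.comp]
      rw [h3] at h4 ⊢
      rw [← h4]
      change s.z₀ = Sphere.param s.z₀ (0 ^ N)
      rw [zero_pow hN.ne', Sphere.param_zero]

variable (Q) in
/-- The inclusion of the surface as an open partial homeomorphism. -/
def pointHomeomorph : OpenPartialHomeomorph Q.S Q.RemovableCompletion :=
  isOpenEmbedding_point.toOpenPartialHomeomorph point

theorem pointHomeomorph_symm_point (x : Q.S) : (pointHomeomorph Q).symm (point x) = x :=
  isOpenEmbedding_point.toOpenPartialHomeomorph_left_inv

theorem pointHomeomorph_target : (pointHomeomorph Q).target = range point := image_univ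

/-- The charts of the completion. -/
def chart : Q.RemovableCompletion → OpenPartialHomeomorph Q.RemovableCompletion ℂ
  | point x => (pointHomeomorph Q).symm.trans (chartAt ℂ x)
  | singular p hp => (exists_singular_chart p hp).choose

theorem mem_chart_source (y : Q.RemovableCompletion) : y ∈ (chart y).source := by
  rcases y with x | ⟨p, hp⟩
  · refine ⟨?_, ?_⟩
    · change point x ∈ (pointHomeomorph Q).target
      rw [pointHomeomorph_target]
      exact mem_range_self x
    · change (pointHomeomorph Q).symm (point x) ∈ (chartAt ℂ x).source
      rw [pointHomeomorph_symm_point]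
      exact _root_.mem_chart_source ℂ x
  · exact (exists_singular_chart p hp).choose_spec.1

/-- A singularity lies in no chart domain but its own, so no transition map between different charts
has to be examined there. -/
theorem eq_chart_singular {y : Q.RemovableCompletion} {p : Q.SuperstructuralSingularity}
    {hp : p.IsRemovable} (h : singular p hp ∈ (chart y).source) : y = singular p hp := by
  rcases y with x | ⟨q, hq⟩
  · have h1 : singular p hp ∈ (pointHomeomorph Q).target := h.1
    rw [pointHomeomorph_target] at h1
    obtain ⟨x, hx⟩ := h1
    cases hx
  · have := (exists_singular_chart q hq).choose_spec.2.1 p hp h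
    subst this
    rfl

instance : ChartedSpace ℂ Q.RemovableCompletion where
  atlas := range chart
  chartAt := chart
  mem_chart_source := mem_chart_source
  chart_mem_atlas := mem_range_self

theorem chart_point_apply (x y : Q.S) : chart (point x) (point y) = chartAt ℂ x y := by
  change chartAt ℂ x ((pointHomeomorph Q).symm (point y)) = _
  rw [pointHomeomorph_symm_point]

theorem isGoodChart_chart (y : Q.RemovableCompletion) : IsGoodChart (chart y) := by
  rcases y with x | ⟨p, hp⟩
  · refine ⟨fun x' hx' => ?_, fun τ hτ => ?_⟩
    · have h1 : x' ∈ (chartAt ℂ x).source := by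
        have : (pointHomeomorph Q).symm (point x') ∈ (chartAt ℂ x).source := hx'.2
        rwa [pointHomeomorph_symm_point] at this
      have h2 : chart (point x) ∘ point = chartAt ℂ x := funext (chart_point_apply x)
      rw [h2]
      exact mdifferentiableAt_atlas (chart_mem_atlas ℂ x) h1
    · have h1 : τ ∈ (chartAt ℂ x).target := hτ.1
      have h2 : proj ∘ (chart (point x)).symm = Q.proj ∘ (chartAt ℂ x).symm := rfl
      rw [h2]
      exact MDifferentiableAt.comp τ (Q.proj_holo _)
        (mdifferentiableAt_atlas_symm (chart_mem_atlas ℂ x) h1)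
  · exact (exists_singular_chart p hp).choose_spec.2.2

/-- At a parameter of a surface point, `σ` lifts the inverse chart to the surface. It is holomorphic
since its projection is and the projection is locally biholomorphic, by regularity. At a singularity
the two charts coincide and the transition is the identity. -/
theorem isManifold (hQ : Q.IsRegular) : IsManifold 𝓘(ℂ) ω Q.RemovableCompletion := by
  apply isManifold_of_contDiffOn
  rintro _ _ ⟨a, rfl⟩ ⟨b, rfl⟩
  simp only [modelWithCornersSelf_coe, modelWithCornersSelf_coe_symm, Function.comp_id,
    Function.id_comp, range_id, inter_univ, preimage_id]
  refine DifferentiableOn.contDiffOn (fun τ hτ => DifferentiableAt.differentiableWithinAt ?_)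
    (OpenPartialHomeomorph.open_source _)
  have hτa : τ ∈ (chart a).target := hτ.1
  have hτb : (chart a).symm τ ∈ (chart b).source := hτ.2
  rcases hy : (chart a).symm τ with x | ⟨p, hp⟩
  · rw [hy] at hτb
    have hev : ∀ᶠ τ' in 𝓝 τ, (chart a).symm τ' ∈ range (point : Q.S → _) :=
      ((chart a).continuousAt_symm hτa)
        (isOpenEmbedding_point.isOpen_range.mem_nhds (hy ▸ mem_range_self x))
    let σ : ℂ → Q.S := fun τ' => (pointHomeomorph Q).symm ((chart a).symm τ')
    have hσx : σ τ = x := by simp only [σ, hy, pointHomeomorph_symm_point]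
    have hσ : ∀ᶠ τ' in 𝓝 τ, point (σ τ') = (chart a).symm τ' := by
      filter_upwards [hev] with τ' ⟨x', hx'⟩
      simp only [σ, ← hx', pointHomeomorph_symm_point]
    have hσc : ContinuousAt σ τ := by
      refine ContinuousAt.comp ?_ ((chart a).continuousAt_symm hτa)
      refine (pointHomeomorph Q).continuousAt_symm ?_
      rw [hy, pointHomeomorph_target]
      exact mem_range_self x
    have hσd : MDifferentiableAt 𝓘(ℂ) 𝓘(ℂ) σ τ := by
      refine mdifferentiableAt_of_comp (g := Q.proj) hσc (.of_forall Q.proj_holo) (hQ _) ?_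
      refine ((isGoodChart_chart a).proj_comp τ hτa).congr_of_eventuallyEq ?_
      filter_upwards [hσ] with τ' h
      simp only [Function.comp, ← h]
      rfl
    have h1 : MDifferentiableAt 𝓘(ℂ) 𝓘(ℂ) ((chart b ∘ point) ∘ σ) τ :=
      MDifferentiableAt.comp τ ((isGoodChart_chart b).comp_point _ (by rwa [hσx])) hσd
    refine (mdifferentiableAt_iff_differentiableAt.1 h1).congr_of_eventuallyEq ?_
    filter_upwards [hσ] with τ' h
    simp only [Function.comp, h]
    rfl
  · rw [hy] at hτb
    have h1 : singular p hp ∈ (chart a).source := by rw [← hy]; exact (chart a).map_target hτa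
    have hab : a = b := (eq_chart_singular h1).trans (eq_chart_singular hτb).symm
    subst hab
    refine differentiableAt_id.congr_of_eventuallyEq ?_
    filter_upwards [(chart a).open_target.mem_nhds hτa] with τ' hτ'
    exact (chart a).right_inv hτ'

theorem eventually_mem_range_point (y : Q.RemovableCompletion) :
    ∀ᶠ y' in 𝓝[≠] y, y' ∈ range (point : Q.S → _) := by
  filter_upwards [self_mem_nhdsWithin,
    nhdsWithin_le_nhds ((chart y).open_source.mem_nhds (mem_chart_source y))] with y' h1 h2
  rcases y' with x | ⟨p, hp⟩
  · exact mem_range_self x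
  · exact absurd (eq_chart_singular h2).symm h1

theorem mdifferentiable_point (hQ : Q.IsRegular) :
    MDifferentiable 𝓘(ℂ) 𝓘(ℂ) (point : Q.S → Q.RemovableCompletion) := by
  have := isManifold hQ
  intro x
  rw [mdifferentiableAt_iff_charts (_root_.mem_chart_source ℂ x)
    (_root_.mem_chart_source ℂ (point x))]
  refine ⟨isOpenEmbedding_point.continuous.continuousAt,
    differentiableAt_id.congr_of_eventuallyEq ?_⟩
  filter_upwards [(chartAt ℂ x).open_target.mem_nhds ((chartAt ℂ x).map_source
    (_root_.mem_chart_source ℂ x))] with τ hτ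
  refine (chart_point_apply x _).trans ?_
  exact (chartAt ℂ x).right_inv hτ

/-- A continuous map out of the completion is holomorphic if it is so on the surface. -/
theorem mdifferentiable_of_comp_point {H : Type*} [NormedAddCommGroup H]
    [NormedSpace ℂ H] [CompleteSpace H] {N : Type*} [TopologicalSpace N] [ChartedSpace H N]
    [IsManifold 𝓘(ℂ, H) ω N] (hQ : Q.IsRegular) {g : Q.RemovableCompletion → N} (hg : Continuous g)
    (h : MDifferentiable 𝓘(ℂ) 𝓘(ℂ, H) (g ∘ point)) : MDifferentiable 𝓘(ℂ) 𝓘(ℂ, H) g := by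
  have := isManifold hQ
  have hpt : ∀ x, MDifferentiableAt 𝓘(ℂ) 𝓘(ℂ, H) g (point x) := by
    intro x
    have h1 := h x
    rw [mdifferentiableAt_iff_charts (_root_.mem_chart_source ℂ x)
      (_root_.mem_chart_source H ((g ∘ point) x))] at h1
    rw [mdifferentiableAt_iff_charts (_root_.mem_chart_source ℂ (point x))
      (_root_.mem_chart_source H (g (point x)))]
    refine ⟨hg.continuousAt, ?_⟩
    have h2 : chartAt ℂ (point x) (point x) = chartAt ℂ x x := chart_point_apply x x
    rw [h2]
    exact h1.2
  intro y
  refine mdifferentiableAt_of_punctured hg.continuousAt ?_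
  filter_upwards [eventually_mem_range_point y]
  rintro _ ⟨x, rfl⟩
  exact hpt x

end RemovableCompletion

open RemovableCompletion

/-- The completion of a regular continuation by its removable singularities. -/
def completion [CompleteSpace E] [T2Space M] [LocallyCompactSpace M] [IsManifold 𝓘(ℂ, E) ω M]
    (Q : Continuation.{e, u, w} E U f) (hQ : Q.IsRegular) : Continuation.{e, u, w} E U f where
  S := Q.RemovableCompletion
  manifoldS := isManifold hQ
  proj := RemovableCompletion.proj
  proj_holo := mdifferentiable_of_comp_point hQ continuous_proj Q.proj_holo
  j z := point (Q.j z)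
  j_holo z := MDifferentiableAt.comp z (mdifferentiable_point hQ (Q.j z)) (Q.j_holo z)
  proj_j := Q.proj_j
  F := RemovableCompletion.F
  F_holo := mdifferentiable_of_comp_point hQ continuous_F Q.F_holo
  F_j := Q.F_j

theorem isRemovableExtension_completion [CompleteSpace E] [T2Space M] [LocallyCompactSpace M]
    [IsManifold 𝓘(ℂ, E) ω M] (Q : Continuation.{e, u, w} E U f) (hQ : Q.IsRegular) :
    Q.IsRemovableExtension (Q.completion hQ) :=
  ⟨Homeomorph.refl _, mdifferentiable_point hQ, fun _ => rfl, fun _ _ => rfl, fun _ => rfl,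
    fun _ => rfl⟩

end Continuation

/-! ### Recognizing components and finite coverings by compactness. -/

/-- Compactness over compact sets makes `V` relatively closed in the preimage of `D`: a limit point
over `D` lies over a compact neighbourhood `C` inside `D`, and `V ∩ p ⁻¹' C` is closed. An open,
relatively closed, connected subset is a component. -/
theorem eq_connectedComponentIn_of_isCompact {X Y : Type*} [TopologicalSpace X] [TopologicalSpace Y]
    [T2Space X] [LocallyCompactSpace Y] {p : X → Y} (hp : Continuous p) {V : Set X} {D : Set Y}
    (hD : IsOpen D) (hV : IsOpen V) (hVc : IsPreconnected V) (hm : MapsTo p V D)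
    (hK : ∀ C ⊆ D, IsCompact C → IsCompact (V ∩ p ⁻¹' C)) {x : X} (hx : x ∈ V) :
    V = connectedComponentIn (p ⁻¹' D) x := by
  refine (hVc.subset_connectedComponentIn hx hm).antisymm ?_
  refine isPreconnected_connectedComponentIn.subset_of_closure_inter_subset hV
    ⟨x, mem_connectedComponentIn (hm hx), hx⟩ ?_
  rintro y ⟨hy, hy'⟩
  have hyD : p y ∈ D := connectedComponentIn_subset (p ⁻¹' D) x hy'
  obtain ⟨C, hC, hCD, hCc⟩ := local_compact_nhds (hD.mem_nhds hyD)
  refine ((hK C hCD hCc).isClosed.closure_subset_iff.2 subset_rfl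
    (mem_closure_iff_nhds.2 fun O hO => ?_)).1
  obtain ⟨w, hw, hwV⟩ := mem_closure_iff_nhds.1 hy _ (inter_mem hO (hp.continuousAt hC))
  exact ⟨w, hw.1, hwV, hw.2⟩

/-- The compactness condition says that the restriction is proper. A proper local homeomorphism has
finite fibres and is a covering, and its number of sheets is locally constant over the connected
base. -/
theorem isCoveringMap_of_isCompact {X Y : Type*} [TopologicalSpace X] [TopologicalSpace Y]
    [T2Space X] [T2Space Y] [LocallyCompactSpace Y] {p : X → Y} (hp : IsLocalHomeomorph p)
    {V : Set X} {D : Set Y}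
    (hD : IsOpen D) (hDc : IsPreconnected D) (hV : IsOpen V) (hVne : V.Nonempty) (hm : MapsTo p V D)
    (hK : ∀ C ⊆ D, IsCompact C → IsCompact (V ∩ p ⁻¹' C)) :
    IsCoveringMap hm.restrict ∧ ∃ n, 0 < n ∧ ∀ z, (hm.restrict ⁻¹' {z}).ncard = n := by
  set g : V → D := hm.restrict with hg
  have hgc : Continuous g := hp.continuous.restrict hm
  have : LocallyCompactSpace D := hD.locallyCompactSpace
  have hloc : IsLocalHomeomorph g := by
    have h1 : IsLocalHomeomorph (Subtype.val ∘ g) :=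
      hp.comp hV.isOpenEmbedding_subtypeVal.isLocalHomeomorph
    exact h1.of_comp hD.isOpenEmbedding_subtypeVal.isLocalHomeomorph hgc
  have hprop : IsProperMap g := by
    rw [isProperMap_iff_isCompact_preimage]
    refine ⟨hgc, fun C hC => ?_⟩
    have h1 := hK (Subtype.val '' C) (by rintro _ ⟨z, -, rfl⟩; exact z.2)
      (hC.image continuous_subtype_val)
    rw [Topology.IsInducing.subtypeVal.isCompact_iff]
    convert h1 using 1
    ext x
    constructor
    · rintro ⟨x, hx, rfl⟩
      exact ⟨x.2, g x, hx, rfl⟩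
    · rintro ⟨hx, z, hz, hzx⟩
      refine ⟨⟨x, hx⟩, ?_, rfl⟩
      rw [mem_preimage]
      convert hz
      exact Subtype.ext hzx.symm
  have hfin : ∀ z, (g ⁻¹' {z}).Finite := fun z =>
    (hprop.isCompact_preimage isCompact_singleton).finite
      (hloc.isLocalHomeomorphOn.isDiscrete_of_image
        ((finite_singleton z).subset (image_preimage_subset g {z})).isDiscrete)
  have hcov : IsCoveringMap g := by
    rw [isCoveringMap_iff_isCoveringMapOn_univ]
    exact hprop.isClosedMap.isCoveringMapOn_of_isLocalHomeomorphOn (fun z _ => hfin z)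
      (hloc.isLocalHomeomorphOn)
  have : PreconnectedSpace D := isPreconnected_iff_preconnectedSpace.1 hDc
  have hlc : IsLocallyConstant fun z => (g ⁻¹' {z}).ncard := by
    rw [IsLocallyConstant.iff_eventually_eq]
    intro z
    obtain ⟨-, O, hzO, hO, -, H, hH⟩ := hcov z
    have key : ∀ z' ∈ O, (g ⁻¹' {z'}).ncard = Nat.card (g ⁻¹' {z}) := by
      intro z' hz'
      have hinj : Function.Injective fun i => (H.symm (⟨z', hz'⟩, i)).1 :=
        Subtype.val_injective.comp (H.symm.injective.comp (Prod.mk_right_injective _))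
      rw [← Nat.card_range_of_injective hinj]
      change Nat.card _ = Nat.card _
      congr 2
      ext x
      constructor
      · intro hx
        have hxz : g x = z' := hx
        have hxO : x ∈ g ⁻¹' O := by rwa [mem_preimage, hxz]
        refine ⟨(H ⟨x, hxO⟩).2, ?_⟩
        have : ((⟨z', hz'⟩ : O), (H ⟨x, hxO⟩).2) = H ⟨x, hxO⟩ :=
          Prod.ext (Subtype.ext ((hH ⟨x, hxO⟩).trans hxz).symm) rfl
        simp only [this, H.symm_apply_apply]
      · rintro ⟨i, rfl⟩
        have := hH (H.symm (⟨z', hz'⟩, i))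
        rw [H.apply_symm_apply] at this
        exact this.symm
    filter_upwards [hO.mem_nhds hzO] with z' hz'
    rw [key z' hz', key z hzO]
  obtain ⟨x, hx⟩ := hVne
  refine ⟨hcov, (g ⁻¹' {g ⟨x, hx⟩}).ncard, ?_,
    fun z => hlc.apply_eq_of_preconnectedSpace z (g ⟨x, hx⟩)⟩
  exact (ncard_pos (hfin _)).2 ⟨⟨x, hx⟩, mem_singleton _⟩

/-- A component is relatively closed in the preimage of `B`, because adding a limit point over `B`
keeps it connected. Over `C` it therefore equals its closure, a closed subset of the compact `N`. -/
theorem isCompact_connectedComponentIn_inter_preimage {X Y : Type*} [TopologicalSpace X]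
    [TopologicalSpace Y] [T2Space Y] {p : X → Y} (hp : Continuous p) {x : X} {N : Set X}
    (hN : IsCompact N) (hNc : IsClosed N) {B C : Set Y} (h : connectedComponentIn (p ⁻¹' B) x ⊆ N)
    (hC : IsCompact C) (hCB : C ⊆ B) : IsCompact (connectedComponentIn (p ⁻¹' B) x ∩ p ⁻¹' C) := by
  have heq : connectedComponentIn (p ⁻¹' B) x ∩ p ⁻¹' C =
      closure (connectedComponentIn (p ⁻¹' B) x) ∩ p ⁻¹' C := by
    refine (inter_subset_inter_left _ subset_closure).antisymm ?_
    rintro y ⟨hy, hyC⟩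
    refine ⟨?_, hyC⟩
    obtain ⟨w, hw⟩ := closure_nonempty_iff.1 ⟨y, hy⟩
    rw [connectedComponentIn_eq hw]
    refine IsPreconnected.subset_connectedComponentIn
      (s := insert y (connectedComponentIn (p ⁻¹' B) x))
      (isPreconnected_connectedComponentIn.subset_closure (subset_insert _ _)
        (insert_subset hy subset_closure)) (mem_insert_of_mem _ hw) ?_ (mem_insert _ _)
    exact insert_subset (hCB hyC) (connectedComponentIn_subset _ _)
  rw [heq]
  exact hN.of_isClosed_subset (isClosed_closure.inter (hC.isClosed.preimage hp))
    (inter_subset_left.trans (closure_minimal h hNc))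

/-! ### Extension of morphisms across critical points. -/

namespace Continuation

variable {E : Type e} [NormedAddCommGroup E] [NormedSpace ℂ E]
  {M : Type u} [TopologicalSpace M] [ChartedSpace E M]
  {U : TopologicalSpace.Opens Sphere} {f : U → M}

theorem isLocalHomeomorphOn_of_comp {Q : Continuation.{e, u, w} E U f} (hQ : Q.IsRegular)
    {Q' : Continuation.{e, u, v} E U f} {h : Q'.S → Q.S} {R : Set Q'.S} (hR : IsOpen R)
    (hreg : ∀ x ∈ R, mfderiv 𝓘(ℂ) 𝓘(ℂ) Q'.proj x ≠ 0)
    (hc : ContinuousOn h R) (hp : ∀ x ∈ R, Q.proj (h x) = Q'.proj x) : IsLocalHomeomorphOn h R := by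
  refine IsLocalHomeomorphOn.of_comp_left (g := Q.proj) ?_
    (fun y _ => hQ.isLocalHomeomorph y) fun x hx => hc.continuousAt (hR.mem_nhds hx)
  refine IsLocalHomeomorphOn.mk _ _ fun x hx => ?_
  obtain ⟨φ, hxφ, hφ⟩ := Q'.isLocalHomeomorphOn_proj hreg x hx
  refine ⟨φ.restrOpen R hR, ⟨hxφ, hx⟩, fun y hy => ?_⟩
  rw [Function.comp_apply, hp y hy.2, hφ]
  rfl

/-- The behaviour of a morphism at a puncture: the image either converges on the surface, or to a
removable singularity. -/
theorem exists_tendsto_point [T2Space M] (hU : (U : Set Sphere).Nonempty)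
    {Q : Continuation.{e, u, w} E U f} (hQ : Q.IsRegular)
    {Q' : Continuation.{e, u, v} E U f} {h : Q'.S → Q.S} {R : Set Q'.S} (hR : IsOpen R)
    (hreg : ∀ x ∈ R, mfderiv 𝓘(ℂ) 𝓘(ℂ) Q'.proj x ≠ 0) (hc : ContinuousOn h R)
    (hp : ∀ x ∈ R, Q.proj (h x) = Q'.proj x) (hF : ∀ x ∈ R, Q.F (h x) = Q'.F x) {x₀ : Q'.S}
    (hx₀ : R ∈ 𝓝[≠] x₀) :
    ∃ c : Q.RemovableCompletion, Tendsto (fun x => .point (h x)) (𝓝[≠] x₀) (𝓝 c) := by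
  have : LocallyCompactSpace Q'.S := ChartedSpace.locallyCompactSpace ℂ _
  have : LocallyConnectedSpace Q'.S := ChartedSpace.locallyConnectedSpace ℂ _
  have : LocallyCompactSpace Sphere := ChartedSpace.locallyCompactSpace ℂ _
  have hlh := isLocalHomeomorphOn_of_comp hQ hR hreg hc hp
  set z₀ := Q'.proj x₀
  have hiso : ∀ᶠ y in 𝓝[≠] x₀, Q'.proj y ≠ Q'.proj x₀ :=
    (Q'.eventually_proj_ne_and_mfderiv_ne hU x₀).mono fun _ h => h.1
  -- These components form arbitrarily small neighbourhoods of `x₀`, since `x₀` is isolated in its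
  -- fibre. Their punctured versions `V' k` are mapped by `h` to the candidates `V k` for a
  -- singularity.
  set W : ℕ → Set Q'.S := fun k => connectedComponentIn (Q'.proj ⁻¹' Sphere.disc z₀ (1 / k)) x₀
  have hWo : ∀ k, IsOpen (W k) := fun k =>
    ((Sphere.isOpen_disc _ _).preimage Q'.proj_holo.continuous).connectedComponentIn
  have hWp : ∀ k, W k ⊆ Q'.proj ⁻¹' Sphere.disc z₀ (1 / k) := fun k => connectedComponentIn_subset _ _
  have hdisc : ∀ {k : ℕ}, 0 < k → z₀ ∈ Sphere.disc z₀ (1 / k) := fun hk =>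
    Sphere.mem_disc_self _ (by positivity)
  have hxW : ∀ {k : ℕ}, 0 < k → x₀ ∈ W k := fun hk => mem_connectedComponentIn (hdisc hk)
  have hWmono : ∀ {k l : ℕ}, 0 < k → k ≤ l → W l ⊆ W k := fun hk hkl =>
    connectedComponentIn_mono _ (preimage_mono (Sphere.disc_mono _ (Sphere.one_div_le hk hkl)))
  have hWsmall : ∀ O ∈ 𝓝 x₀, ∃ K, 0 < K ∧ ∀ k ≥ K, W k ⊆ O := by
    intro O hO
    obtain ⟨B, hB, hBO⟩ := exists_connectedComponentIn_preimage_subset Q'.proj_holo.continuous hiso hO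
    obtain ⟨K, hK, hKB⟩ := Sphere.exists_disc_subset hB
    exact ⟨K, hK, fun k hk => hBO _ (hKB k hk) (hdisc (hK.trans_le hk))⟩
  obtain ⟨N, hN, hNsub, hNc⟩ := local_compact_nhds
    (inter_mem (mem_nhdsWithin_iff_eventually.1 hx₀) (eventually_nhdsWithin_iff.1 hiso))
  obtain ⟨K₀, hK₀, hWN⟩ := hWsmall N hN
  set V' : ℕ → Set Q'.S := fun k => W k \ {x₀}
  set V : ℕ → Set Q.S := fun k => h '' V' k with hV
  have hV'R : ∀ k ≥ K₀, V' k ⊆ R := fun k hk x hx => (hNsub (hWN k hk hx.1)).1 hx.2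
  have hV'p : ∀ k ≥ K₀, MapsTo Q'.proj (V' k) (Sphere.puncturedDisc z₀ (1 / k)) := fun k hk x hx =>
    ⟨hWp k hx.1, (hNsub (hWN k hk hx.1)).2 hx.2⟩
  have hV'o : ∀ k, IsOpen (V' k) := fun k => (hWo k).sdiff isClosed_singleton
  have hV'ev : ∀ {k : ℕ}, 0 < k → V' k ∈ 𝓝[≠] x₀ := fun hk =>
    sdiff_mem_nhdsWithin_compl ((hWo _).mem_nhds (hxW hk)) _
  have hV'c : ∀ k, IsPreconnected (V' k) := fun k =>
    isPreconnected_diff_of_discrete (hWo k) isPreconnected_connectedComponentIn fun x _ => by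
      by_cases hx : x = x₀
      · subst hx; exact self_mem_nhdsWithin
      · exact nhdsWithin_le_nhds (isClosed_singleton.isOpen_compl.mem_nhds hx)
  have hVo : ∀ k ≥ K₀, IsOpen (V k) := fun k hk => isOpen_iff_mem_nhds.2 <| by
    rintro _ ⟨x, hx, rfl⟩
    rw [← hlh.map_nhds_eq (hV'R k hk hx)]
    exact image_mem_map ((hV'o k).mem_nhds hx)
  have hVc : ∀ k ≥ K₀, IsPreconnected (V k) := fun k hk => (hV'c k).image _ (hc.mono (hV'R k hk))
  have hVne : ∀ {k}, 0 < k → (V k).Nonempty := fun hk =>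
    (Filter.nonempty_of_mem (hV'ev hk)).image _
  have hVp : ∀ k ≥ K₀, MapsTo Q.proj (V k) (Sphere.puncturedDisc z₀ (1 / k)) := by
    rintro k hk _ ⟨x, hx, rfl⟩
    rw [hp x (hV'R k hk hx)]
    exact hV'p k hk hx
  -- A compact subset of the punctured disc avoids `z₀`, so the part of `V k` over it is the image
  -- of a compact part of `W k` not containing `x₀`.
  have hVK : ∀ k ≥ K₀, ∀ C ⊆ Sphere.puncturedDisc z₀ (1 / k), IsCompact C →
      IsCompact (V k ∩ Q.proj ⁻¹' C) := by
    intro k hk C hC hCc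
    have h1 := isCompact_connectedComponentIn_inter_preimage Q'.proj_holo.continuous hNc hNc.isClosed
      (hWN k hk) hCc (hC.trans sdiff_subset)
    have h2 : V k ∩ Q.proj ⁻¹' C = h '' (W k ∩ Q'.proj ⁻¹' C) := by
      ext y
      constructor
      · rintro ⟨⟨x, hx, rfl⟩, hy⟩
        rw [mem_preimage, hp x (hV'R k hk hx)] at hy
        exact ⟨x, ⟨hx.1, hy⟩, rfl⟩
      · rintro ⟨x, ⟨hx, hxC⟩, rfl⟩
        have hx' : x ∈ V' k := ⟨hx, fun hxx => (hC hxC).2 (by rw [hxx]; rfl)⟩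
        refine ⟨⟨x, hx', rfl⟩, ?_⟩
        rwa [mem_preimage, hp x (hV'R k hk hx')]
    rw [h2]
    refine h1.image_of_continuousOn (hc.mono fun x hx => hV'R k hk ⟨hx.1, fun hxx => ?_⟩)
    exact (hC hx.2).2 (by rw [hxx]; rfl)
  have hVcomp : ∀ k ≥ K₀, ∀ x ∈ V k,
      V k = connectedComponentIn (Q.proj ⁻¹' Sphere.puncturedDisc z₀ (1 / k)) x := fun k hk x hx =>
    eq_connectedComponentIn_of_isCompact Q.proj_holo.continuous (Sphere.isOpen_puncturedDisc _ _)
      (hVo k hk) (hVc k hk) (hVp k hk) (hVK k hk) hx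
  have hVmono : ∀ {k l}, 0 < k → k ≤ l → V l ⊆ V k := fun hk hkl =>
    image_mono (sdiff_subset_sdiff_left (hWmono hk hkl))
  have hVev : ∀ {k}, 0 < k → ∀ᶠ x in 𝓝[≠] x₀, h x ∈ V k := fun hk => by
    filter_upwards [hV'ev hk] with x hx using ⟨x, hx, rfl⟩
  -- If the closures share a point of the surface, the limit is that point; otherwise the sets `V k`
  -- define a singularity.
  by_cases hcl : (⋂ k ≥ K₀, closure (V k)).Nonempty
  · obtain ⟨y₀, hy₀⟩ := hcl
    simp only [mem_iInter] at hy₀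
    have hpy : Q.proj y₀ = z₀ := by
      by_contra hne
      obtain ⟨A, B, hA, hB, hyA, hzB, hAB⟩ := t2_separation hne
      obtain ⟨K, -, hK⟩ := Sphere.exists_disc_subset (hB.mem_nhds hzB)
      obtain ⟨w, hwA, hwV⟩ := mem_closure_iff.1 (hy₀ (max K K₀) (le_max_right _ _)) _
        (hA.preimage Q.proj_holo.continuous) hyA
      exact Set.disjoint_left.1 hAB hwA
        (hK _ (le_max_left _ _) (hVp _ (le_max_right _ _) hwV).1)
    refine ⟨.point y₀, (RemovableCompletion.isOpenEmbedding_point.continuous.tendsto y₀).comp ?_⟩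
    intro O hO
    obtain ⟨φ, hyφ, hφ⟩ := hQ.isLocalHomeomorph y₀
    have h1 : φ.target ∩ φ.symm ⁻¹' O ∈ 𝓝 z₀ := by
      rw [← hpy, hφ]
      refine inter_mem (φ.open_target.mem_nhds (φ.map_source hyφ)) ?_
      exact φ.symm.continuousAt (φ.map_source hyφ) (by rwa [φ.left_inv hyφ])
    obtain ⟨K, hK, hKO⟩ := Sphere.exists_disc_subset h1
    set k := max K K₀
    have hk₀ : K₀ ≤ k := le_max_right _ _
    have hkpos : 0 < k := hK₀.trans_le hk₀
    have hDt : Sphere.puncturedDisc z₀ (1 / k) ⊆ φ.target := fun z hz =>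
      (hKO k (le_max_left _ _) hz.1).1
    have hsec : ∀ z ∈ φ.target, Q.proj (φ.symm z) = z := fun z hz => by rw [hφ]; exact φ.right_inv hz
    obtain ⟨w, hwφ, hwV⟩ := mem_closure_iff_nhds.1 (hy₀ k hk₀) _ (φ.open_source.mem_nhds hyφ)
    have hwB : w ∈ φ.symm '' Sphere.puncturedDisc z₀ (1 / k) :=
      ⟨Q.proj w, hVp k hk₀ hwV, by rw [hφ]; exact φ.left_inv hwφ⟩
    -- The local section at `y₀` over the punctured disc is also a whole component. It meets `V k`,
    -- so it equals `V k`, and hence `V k` lies in the given neighbourhood of `y₀`.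
    have hB := eq_connectedComponentIn_of_isCompact Q.proj_holo.continuous
      (Sphere.isOpen_puncturedDisc z₀ (1 / k))
      (φ.symm.isOpen_image_of_subset_source (Sphere.isOpen_puncturedDisc _ _) hDt)
      ((Sphere.isPreconnected_puncturedDisc z₀ (by positivity)).image _
        (φ.continuousOn_symm.mono hDt))
      (by rintro _ ⟨z, hz, rfl⟩; rwa [hsec z (hDt hz)]) (fun C hC hCc => by
        convert hCc.image_of_continuousOn (φ.continuousOn_symm.mono (hC.trans hDt)) using 1
        ext y
        constructor
        · rintro ⟨⟨z, hz, rfl⟩, hy⟩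
          rw [mem_preimage, hsec z (hDt hz)] at hy
          exact ⟨z, hy, rfl⟩
        · rintro ⟨z, hz, rfl⟩
          refine ⟨⟨z, hC hz, rfl⟩, ?_⟩
          rwa [mem_preimage, hsec z (hDt (hC hz))]) hwB
    rw [← hVcomp k hk₀ w hwV] at hB
    filter_upwards [hVev hkpos] with x hx
    rw [← hB] at hx
    obtain ⟨z, hz, hzx⟩ := hx
    rw [← hzx]
    exact (hKO k (le_max_left _ _) hz.1).2
  · have hcov : ∀ k, ∃ n, K₀ ≤ k → 0 < n ∧
        ∃ hm : MapsTo Q.proj (V k) (Sphere.puncturedDisc z₀ (1 / k)),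
          IsCoveringMap hm.restrict ∧ ∀ z, (hm.restrict ⁻¹' {z}).ncard = n := by
      intro k
      by_cases hk : K₀ ≤ k
      · have hkpos : 0 < k := hK₀.trans_le hk
        obtain ⟨h1, n, h2, h3⟩ := isCoveringMap_of_isCompact hQ.isLocalHomeomorph
          (Sphere.isOpen_puncturedDisc z₀ (1 / k))
          (Sphere.isPreconnected_puncturedDisc z₀ (by positivity)) (hVo k hk) (hVne hkpos)
          (hVp k hk) (hVK k hk)
        exact ⟨n, fun _ => ⟨h2, hVp k hk, h1, h3⟩⟩
      · exact ⟨0, fun h => absurd h hk⟩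
    choose n hn using hcov
    have hanti : ∀ k l, K₀ ≤ k → k ≤ l → n l ≤ n k := by
      intro k l hk hkl
      obtain ⟨y, hy⟩ := hVne (hK₀.trans_le (hk.trans hkl))
      obtain ⟨h1, hm, -, h2⟩ := hn k hk
      obtain ⟨-, hm', -, h3⟩ := hn l (hk.trans hkl)
      have hy' : y ∈ V k := hVmono (hK₀.trans_le hk) hkl hy
      rw [← h2 ⟨_, hm hy'⟩, ← h3 ⟨_, hm' hy⟩, ncard_preimage_restrict, ncard_preimage_restrict]
      refine ncard_le_ncard (fun x hx => ⟨hVmono (hK₀.trans_le hk) hkl hx.1, hx.2⟩) ?_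
      refine finite_of_ncard_ne_zero ?_
      rw [← ncard_preimage_restrict hm ⟨_, hm hy'⟩, h2]
      exact h1.ne'
    -- The number of sheets does not increase as `V k` shrinks. Starting where it is minimal makes
    -- it constant, as a singular sequence requires.
    obtain ⟨K, hK, hmin⟩ := WellFounded.has_min (measure n).wf {k | K₀ ≤ k} ⟨K₀, le_refl K₀⟩
    replace hK : K₀ ≤ K := hK
    have hKpos : 0 < K := hK₀.trans_le hK
    have hnK : ∀ k ≥ K, n k = n K := fun k hk =>
      (hanti K k hK hk).antisymm (not_lt.1 (hmin k (hK.trans hk)))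
    let s : Q.SingularSequence :=
      { K := K
        K_pos := hKpos
        V := V
        n := n K
        n_pos := (hn K hK).1
        z₀ := z₀
        isOpen := fun k hk => hVo k (hK.trans hk)
        decreasing := fun k hk => hVmono (hKpos.trans_le hk) k.le_succ
        component := fun k hk => by
          obtain ⟨y, hy⟩ := hVne (hKpos.trans_le hk)
          exact ⟨y, hVp k (hK.trans hk) hy, hVcomp k (hK.trans hk) y hy⟩
        covering := fun k hk => hnK k hk ▸ (hn k (hK.trans hk)).2
        iInter_closure := by
          rw [← not_nonempty_iff_eq_empty]
          rintro ⟨y, hy⟩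
          simp only [mem_iInter] at hy
          refine hcl ⟨y, mem_iInter₂.2 fun k hk => ?_⟩
          exact closure_mono (hVmono (hK₀.trans_le hk) (le_max_left k K)) (hy _ (le_max_right k K)) }
    -- Since `F ∘ h = F'`, the images `F(V k)` are the `F'(V' k)`, which shrink to `F' x₀` by
    -- continuity.
    have hs : SuperstructuralSingularity.IsRemovable (Quotient.mk _ s) := by
      refine ⟨s, rfl, Q'.F x₀, ?_⟩
      have hFV : ∀ k ≥ K₀, Q.F '' V k = Q'.F '' V' k := fun k hk => by
        rw [hV, image_image]
        exact image_congr fun x hx => hF x (hV'R k hk hx)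
      ext m
      simp only [mem_iInter, mem_singleton_iff]
      constructor
      · intro hm
        by_contra hne
        obtain ⟨A, B, hA, hB, hmA, hxB, hAB⟩ := t2_separation hne
        obtain ⟨L, -, hL⟩ := hWsmall _ ((hB.preimage Q'.F_holo.continuous).mem_nhds hxB)
        have h1 := hm (max K L) (le_max_left _ _)
        change m ∈ closure (Q.F '' V _) at h1
        rw [hFV _ (hK.trans (le_max_left _ _))] at h1
        obtain ⟨_, hwA, x, hx, rfl⟩ := mem_closure_iff.1 h1 A hA hmA
        exact Set.disjoint_left.1 hAB hwA (hL _ (le_max_right _ _) hx.1)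
      · rintro rfl k hk
        change Q'.F x₀ ∈ closure (Q.F '' V k)
        rw [hFV k (hK.trans hk)]
        refine image_closure_subset_closure_image Q'.F_holo.continuous ⟨x₀, ?_, rfl⟩
        exact mem_closure_of_tendsto (tendsto_id.mono_left nhdsWithin_le_nhds)
          (hV'ev (hKpos.trans_le hk))
    refine ⟨.singular _ hs, fun O hO => ?_⟩
    obtain ⟨k, hk, hsub⟩ := RemovableCompletion.mem_nhds_singular.1 hO
    refine (hVev (hKpos.trans_le hk)).mono fun x hx => ?_
    exact hsub (s.point_mem_nhd.2 hx)

/-! ### Maximality of the completion among standard continuations. -/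

section Maximal

variable [CompleteSpace E] [T2Space M] [LocallyCompactSpace M] [IsManifold 𝓘(ℂ, E) ω M]

theorem completion_isStandardRiemannSurface (hU : IsConnected (U : Set Sphere))
    (hf : MDifferentiable 𝓘(ℂ) 𝓘(ℂ, E) f) (z₁ : U) :
    ((regularSurface hU hf z₁).completion
      (regularSurface_isRegular hU hf z₁)).IsStandardRiemannSurface.{e, u, v, u} := by
  refine ⟨isStandard _ hU.nonempty, fun Q' _ => ?_⟩
  set Q := regularSurface hU hf z₁
  have hQ : Q.IsRegular := regularSurface_isRegular hU hf z₁
  -- The complement of the critical points, which are isolated; hence `R` is open and connected and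
  -- the lift to the regular surface is available on it.
  set R : Set Q'.S := {x | mfderiv 𝓘(ℂ) 𝓘(ℂ) Q'.proj x ≠ 0}
  have hRev : ∀ x, R ∈ 𝓝[≠] x := fun x =>
    (Q'.eventually_proj_ne_and_mfderiv_ne hU.nonempty x).mono fun _ h => h.2
  have hR : IsOpen R := by
    rw [isOpen_iff_mem_nhds]
    intro x hx
    rw [← insert_eq_of_mem hx]
    exact insert_mem_nhds_iff.2 (hRev x)
  have hRc : IsPreconnected R := by
    have := isPreconnected_diff_of_discrete (D := Rᶜ) isOpen_univ
      (isPreconnected_univ (α := Q'.S)) fun x _ => by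
        filter_upwards [hRev x] with y hy using not_not.2 hy
    simpa using this
  obtain ⟨h, h1, h2⟩ := exists_regular_lift hU hf z₁ Q' hR hRc (fun x hx => hx)
    fun z => Q'.mfderiv_proj_j_ne_zero z
  have hlim := fun x₀ => exists_tendsto_point hU.nonempty hQ hR (fun x hx => hx)
    (fun x hx => (h1 x hx).1.continuousAt.continuousWithinAt) (fun x hx => (h1 x hx).2.1)
    (fun x hx => (h1 x hx).2.2) (hRev x₀)
  -- `H` is defined at every point as the limit of the lift along the punctured neighbourhood. It
  -- agrees with the lift on `R` and is continuous elsewhere by construction, so it is holomorphic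
  -- by removability.
  choose H hH using hlim
  have hHR : ∀ x ∈ R, H x = .point (h x) := fun x hx =>
    tendsto_nhds_unique (hH x) (((RemovableCompletion.isOpenEmbedding_point.continuous.tendsto
      _).comp (h1 x hx).1.continuousAt).mono_left nhdsWithin_le_nhds)
  have hHd : ∀ x ∈ R, MDifferentiableAt 𝓘(ℂ) 𝓘(ℂ) H x := fun x hx => by
    have h3 : MDifferentiableAt 𝓘(ℂ) 𝓘(ℂ) (RemovableCompletion.point ∘ h) x :=
      MDifferentiableAt.comp x (RemovableCompletion.mdifferentiable_point hQ _) (h1 x hx).1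
    refine h3.congr_of_eventuallyEq ?_
    filter_upwards [hR.mem_nhds hx] with y hy using hHR y hy
  have := RemovableCompletion.isManifold hQ
  refine ⟨H, fun x => ?_, fun z => ?_⟩
  · refine mdifferentiableAt_of_punctured ?_ ?_
    · refine continuousAt_iff_punctured_nhds.2 ((hH x).congr' ?_)
      filter_upwards [hRev x] with y hy using (hHR y hy).symm
    · filter_upwards [hRev x] with y hy using hHd y hy
  · rw [hHR _ (Q'.mfderiv_proj_j_ne_zero z), h2]
    rfl

end Maximal

end Continuation

end PathCont
end

theorem mainTheorem9 {E : Type e} [NormedAddCommGroup E] [NormedSpace ℂ E]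
    [FiniteDimensional ℂ E] {M : Type u} [TopologicalSpace M] [T2Space M] [ConnectedSpace M]
    [ChartedSpace E M] [IsManifold 𝓘(ℂ, E) ω M]
    (U : TopologicalSpace.Opens PathCont.Sphere) (hU : IsConnected (U : Set PathCont.Sphere))
    (f : U → M) (hf : MDifferentiable 𝓘(ℂ) 𝓘(ℂ, E) f) :
    ∃ Qr Qs : PathCont.Continuation.{e, u, u} E U f,
      Qr.IsRegularRiemannSurface.{e, u, v, u} ∧ Qs.IsStandardRiemannSurface.{e, u, v, u} ∧
        Qr.IsRemovableExtension Qs ∧ SecondCountableTopology Qs.S := by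
  -- Finite dimension enters twice: completeness for the analyticity of holomorphic maps, and local
  -- compactness of `M` for the continuity of the extended `F`.
  have : CompleteSpace E := FiniteDimensional.complete ℂ E
  have : ProperSpace E := FiniteDimensional.proper ℂ E
  have : LocallyCompactSpace M := ChartedSpace.locallyCompactSpace E M
  obtain ⟨z, hz⟩ := hU.nonempty
  have hreg := PathCont.regularSurface_isRegular hU hf ⟨z, hz⟩
  exact ⟨PathCont.regularSurface hU hf ⟨z, hz⟩, PathCont.Continuation.completion _ hreg,
    PathCont.regularSurface_isRegularRiemannSurface hU hf ⟨z, hz⟩,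
    PathCont.Continuation.completion_isStandardRiemannSurface hU hf ⟨z, hz⟩,
    PathCont.Continuation.isRemovableExtension_completion _ hreg,
    PathCont.Continuation.secondCountableTopology _ hU.nonempty⟩
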